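/- **Model.** Running times refer to a unit-cost random access machine with integer and real memory cells, which can add, subtract and compare integers, and add, subtract and compare reals; memory outside the input is initially arbitrary, and the time of a run is the number of executed steps plus the size of the input (each input number has to be read in). Let $\mathrm{MST}(m)$ denote a bound on the worst-case running time, on graphs with $m$ edges, of a program that finds a minimum spanning tree in every connected graph with positive edge weights (loops and parallel edges allowed). **Setting.** Let $B=(V,E)$ be a simple graph with $m=|E|$ edges, let $R$ be a finite family of $p=|R|$ arcs (requests) on $V$, and let $c:E\cup R\to\mathbb{R}$ be a positive cost function. Let $k$ be the number of branch vertices of $B$, i.e. of vertices of degree at least $3$ in $B$. Fix an arbitrary orientation of each edge. A *circulation* in the mixed graph $G=(V,E\cup R)$ is a function $f:E\cup R\to\mathbb{Z}$ with $\sum_{e\in\delta^-(v)}f(e)=\sum_{e\in\delta^+(v)}f(e)$ for every $v\in V$. A *tour* is a walk in $G$ (edges may be traversed in both directions, arcs only forward) that starts and ends at the same vertex; its cost is the sum of the costs of its steps. The *homology class* $[f]$ is the set of all tours such that, for each edge $e$, the number of forward traversals minus the number of backward traversals of $e$ is $f(e)$, and each arc $a$ is traversed exactly $f(a)$ times. **Theorem.**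 There is an algorithm which, given $G$, $c$ and a circulation $f$ with $f(a)=1$ for every $a\in R$ and $[f]\neq\emptyset$, finds a minimum-cost tour in $[f]$ in $O(p+2^k\,\mathrm{MST}(m))$ time. Here the tour is returned through the numbers of times that it traverses each edge forward, each edge backward, and each arc. The constant in the $O$ does not depend on $G$, $c$, $f$ or $k$. -/

import Mathlib

open Finset

namespace StackerCrane

noncomputable section

/-! ### The machine model

A random access machine with unit cost.  It has integer arrays and real arrays, which are named by
natural numbers and indexed by integers.  Integers and reals can be added, subtracted and compared;
the machine has no multiplication, no rounding, and no conversion between the two types.  A program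
names only finitely many arrays, and a scalar variable is a cell of an array with a constant index.
-/

/-- The contents of the memory. -/
structure State where
  int : ℕ → ℤ → ℤ
  real : ℕ → ℤ → ℝ

/-- Integer expressions. -/
inductive IExpr where
  | const (c : ℤ)
  | get (a : ℕ) (i : IExpr)
  | add (x y : IExpr)
  | sub (x y : IExpr)

/-- Real expressions. -/
inductive RExpr where
  | zero
  | get (a : ℕ) (i : IExpr)
  | add (x y : RExpr)
  | sub (x y : RExpr)

/-- Tests. -/
inductive Test where
  | intLE (x y : IExpr)
  | realLE (x y : RExpr)
  | neg (b : Test)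
  | conj (b c : Test)

/-- Programs. -/
inductive Prog where
  | skip
  | setInt (a : ℕ) (i x : IExpr)
  | setReal (a : ℕ) (i : IExpr) (x : RExpr)
  | seq (P Q : Prog)
  | ifte (b : Test) (P Q : Prog)
  | while (b : Test) (P : Prog)

def IExpr.eval (σ : State) : IExpr → ℤ
  | .const c => c
  | .get a i => σ.int a (i.eval σ)
  | .add x y => x.eval σ + y.eval σ
  | .sub x y => x.eval σ - y.eval σ

def RExpr.eval (σ : State) : RExpr → ℝ
  | .zero => 0
  | .get a i => σ.real a (i.eval σ)
  | .add x y => x.eval σ + y.eval σ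
  | .sub x y => x.eval σ - y.eval σ

def Test.holds (σ : State) : Test → Prop
  | .intLE x y => x.eval σ ≤ y.eval σ
  | .realLE x y => x.eval σ ≤ y.eval σ
  | .neg b => ¬ b.holds σ
  | .conj b c => b.holds σ ∧ c.holds σ

/-- Write `x` into cell `i` of the integer array `a`. -/
def State.putInt (σ : State) (a : ℕ) (i x : ℤ) : State :=
  { σ with int := Function.update σ.int a (Function.update (σ.int a) i x) }

/-- Write `x` into cell `i` of the real array `a`. -/
def State.putReal (σ : State) (a : ℕ) (i : ℤ) (x : ℝ) : State :=
  { σ with real := Function.update σ.real a (Function.update (σ.real a) i x) }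

/-- `Exec P σ t σ'`: started in the state `σ`, the program `P` stops in the state `σ'` after exactly
`t` steps.  Every assignment, every `skip` and every evaluation of a test is one step (the
expressions in a program are part of the program, so their size is a constant). -/
inductive Exec : Prog → State → ℕ → State → Prop
  | skip (σ : State) : Exec .skip σ 1 σ
  | setInt (σ : State) (a : ℕ) (i x : IExpr) :
      Exec (.setInt a i x) σ 1 (σ.putInt a (i.eval σ) (x.eval σ))
  | setReal (σ : State) (a : ℕ) (i : IExpr) (x : RExpr) :
      Exec (.setReal a i x) σ 1 (σ.putReal a (i.eval σ) (x.eval σ))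
  | seq {P Q : Prog} {σ₁ σ₂ σ₃ : State} {s t : ℕ} :
      Exec P σ₁ s σ₂ → Exec Q σ₂ t σ₃ → Exec (.seq P Q) σ₁ (s + t) σ₃
  | ifTrue {b : Test} {P Q : Prog} {σ σ' : State} {t : ℕ} :
      b.holds σ → Exec P σ t σ' → Exec (.ifte b P Q) σ (1 + t) σ'
  | ifFalse {b : Test} {P Q : Prog} {σ σ' : State} {t : ℕ} :
      ¬ b.holds σ → Exec Q σ t σ' → Exec (.ifte b P Q) σ (1 + t) σ'
  | whileTrue {b : Test} {P : Prog} {σ₁ σ₂ σ₃ : State} {s t : ℕ} :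
      b.holds σ₁ → Exec P σ₁ s σ₂ → Exec (.while b P) σ₂ t σ₃ →
        Exec (.while b P) σ₁ (1 + s + t) σ₃
  | whileFalse {b : Test} {P : Prog} {σ : State} :
      ¬ b.holds σ → Exec (.while b P) σ 1 σ

/-! ### Minimum spanning trees -/

/-- A finite undirected graph with vertices `0, …, n - 1`, edges `0, …, m - 1` (parallel edges and
loops are allowed) and positive edge weights. -/
structure WeightedGraph where
  n : ℕ
  m : ℕ
  ends : Fin m → Fin n × Fin n
  weight : Fin m → ℝ
  weight_pos : ∀ e, 0 < weight e

namespace WeightedGraph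

/-- Any two vertices are joined by a path of edges in `S`. -/
def Spans (G : WeightedGraph) (S : Finset (Fin G.m)) : Prop :=
  ∀ u v : Fin G.n, Relation.EqvGen (fun x y => ∃ e ∈ S, G.ends e = (x, y)) u v

def Connected (G : WeightedGraph) : Prop := 0 < G.n ∧ G.Spans univ

/-- A spanning tree: the `n` vertices are connected by `n - 1` edges. -/
def IsSpanningTree (G : WeightedGraph) (S : Finset (Fin G.m)) : Prop :=
  G.Spans S ∧ S.card + 1 = G.n

def IsMST (G : WeightedGraph) (S : Finset (Fin G.m)) : Prop :=
  G.IsSpanningTree S ∧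
    ∀ S', G.IsSpanningTree S' → ∑ e ∈ S, G.weight e ≤ ∑ e ∈ S', G.weight e

/-- The memory holds `G` as an input; all other cells are arbitrary. -/
def LoadedIn (G : WeightedGraph) (σ : State) : Prop :=
  σ.int 0 0 = G.n ∧ σ.int 0 1 = G.m ∧
  ∀ e : Fin G.m, σ.int 1 (e : ℕ) = ((G.ends e).1 : ℕ) ∧ σ.int 2 (e : ℕ) = ((G.ends e).2 : ℕ) ∧
    σ.real 0 (e : ℕ) = G.weight e

/-- The number of memory cells that the input occupies. -/
def inputSize (G : WeightedGraph) : ℕ := 2 + 3 * G.m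

end WeightedGraph

/-- The program `M` finds a minimum spanning tree in every connected graph, and `T m` bounds its
worst-case running time on graphs with `m` edges.  The running time is the number of steps plus the
size of the input (as each number of the input has to be read in).  The tree is returned as a 0-1
vector in the integer array 3. -/
def FindsMST (M : Prog) (T : ℕ → ℕ) : Prop :=
  ∀ G : WeightedGraph, G.Connected → ∀ σ : State, G.LoadedIn σ →
    ∃ t σ', Exec M σ t σ' ∧ G.inputSize + t ≤ T G.m ∧
      ∃ S, G.IsMST S ∧ ∀ e : Fin G.m, σ'.int 3 (e : ℕ) = if e ∈ S then 1 else 0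

/-! ### Mixed graphs, circulations and tours -/

/-- The mixed graph `(V, E ∪ R)` of the stacker crane problem, `V = {0, …, n - 1}`, with `m`
undirected edges (the elements `Sum.inl e`) and `p` request arcs (the elements `Sum.inr a`).  The
base graph `(V, E)` is simple.  The forward direction of an edge is from its `tail` to its `head`. -/
structure MixedGraph where
  n : ℕ
  m : ℕ
  p : ℕ
  tail : Fin m ⊕ Fin p → Fin n
  head : Fin m ⊕ Fin p → Fin n
  cost : Fin m ⊕ Fin p → ℝ
  cost_pos : ∀ x, 0 < cost x
  no_loop : ∀ e : Fin m, tail (.inl e) ≠ head (.inl e)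
  no_parallel : Function.Injective fun e : Fin m => s(tail (.inl e), head (.inl e))

namespace MixedGraph

/-- The degree of a vertex in the base graph. -/
def baseDegree (G : MixedGraph) (v : Fin G.n) : ℕ :=
  #{e : Fin G.m | v = G.tail (.inl e) ∨ v = G.head (.inl e)}

/-- The number of branch vertices of the base graph. -/
def branchCount (G : MixedGraph) : ℕ := #{v : Fin G.n | 3 ≤ G.baseDegree v}

def IsCirculation (G : MixedGraph) (f : Fin G.m ⊕ Fin G.p → ℤ) : Prop :=
  ∀ v : Fin G.n, ∑ x with G.head x = v, f x = ∑ x with G.tail x = v, f x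

/-- One step of a walk: an edge or an arc is traversed forward, or an edge is traversed backward. -/
inductive Step (G : MixedGraph) where
  | along (x : Fin G.m ⊕ Fin G.p)
  | back (e : Fin G.m)
  deriving DecidableEq

variable {G : MixedGraph}

def Step.source : G.Step → Fin G.n
  | .along x => G.tail x
  | .back e => G.head (.inl e)

def Step.target : G.Step → Fin G.n
  | .along x => G.head x
  | .back e => G.tail (.inl e)

def Step.cost : G.Step → ℝ
  | .along x => G.cost x
  | .back e => G.cost (.inl e)

/-- The steps in the list form a walk from `u` to `v`. -/
def IsWalk : Fin G.n → List G.Step → Fin G.n → Prop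
  | u, [], v => u = v
  | u, s :: W, v => s.source = u ∧ IsWalk s.target W v

/-- A tour is a walk that starts and ends at the same vertex. -/
def IsTour (W : List G.Step) : Prop := ∃ v, IsWalk v W v

def tourCost (W : List G.Step) : ℝ := (W.map Step.cost).sum

/-- The homology class `[f]`: the tours that traverse each edge `e` forward `f e` times more often
than backward, and each arc `a` exactly `f a` times. -/
def homologyClass (f : Fin G.m ⊕ Fin G.p → ℤ) : Set (List G.Step) :=
  {W | IsTour W ∧
    (∀ e : Fin G.m, (W.count (.along (.inl e)) : ℤ) - W.count (.back e) = f (.inl e)) ∧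
    ∀ a : Fin G.p, (W.count (.along (.inr a)) : ℤ) = f (.inr a)}

def IsMinCostTourIn (W : List G.Step) (f : Fin G.m ⊕ Fin G.p → ℤ) : Prop :=
  W ∈ homologyClass f ∧ ∀ W' ∈ homologyClass f, tourCost W ≤ tourCost W'

/-- The memory holds `G` and `f` as an input; all other cells are arbitrary. -/
def LoadedIn (G : MixedGraph) (f : Fin G.m ⊕ Fin G.p → ℤ) (σ : State) : Prop :=
  σ.int 0 0 = G.n ∧ σ.int 0 1 = G.m ∧ σ.int 0 2 = G.p ∧
  (∀ e : Fin G.m, σ.int 1 (e : ℕ) = (G.tail (.inl e) : ℕ) ∧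
    σ.int 2 (e : ℕ) = (G.head (.inl e) : ℕ) ∧
    σ.int 3 (e : ℕ) = f (.inl e) ∧ σ.real 0 (e : ℕ) = G.cost (.inl e)) ∧
  ∀ a : Fin G.p, σ.int 4 (a : ℕ) = (G.tail (.inr a) : ℕ) ∧
    σ.int 5 (a : ℕ) = (G.head (.inr a) : ℕ) ∧
    σ.int 6 (a : ℕ) = f (.inr a) ∧ σ.real 1 (a : ℕ) = G.cost (.inr a)

/-- The number of memory cells that the input, `G` together with a circulation, occupies. -/
def inputSize (G : MixedGraph) : ℕ := 3 + 4 * G.m + 4 * G.p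

/-- The memory holds the tour `W` of a homology class as an output: the integer arrays 7 and 8 list
how often `W` traverses each edge forward and backward, and array 9 how often it traverses each
arc. -/
def ReturnedIn (W : List G.Step) (σ : State) : Prop :=
  (∀ e : Fin G.m, σ.int 7 (e : ℕ) = W.count (.along (.inl e)) ∧
    σ.int 8 (e : ℕ) = W.count (.back e)) ∧
  ∀ a : Fin G.p, σ.int 9 (a : ℕ) = W.count (.along (.inr a))

end MixedGraph

end

end StackerCrane

open StackerCrane

/-!
A tour in the homology class of `f` traverses each edge and arc `|f|` times, up to additional pairs of
traversals of edges in both directions.  A balanced connected multiset of steps is a closed walk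
(`MixedGraph.exists_eulerian`), so a cheapest tour arises from a cheapest set of edges outside the
support of `f` that connects the support: each of these edges is traversed once in both directions
(`MixedGraph.exists_tour`, `MixedGraph.exists_connects`).  This is a Steiner tree problem
(`MixedGraph.steiner`) in which the edges of the support are free of charge.

*Reduction to minimum spanning trees.*  In an optimal Steiner tree no Steiner vertex has degree one
(`Steiner.Optimal.exists_ne`), so the vertices of degree two outside the support group the edges into
threads, which are bought as a whole or not at all.  Contract the free edges and all edges of each
thread but one, its representative, which gets the cost of the thread; this keeps the number of edges,
as loops are allowed.  What remains open is which of the branch vertices of degree at least three are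
used.  For each of the `2 ^ k` sets of branch vertices, and together with the leaves, take the set `X`
of excluded vertices, and give the threads that meet `X`, the dead ones, a cost `b` above all others.
The contracted graph is connected, and a spanning tree of it contains at least `#X` representatives of
dead threads.  If there are no more, then the living threads in the tree form a feasible purchase
(`Steiner.feasible_purchase`, where the components are counted).  Conversely, an optimal purchase can be
extended to a connected subgraph by `#X` dead representatives if `X` consists of the vertices that it
avoids (`Steiner.Optimal.exists_spans`).  Hence the best among the minimum spanning trees, at their cost
minus `#X * b`, yields an optimal purchase (`Steiner.optimal_of_best`).

*The program.*  `Runs P σ Q` says that `P` stops when started in `σ`, with running time and final state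
as required by `Q`; the rule `runs_while` bounds the time by a potential.  Components of a graph are
computed by a depth-first search in linear time, independently of the number of isolated vertices
(`runs_labelComponents`); this serves to find the component of the support, the threads (as components
of a graph on the edges) and the contracted graph.  A binary counter runs through the sets of branch
vertices (`runs_tryAll`), and for each of them the given program for minimum spanning trees is run on
arrays of its own, with renamed arrays (`Exec.shift`).  Apart from these runs the time is
`O(2 ^ k * (m + 1) + p)`; as a program for minimum spanning trees has to read its input
(`FindsMST.le`), this is within the bound.
-/

namespace StackerCrane

/-! ### Total correctness of programs -/

/-- The program stops when it is started in the state `σ`, and the running time and the final state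
satisfy `Q`. -/
def Runs (P : Prog) (σ : State) (Q : ℕ → State → Prop) : Prop :=
  ∃ t σ', Exec P σ t σ' ∧ Q t σ'

theorem Runs.mono {P : Prog} {σ : State} {Q Q' : ℕ → State → Prop} (h : Runs P σ Q)
    (hQ : ∀ t σ', Q t σ' → Q' t σ') : Runs P σ Q' := by
  obtain ⟨t, σ', he, hq⟩ := h
  exact ⟨t, σ', he, hQ _ _ hq⟩

theorem runs_skip {σ : State} {Q : ℕ → State → Prop} : Runs .skip σ Q ↔ Q 1 σ :=
  ⟨fun ⟨_, _, he, hq⟩ => by cases he; exact hq, fun h => ⟨_, _, .skip σ, h⟩⟩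

theorem runs_setInt {σ : State} {a : ℕ} {i x : IExpr} {Q : ℕ → State → Prop} :
    Runs (.setInt a i x) σ Q ↔ Q 1 (σ.putInt a (i.eval σ) (x.eval σ)) :=
  ⟨fun ⟨_, _, he, hq⟩ => by cases he; exact hq, fun h => ⟨_, _, .setInt σ a i x, h⟩⟩

theorem runs_setReal {σ : State} {a : ℕ} {i : IExpr} {x : RExpr} {Q : ℕ → State → Prop} :
    Runs (.setReal a i x) σ Q ↔ Q 1 (σ.putReal a (i.eval σ) (x.eval σ)) :=
  ⟨fun ⟨_, _, he, hq⟩ => by cases he; exact hq, fun h => ⟨_, _, .setReal σ a i x, h⟩⟩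

theorem runs_seq {σ : State} {P P' : Prog} {Q : ℕ → State → Prop} :
    Runs (.seq P P') σ Q ↔ Runs P σ fun s σ' => Runs P' σ' fun t σ'' => Q (s + t) σ'' := by
  constructor
  · rintro ⟨_, _, he, hq⟩
    cases he with
    | seq h1 h2 => exact ⟨_, _, h1, _, _, h2, hq⟩
  · rintro ⟨_, _, h1, _, _, h2, hq⟩
    exact ⟨_, _, .seq h1 h2, hq⟩

theorem runs_ifte {σ : State} {b : Test} {P P' : Prog} {Q : ℕ → State → Prop} :
    Runs (.ifte b P P') σ Q ↔ (b.holds σ → Runs P σ fun t σ' => Q (1 + t) σ') ∧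
      (¬ b.holds σ → Runs P' σ fun t σ' => Q (1 + t) σ') := by
  constructor
  · rintro ⟨_, _, he, hq⟩
    cases he with
    | ifTrue hb h => exact ⟨fun _ => ⟨_, _, h, hq⟩, fun h' => absurd hb h'⟩
    | ifFalse hb h => exact ⟨fun h' => absurd h' hb, fun _ => ⟨_, _, h, hq⟩⟩
  · rintro ⟨h1, h2⟩
    by_cases hb : b.holds σ
    · obtain ⟨_, _, h, hq⟩ := h1 hb
      exact ⟨_, _, .ifTrue hb h, hq⟩
    · obtain ⟨_, _, h, hq⟩ := h2 hb
      exact ⟨_, _, .ifFalse hb h, hq⟩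

/-- The index `n` of the invariant is a potential that pays for the iterations: each of them decreases
it by at least the time of the loop body plus one, for the test. -/
theorem runs_while {b : Test} {P : Prog} (I : ℕ → State → Prop)
    (h : ∀ n σ, I n σ → b.holds σ → Runs P σ fun s σ' => ∃ n', I n' σ' ∧ n' + s + 1 ≤ n)
    {n : ℕ} {σ : State} (hI : I n σ) :
    Runs (.while b P) σ fun t σ' => ∃ n', I n' σ' ∧ ¬ b.holds σ' ∧ t + n' ≤ n + 1 := by
  induction n using Nat.strong_induction_on generalizing σ with
  | _ n ih =>
    by_cases hb : b.holds σ
    · obtain ⟨s, σ', he, n', hI', hμ⟩ := h n σ hI hb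
      obtain ⟨t, σ'', he', n'', h1, h2, h3⟩ := ih n' (by omega) hI'
      exact ⟨_, _, .whileTrue hb he he', n'', h1, h2, by omega⟩
    · exact ⟨_, _, .whileFalse hb, n, hI, hb, by omega⟩

/-- Execute the programs of a list one after the other. -/
def block : List Prog → Prog
  | [] => .skip
  | P :: L => .seq P (block L)

theorem runs_block_nil {σ : State} {Q : ℕ → State → Prop} : Runs (block []) σ Q ↔ Q 1 σ :=
  runs_skip

theorem runs_block_cons {σ : State} {P : Prog} {L : List Prog} {Q : ℕ → State → Prop} :
    Runs (block (P :: L)) σ Q ↔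
      Runs P σ fun s σ' => Runs (block L) σ' fun t σ'' => Q (s + t) σ'' :=
  runs_seq

/-! ### Memory access -/

theorem putInt_int (σ : State) (a : ℕ) (i x : ℤ) (a' : ℕ) :
    (σ.putInt a i x).int a' = if a' = a then Function.update (σ.int a) i x else σ.int a' := by
  simp [State.putInt, Function.update_apply]

theorem putInt_real (σ : State) (a : ℕ) (i x : ℤ) : (σ.putInt a i x).real = σ.real := rfl

theorem putReal_int (σ : State) (a : ℕ) (i : ℤ) (x : ℝ) : (σ.putReal a i x).int = σ.int := rfl

theorem putReal_real (σ : State) (a : ℕ) (i : ℤ) (x : ℝ) (a' : ℕ) :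
    (σ.putReal a i x).real a' =
      if a' = a then Function.update (σ.real a) i x else σ.real a' := by
  simp [State.putReal, Function.update_apply]

attribute [simp] runs_skip runs_setInt runs_setReal runs_seq runs_ifte runs_block_nil
  runs_block_cons putInt_int putInt_real putReal_int putReal_real IExpr.eval RExpr.eval Test.holds

/-- The integer arrays that a program may write to. -/
def Prog.ints : Prog → List ℕ
  | .skip => []
  | .setInt a _ _ => [a]
  | .setReal _ _ _ => []
  | .seq P Q => P.ints ++ Q.ints
  | .ifte _ P Q => P.ints ++ Q.ints
  | .while _ P => P.ints

/-- The real arrays that a program may write to. -/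
def Prog.reals : Prog → List ℕ
  | .skip => []
  | .setInt _ _ _ => []
  | .setReal a _ _ => [a]
  | .seq P Q => P.reals ++ Q.reals
  | .ifte _ P Q => P.reals ++ Q.reals
  | .while _ P => P.reals

/-- The two states agree on the arrays outside the two lists. -/
def SameOff (li lr : List ℕ) (σ σ' : State) : Prop :=
  (∀ a ∉ li, σ'.int a = σ.int a) ∧ ∀ a ∉ lr, σ'.real a = σ.real a

theorem SameOff.refl (li lr : List ℕ) (σ : State) : SameOff li lr σ σ :=
  ⟨fun _ _ => rfl, fun _ _ => rfl⟩

theorem SameOff.trans {li lr : List ℕ} {σ₁ σ₂ σ₃ : State} (h : SameOff li lr σ₁ σ₂)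
    (h' : SameOff li lr σ₂ σ₃) : SameOff li lr σ₁ σ₃ :=
  ⟨fun a ha => (h'.1 a ha).trans (h.1 a ha), fun a ha => (h'.2 a ha).trans (h.2 a ha)⟩

theorem SameOff.mono {li lr li' lr' : List ℕ} {σ₁ σ₂ : State} (h : SameOff li lr σ₁ σ₂)
    (hi : li ⊆ li') (hr : lr ⊆ lr') : SameOff li' lr' σ₁ σ₂ :=
  ⟨fun a ha => h.1 a fun h' => ha (hi h'), fun a ha => h.2 a fun h' => ha (hr h')⟩

theorem Exec.sameOff {P : Prog} {σ σ' : State} {t : ℕ} (h : Exec P σ t σ') :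
    SameOff P.ints P.reals σ σ' := by
  induction h with
  | skip σ => exact .refl _ _ _
  | setInt σ a i x =>
    refine ⟨fun b hb => ?_, fun _ _ => rfl⟩
    simp only [Prog.ints, List.mem_singleton] at hb
    simp [hb]
  | setReal σ a i x =>
    refine ⟨fun _ _ => rfl, fun b hb => ?_⟩
    simp only [Prog.reals, List.mem_singleton] at hb
    simp [hb]
  | seq _ _ ih1 ih2 =>
    exact (ih1.mono (by simp [Prog.ints]) (by simp [Prog.reals])).trans
      (ih2.mono (by simp [Prog.ints]) (by simp [Prog.reals]))
  | ifTrue _ _ ih => exact ih.mono (by simp [Prog.ints]) (by simp [Prog.reals])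
  | ifFalse _ _ ih => exact ih.mono (by simp [Prog.ints]) (by simp [Prog.reals])
  | whileTrue _ _ _ ih1 ih2 => exact SameOff.trans ih1 ih2
  | whileFalse _ => exact .refl _ _ _

theorem Runs.sameOff {P : Prog} {σ : State} {Q : ℕ → State → Prop} (h : Runs P σ Q) :
    Runs P σ fun t σ' => Q t σ' ∧ SameOff P.ints P.reals σ σ' := by
  obtain ⟨t, σ', he, hq⟩ := h
  exact ⟨t, σ', he, hq, he.sameOff⟩

/-- `for iv := 0 to nv[j] - 1 do P`, where the cell `0` of the array `iv` is the loop variable. -/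
def forLoop (iv nv : ℕ) (j : ℤ) (P : Prog) : Prog :=
  .seq (.setInt iv (.const 0) (.const 0))
    (.while (.neg (.intLE (.get nv (.const j)) (.get iv (.const 0))))
      (.seq P (.setInt iv (.const 0) (.add (.get iv (.const 0)) (.const 1)))))

/-- The rule for a loop in which an iteration costs `c` amortized steps; the second index of the
invariant is the potential. -/
theorem runs_forLoop_amortized {iv nv : ℕ} {j : ℤ} {P : Prog} {σ₀ : State} (q c : ℕ)
    (I : ℕ → ℕ → State → Prop) (hq : σ₀.int nv j = q) (hiv : iv ∉ P.ints)
    (hnv : nv ∉ iv :: P.ints) {n₀ : ℕ} (h0 : I 0 n₀ (σ₀.putInt iv 0 0))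
    (hstep : ∀ i < q, ∀ n σ, SameOff (iv :: P.ints) P.reals σ₀ σ → σ.int iv 0 = i → I i n σ →
      Runs P σ fun t σ' => ∃ n', t + n' ≤ c + n ∧ I (i + 1) n' (σ'.putInt iv 0 (i + 1))) :
    Runs (forLoop iv nv j P) σ₀ fun t σ' => ∃ n, t + n ≤ (c + 2) * q + 2 + n₀ ∧
      SameOff (iv :: P.ints) P.reals σ₀ σ' ∧ I q n σ' := by
  rw [List.mem_cons, not_or] at hnv
  have key := runs_while (b := .neg (.intLE (.get nv (.const j)) (.get iv (.const 0))))
    (P := .seq P (.setInt iv (.const 0) (.add (.get iv (.const 0)) (.const 1))))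
    (fun n σ => SameOff (iv :: P.ints) P.reals σ₀ σ ∧ ∃ i k : ℕ, i ≤ q ∧ σ.int iv 0 = i ∧
      I i k σ ∧ n = (c + 2) * (q - i) + k) ?_ (σ := σ₀.putInt iv 0 0)
      (n := (c + 2) * q + n₀) ?_
  · rw [forLoop, runs_seq, runs_setInt]
    refine key.mono ?_
    rintro t σ' ⟨n, ⟨hs, i, k, hi, hiv', hI, hn⟩, hb, ht⟩
    simp only [Test.holds, IExpr.eval, not_not, hs.1 nv (by simp [hnv]), hq, hiv'] at hb
    obtain rfl : i = q := by omega
    refine ⟨k, ?_, hs, hI⟩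
    rw [Nat.sub_self] at hn
    omega
  · rintro n σ ⟨hs, i, k, hi, hiv', hI, rfl⟩ hb
    simp only [Test.holds, IExpr.eval, hs.1 nv (by simp [hnv]), hq, hiv'] at hb
    have hlt : i < q := by omega
    rw [runs_seq]
    refine (hstep i hlt k σ hs hiv' hI).sameOff.mono ?_
    rintro t σ' ⟨⟨k', ht, hI'⟩, hs'⟩
    have h2 : σ'.int iv 0 = i := by rw [hs'.1 iv hiv, hiv']
    simp only [runs_setInt, IExpr.eval, h2]
    refine ⟨_, ⟨?_, i + 1, k', hlt, by simp, hI', rfl⟩, ?_⟩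
    · refine (hs.trans (hs'.mono (by simp) (by simp))).trans ⟨fun a ha => ?_, fun _ _ => rfl⟩
      have : a ≠ iv := fun h => ha (by simp [h])
      simp [this]
    · obtain ⟨d, rfl⟩ : ∃ d, q = i + 1 + d := ⟨q - (i + 1), by omega⟩
      have e1 : i + 1 + d - (i + 1) = d := by omega
      have e2 : i + 1 + d - i = d + 1 := by omega
      rw [e1, e2, mul_add]
      omega
  · refine ⟨⟨fun a ha => ?_, fun _ _ => rfl⟩, 0, n₀, Nat.zero_le _, by simp, h0, by simp⟩
    have : a ≠ iv := fun h => ha (by simp [h])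
    simp [this]

theorem runs_forLoop {iv nv : ℕ} {j : ℤ} {P : Prog} {σ₀ : State} (q c : ℕ)
    (I : ℕ → State → Prop) (hq : σ₀.int nv j = q) (hiv : iv ∉ P.ints) (hnv : nv ∉ iv :: P.ints)
    (h0 : I 0 (σ₀.putInt iv 0 0))
    (hstep : ∀ i < q, ∀ σ, SameOff (iv :: P.ints) P.reals σ₀ σ → σ.int iv 0 = i → I i σ →
      Runs P σ fun t σ' => t ≤ c ∧ I (i + 1) (σ'.putInt iv 0 (i + 1))) :
    Runs (forLoop iv nv j P) σ₀ fun t σ' => t ≤ (c + 2) * q + 2 ∧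
      SameOff (iv :: P.ints) P.reals σ₀ σ' ∧ I q σ' := by
  refine (runs_forLoop_amortized q c (fun i _ σ => I i σ) hq hiv hnv (n₀ := 0) h0
    fun i hi _ σ hs h h' => (hstep i hi σ hs h h').mono ?_).mono ?_
  · exact fun t σ' h => ⟨0, by omega, h.2⟩
  · rintro t σ' ⟨n, h, h'⟩
    exact ⟨by omega, h'⟩

/-! ### Renaming of arrays -/

/-- The expression with `K` added to the names of all arrays. -/
def IExpr.shift (K : ℕ) : IExpr → IExpr
  | .const c => .const c
  | .get a i => .get (a + K) (i.shift K)
  | .add x y => .add (x.shift K) (y.shift K)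
  | .sub x y => .sub (x.shift K) (y.shift K)

/-- The real expression with `K` added to the names of all arrays. -/
def RExpr.shift (K : ℕ) : RExpr → RExpr
  | .zero => .zero
  | .get a i => .get (a + K) (i.shift K)
  | .add x y => .add (x.shift K) (y.shift K)
  | .sub x y => .sub (x.shift K) (y.shift K)

/-- The test with `K` added to the names of all arrays. -/
def Test.shift (K : ℕ) : Test → Test
  | .intLE x y => .intLE (x.shift K) (y.shift K)
  | .realLE x y => .realLE (x.shift K) (y.shift K)
  | .neg b => .neg (b.shift K)
  | .conj b c => .conj (b.shift K) (c.shift K)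

/-- The program with `K` added to the names of all arrays. -/
def Prog.shift (K : ℕ) : Prog → Prog
  | .skip => .skip
  | .setInt a i x => .setInt (a + K) (i.shift K) (x.shift K)
  | .setReal a i x => .setReal (a + K) (i.shift K) (x.shift K)
  | .seq P Q => .seq (P.shift K) (Q.shift K)
  | .ifte b P Q => .ifte (b.shift K) (P.shift K) (Q.shift K)
  | .while b P => .while (b.shift K) (P.shift K)

/-- The part of the memory that a program shifted by `K` sees. -/
def State.drop (K : ℕ) (σ : State) : State :=
  ⟨fun a => σ.int (a + K), fun a => σ.real (a + K)⟩

/-- Put the memory `τ` in place of the arrays from `K` on. -/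
def State.graft (K : ℕ) (σ τ : State) : State :=
  ⟨fun a => if a < K then σ.int a else τ.int (a - K),
    fun a => if a < K then σ.real a else τ.real (a - K)⟩

variable {K : ℕ} {σ τ : State}

theorem State.drop_graft : (σ.graft K τ).drop K = τ := by
  simp [drop, graft]

theorem State.graft_drop : σ.graft K (σ.drop K) = σ := by
  cases σ
  simp only [drop, graft, State.mk.injEq]
  constructor <;> funext a <;> split_ifs with h
  · rfl
  · rw [Nat.sub_add_cancel (not_lt.mp h)]
  · rfl
  · rw [Nat.sub_add_cancel (not_lt.mp h)]

theorem IExpr.eval_shift (x : IExpr) : (x.shift K).eval (σ.graft K τ) = x.eval τ := by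
  induction x with
  | const c => rfl
  | get a i ih => simp [shift, State.graft, ← ih]
  | add x y ih1 ih2 => simp [shift, ih1, ih2]
  | sub x y ih1 ih2 => simp [shift, ih1, ih2]

theorem RExpr.eval_shift (x : RExpr) : (x.shift K).eval (σ.graft K τ) = x.eval τ := by
  induction x with
  | zero => rfl
  | get a i => simp [shift, State.graft, ← IExpr.eval_shift (K := K) (σ := σ) (τ := τ) i]
  | add x y ih1 ih2 => simp [shift, ih1, ih2]
  | sub x y ih1 ih2 => simp [shift, ih1, ih2]

theorem Test.holds_shift (b : Test) : (b.shift K).holds (σ.graft K τ) ↔ b.holds τ := by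
  induction b with
  | intLE x y => simp [shift, IExpr.eval_shift]
  | realLE x y => simp [shift, RExpr.eval_shift]
  | neg b ih => simp [shift, ih]
  | conj b c ih1 ih2 => simp [shift, ih1, ih2]

theorem State.graft_putInt (a : ℕ) (i x : ℤ) :
    σ.graft K (τ.putInt a i x) = (σ.graft K τ).putInt (a + K) i x := by
  simp only [graft, putInt, State.mk.injEq, and_true]
  funext b
  rcases lt_or_ge b K with h | h
  · simp [h, show b ≠ a + K by omega]
  · by_cases hb : b = a + K
    · subst hb; simp
    · simp [h.not_gt, hb, show b - K ≠ a by omega]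

theorem State.graft_putReal (a : ℕ) (i : ℤ) (x : ℝ) :
    σ.graft K (τ.putReal a i x) = (σ.graft K τ).putReal (a + K) i x := by
  simp only [graft, putReal, State.mk.injEq, true_and]
  funext b
  rcases lt_or_ge b K with h | h
  · simp [h, show b ≠ a + K by omega]
  · by_cases hb : b = a + K
    · subst hb; simp
    · simp [h.not_gt, hb, show b - K ≠ a by omega]

theorem Exec.shift {P : Prog} {τ τ' : State} {t : ℕ} (h : Exec P τ t τ') (K : ℕ) (σ : State) :
    Exec (P.shift K) (σ.graft K τ) t (σ.graft K τ') := by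
  induction h with
  | skip τ => exact .skip _
  | setInt τ a i x =>
    rw [State.graft_putInt, ← IExpr.eval_shift (K := K) (σ := σ) i,
      ← IExpr.eval_shift (K := K) (σ := σ) x]
    exact .setInt _ _ _ _
  | setReal τ a i x =>
    rw [State.graft_putReal, ← IExpr.eval_shift (K := K) (σ := σ) i,
      ← RExpr.eval_shift (K := K) (σ := σ) x]
    exact .setReal _ _ _ _
  | seq _ _ ih1 ih2 => exact .seq ih1 ih2
  | ifTrue hb _ ih => exact .ifTrue ((Test.holds_shift _).2 hb) ih
  | ifFalse hb _ ih => exact .ifFalse (mt (Test.holds_shift _).1 hb) ih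
  | whileTrue hb _ _ ih1 ih2 => exact .whileTrue ((Test.holds_shift _).2 hb) ih1 ih2
  | whileFalse hb => exact .whileFalse (mt (Test.holds_shift _).1 hb)

/-! ### Depth-first search -/

/-- The array `nxt` links the elements of the list, starting with `h`; the list ends with `-1`. -/
def IsLinked (nxt : ℤ → ℤ) : ℤ → List ℕ → Prop
  | h, [] => h = -1
  | h, x :: l => h = x ∧ IsLinked nxt (nxt x) l

theorem IsLinked.update {nxt : ℤ → ℤ} {h : ℤ} {l : List ℕ} (hl : IsLinked nxt h l) {j : ℕ} {x : ℤ}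
    (hj : j ∉ l) : IsLinked (Function.update nxt j x) h l := by
  induction l generalizing h with
  | nil => exact hl
  | cons y l ih =>
    rw [List.mem_cons, not_or] at hj
    refine ⟨hl.1, ?_⟩
    rw [Function.update_of_ne (by intro e; exact hj.1 (by exact_mod_cast e.symm))]
    exact ih hl.2 hj.2

/-- A graph is given by half-edges `0, …, N - 1` from `src h` to `dst h`; only the active ones, with
`act h`, count. -/
structure HalfEdges where
  N : ℕ
  src : ℕ → ℤ
  dst : ℕ → ℤ
  act : ℕ → Prop

namespace HalfEdges

variable (H : HalfEdges)

/-- The vertices of the graph are the sources of the half-edges, active or not. -/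
def verts : Finset ℤ := (range H.N).image H.src

/-- Every active half-edge has a reverse. -/
def Symm : Prop :=
  ∀ h < H.N, H.act h → ∃ h' < H.N, H.act h' ∧ H.src h' = H.dst h ∧ H.dst h' = H.src h

/-- The two vertices are connected by active half-edges. -/
def Linked : ℤ → ℤ → Prop :=
  Relation.EqvGen fun x y => ∃ h < H.N, H.act h ∧ H.src h = x ∧ H.dst h = y

variable {H}

theorem Symm.dst_mem (hH : H.Symm) {h : ℕ} (hh : h < H.N) (ha : H.act h) : H.dst h ∈ H.verts := by
  obtain ⟨h', h1, -, h2, -⟩ := hH h hh ha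
  exact mem_image.2 ⟨h', mem_range.2 h1, h2⟩

theorem src_mem {h : ℕ} (hh : h < H.N) : H.src h ∈ H.verts :=
  mem_image.2 ⟨h, mem_range.2 hh, rfl⟩

variable (H)

/-- The invariant of the search.  The vertices are labelled with the numbers of their components, or
`-1` as long as they are unseen; there are `cnt` components so far.  The vertices on the stack, all of
the last component, may have unseen neighbours.  The list `adj v`, linked by the array `nxt` from
`head v` on, consists of the half-edges at `v` that are still to be explored. -/
structure DfsInv (nxt : ℤ → ℤ) (cnt : ℕ) (lab head stack : ℤ → ℤ) (sp : ℕ) (adj : ℤ → List ℕ) :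
    Prop where
  linked : ∀ v ∈ H.verts, IsLinked nxt (head v) (adj v)
  sound : ∀ v ∈ H.verts, ∀ h ∈ adj v, h < H.N ∧ H.act h ∧ H.src h = v
  lab_ge : ∀ v ∈ H.verts, -1 ≤ lab v
  lab_lt : ∀ v ∈ H.verts, lab v < cnt
  same : ∀ v ∈ H.verts, ∀ w ∈ H.verts, 0 ≤ lab v → lab v = lab w → H.Linked v w
  explored : ∀ h < H.N, H.act h → h ∉ adj (H.src h) →
    lab (H.src h) = lab (H.dst h) ∧ 0 ≤ lab (H.src h)
  stack_mem : ∀ i : ℕ, i < sp → stack i ∈ H.verts ∧ lab (stack i) = cnt - 1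
  pending : ∀ v ∈ H.verts, 0 ≤ lab v → adj v ≠ [] → ∃ i : ℕ, i < sp ∧ stack i = v
  surj : ∀ c : ℕ, c < cnt → ∃ v ∈ H.verts, lab v = c

/-- The potential of the search: the numbers of unexplored half-edges, unseen vertices and vertices
on the stack. -/
def pot (lab : ℤ → ℤ) (sp : ℕ) (adj : ℤ → List ℕ) : ℕ :=
  ∑ v ∈ H.verts, (adj v).length + #{v ∈ H.verts | lab v < 0} + sp

variable {H} {nxt lab head stack : ℤ → ℤ} {cnt sp : ℕ} {adj : ℤ → List ℕ}

theorem DfsInv.pop (I : H.DfsInv nxt cnt lab head stack (sp + 1) adj) (hv : adj (stack sp) = []) :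
    H.DfsInv nxt cnt lab head stack sp adj where
  __ := I
  stack_mem i hi := I.stack_mem i (by omega)
  pending v hv' h0 hne := by
    obtain ⟨i, hi, rfl⟩ := I.pending v hv' h0 hne
    refine ⟨i, ?_, rfl⟩
    rcases Nat.lt_succ_iff_lt_or_eq.1 hi with h | rfl
    · exact h
    · exact absurd hv hne

/-- An explored half-edge leads to a vertex that has been seen before. -/
theorem DfsInv.skip (hH : H.Symm) (I : H.DfsInv nxt cnt lab head stack (sp + 1) adj) {h : ℕ}
    {l : List ℕ} (hv : adj (stack sp) = h :: l) (hw : 0 ≤ lab (H.dst h)) :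
    H.DfsInv nxt cnt lab (Function.update head (stack sp) (nxt h)) stack (sp + 1)
      (Function.update adj (stack sp) l) := by
  obtain ⟨hv1, hv2⟩ := I.stack_mem sp (by omega)
  obtain ⟨hN, ha, hs⟩ := I.sound _ hv1 h (by simp [hv])
  obtain ⟨h', hN', ha', hs', hd'⟩ := hH h hN ha
  have hcnt : 0 ≤ lab (stack sp) := by
    have h1 := I.lab_lt _ (hH.dst_mem hN ha)
    omega
  -- the reverse half-edge has been explored, or both ends belong to the last component
  have hlab : lab (H.src h) = lab (H.dst h) := by
    by_cases h1 : h' ∈ adj (H.src h')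
    · rw [hs'] at h1
      obtain ⟨i, hi, hi'⟩ := I.pending _ (hH.dst_mem hN ha) hw (List.ne_nil_of_mem h1)
      rw [hs, hv2, ← hi', (I.stack_mem i hi).2]
    · have := (I.explored h' hN' ha' h1).1
      rw [hs', hd'] at this
      exact this.symm
  refine { I with linked := ?_, sound := ?_, explored := ?_, pending := ?_ }
  · intro v hv'
    by_cases e : v = stack sp
    · subst e
      have := I.linked _ hv'
      rw [hv] at this
      simpa using this.2
    · simpa [e] using I.linked v hv'
  · intro v hv' k hk
    by_cases e : v = stack sp
    · subst e
      rw [Function.update_self] at hk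
      exact I.sound _ hv' k (by simp [hv, hk])
    · rw [Function.update_of_ne e] at hk
      exact I.sound v hv' k hk
  · intro k hk hka hk'
    by_cases e : k = h
    · subst e
      exact ⟨hlab, by rw [hs]; exact hcnt⟩
    · refine I.explored k hk hka fun hc => hk' ?_
      by_cases e' : H.src k = stack sp
      · rw [e', hv] at hc
        rw [e', Function.update_self]
        exact (List.mem_cons.1 hc).resolve_left e
      · rwa [Function.update_of_ne e']
  · intro v hv' h0 hne
    by_cases e : v = stack sp
    · exact ⟨sp, by omega, e.symm⟩
    · rw [Function.update_of_ne e] at hne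
      exact I.pending v hv' h0 hne

/-- An explored half-edge leads to an unseen vertex, which is labelled and pushed on the stack. -/
theorem DfsInv.push (hH : H.Symm) (I : H.DfsInv nxt cnt lab head stack (sp + 1) adj) {h : ℕ}
    {l : List ℕ} (hv : adj (stack sp) = h :: l) (hc : 0 < cnt) (hw : lab (H.dst h) < 0) :
    H.DfsInv nxt cnt (Function.update lab (H.dst h) (cnt - 1))
      (Function.update head (stack sp) (nxt h)) (Function.update stack (sp + 1 : ℕ) (H.dst h))
      (sp + 1 + 1) (Function.update adj (stack sp) l) := by
  obtain ⟨hv1, hv2⟩ := I.stack_mem sp (by omega)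
  obtain ⟨hN, ha, hs⟩ := I.sound _ hv1 h (by simp [hv])
  have hne : stack sp ≠ H.dst h := by
    intro e
    rw [← e] at hw
    omega
  have hstep : H.Linked (stack sp) (H.dst h) := .rel _ _ ⟨h, hN, ha, hs, rfl⟩
  have hst : ∀ i : ℕ, i < sp + 1 →
      Function.update stack (sp + 1 : ℕ) (H.dst h) i = stack i := fun i hi =>
    Function.update_of_ne (by norm_cast; omega) _ _
  refine ⟨?_, ?_, ?_, ?_, ?_, ?_, ?_, ?_, ?_⟩
  · intro v hv'
    by_cases e : v = stack sp
    · subst e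
      have := I.linked _ hv'
      rw [hv] at this
      simpa using this.2
    · simpa [e] using I.linked v hv'
  · intro v hv' k hk
    by_cases e : v = stack sp
    · subst e
      rw [Function.update_self] at hk
      exact I.sound _ hv' k (by simp [hv, hk])
    · rw [Function.update_of_ne e] at hk
      exact I.sound v hv' k hk
  · intro v hv'
    by_cases e : v = H.dst h
    · subst e; rw [Function.update_self]; omega
    · simpa [e] using I.lab_ge v hv'
  · intro v hv'
    by_cases e : v = H.dst h
    · subst e; rw [Function.update_self]; omega
    · simpa [e] using I.lab_lt v hv'
  · -- the new vertex is joined to the whole last component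
    have key : ∀ w ∈ H.verts, lab w = cnt - 1 → H.Linked (H.dst h) w := fun w hw' e =>
      (hstep.symm _ _).trans _ _ _ (I.same _ hv1 w hw' (by omega) (by omega))
    intro v hv' w hw' h0 heq
    by_cases e1 : v = H.dst h <;> by_cases e2 : w = H.dst h
    · rw [e1, e2]; exact .refl _
    · subst e1
      rw [Function.update_self, Function.update_of_ne e2] at heq
      exact key w hw' heq.symm
    · subst e2
      rw [Function.update_self, Function.update_of_ne e1] at heq
      exact (key v hv' heq).symm
    · rw [Function.update_of_ne e1] at h0 heq
      rw [Function.update_of_ne e2] at heq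
      exact I.same v hv' w hw' h0 heq
  · intro k hk hka hk'
    by_cases e : k = h
    · subst e
      rw [Function.update_self, hs, Function.update_of_ne hne]
      omega
    · have := I.explored k hk hka fun hc => hk' <| by
        by_cases e' : H.src k = stack sp
        · rw [e', hv] at hc
          rw [e', Function.update_self]
          exact (List.mem_cons.1 hc).resolve_left e
        · rwa [Function.update_of_ne e']
      rw [Function.update_of_ne, Function.update_of_ne]
      · exact this
      · intro e'; rw [e'] at this; omega
      · intro e'; rw [e'] at this; omega
  · intro i hi
    rcases Nat.lt_succ_iff_lt_or_eq.1 hi with h1 | rfl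
    · rw [hst i h1]
      obtain ⟨h2, h3⟩ := I.stack_mem i h1
      refine ⟨h2, ?_⟩
      rw [Function.update_of_ne, h3]
      intro e
      rw [e] at h3
      omega
    · simpa using hH.dst_mem hN ha
  · intro v hv' h0 hne'
    by_cases e1 : v = H.dst h
    · exact ⟨sp + 1, by omega, by simp [e1]⟩
    · by_cases e : v = stack sp
      · exact ⟨sp, by omega, by rw [hst _ (by omega), e]⟩
      · rw [Function.update_of_ne e] at hne'
        rw [Function.update_of_ne e1] at h0
        obtain ⟨i, hi, rfl⟩ := I.pending v hv' h0 hne'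
        exact ⟨i, by omega, hst i hi⟩
  · intro c hc'
    obtain ⟨v, hv', e⟩ := I.surj c hc'
    refine ⟨v, hv', ?_⟩
    rw [Function.update_of_ne, e]
    rintro rfl
    omega

/-- A new component is started at an unseen vertex. -/
theorem DfsInv.start (I : H.DfsInv nxt cnt lab head stack 0 adj) {x : ℤ} (hx : x ∈ H.verts)
    (hlab : lab x < 0) :
    H.DfsInv nxt (cnt + 1) (Function.update lab x cnt) head (Function.update stack 0 x) 1 adj := by
  refine ⟨I.linked, I.sound, ?_, ?_, ?_, ?_, ?_, ?_, ?_⟩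
  · intro v hv
    by_cases e : v = x
    · subst e; rw [Function.update_self]; omega
    · simpa [e] using I.lab_ge v hv
  · intro v hv
    by_cases e : v = x
    · subst e; rw [Function.update_self]; push_cast; omega
    · rw [Function.update_of_ne e]
      have := I.lab_lt v hv
      push_cast; omega
  · intro v hv w hw h0 heq
    have h1 := I.lab_lt v hv
    have h2 := I.lab_lt w hw
    by_cases e1 : v = x <;> by_cases e2 : w = x
    · rw [e1, e2]; exact .refl _
    · subst e1
      rw [Function.update_self, Function.update_of_ne e2] at heq
      omega
    · subst e2
      rw [Function.update_self, Function.update_of_ne e1] at heq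
      omega
    · rw [Function.update_of_ne e1] at h0 heq
      rw [Function.update_of_ne e2] at heq
      exact I.same v hv w hw h0 heq
  · intro h hh ha hh'
    have := I.explored h hh ha hh'
    rw [Function.update_of_ne, Function.update_of_ne]
    · exact this
    · intro e'; rw [e'] at this; omega
    · intro e'; rw [e'] at this; omega
  · intro i hi
    obtain rfl : i = 0 := by omega
    simpa using hx
  · intro v hv h0 hne
    by_cases e : v = x
    · exact ⟨0, by omega, by simp [e]⟩
    · rw [Function.update_of_ne e] at h0
      obtain ⟨i, hi, -⟩ := I.pending v hv h0 hne
      omega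
  · intro c hc
    rcases Nat.lt_succ_iff_lt_or_eq.1 hc with h1 | rfl
    · obtain ⟨v, hv, e⟩ := I.surj c h1
      refine ⟨v, hv, ?_⟩
      rw [Function.update_of_ne, e]
      rintro rfl
      omega
    · exact ⟨x, hx, by simp⟩

theorem pot_skip (hv : stack sp ∈ H.verts) {h : ℕ} {l : List ℕ} (hl : adj (stack sp) = h :: l) :
    H.pot lab (sp + 1) (Function.update adj (stack sp) l) + 1 ≤ H.pot lab (sp + 1) adj := by
  have h1 := sum_erase_add H.verts (fun v => (adj v).length) hv
  have h2 := sum_erase_add H.verts (fun v => (Function.update adj (stack sp) l v).length) hv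
  have h3 : ∑ v ∈ H.verts.erase (stack sp), (Function.update adj (stack sp) l v).length =
      ∑ v ∈ H.verts.erase (stack sp), (adj v).length :=
    sum_congr rfl fun v hv' => by rw [Function.update_of_ne (ne_of_mem_erase hv')]
  simp only [Function.update_self, hl, List.length_cons] at h1 h2
  unfold pot
  omega

theorem card_unseen {x y : ℤ} (hx : x ∈ H.verts) (hlab : lab x < 0) (hy : 0 ≤ y) :
    #{v ∈ H.verts | Function.update lab x y v < 0} + 1 = #{v ∈ H.verts | lab v < 0} := by
  rw [← card_erase_add_one (s := {v ∈ H.verts | lab v < 0}) (a := x) (by simp [hx, hlab])]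
  congr 2
  ext v
  by_cases e : v = x
  · subst e; simp [hy]
  · simp [e]

end HalfEdges

/-! ### Computing connected components -/

/-- Compute the half-edges (their sources in array 25, their targets in array 17, and flags in
array 26) of the graph with edges from `10[s]` to `11[s]` that have the flags `12[s]`. -/
def makeHalves : Prog :=
  forLoop 21 13 0 (block [
    .setInt 25 (.get 21 (.const 0)) (.get 10 (.get 21 (.const 0))),
    .setInt 17 (.get 21 (.const 0)) (.get 11 (.get 21 (.const 0))),
    .setInt 26 (.get 21 (.const 0)) (.get 12 (.get 21 (.const 0))),
    .setInt 25 (.add (.get 13 (.const 0)) (.get 21 (.const 0))) (.get 11 (.get 21 (.const 0))),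
    .setInt 17 (.add (.get 13 (.const 0)) (.get 21 (.const 0))) (.get 10 (.get 21 (.const 0))),
    .setInt 26 (.add (.get 13 (.const 0)) (.get 21 (.const 0))) (.get 12 (.get 21 (.const 0)))])

/-- All vertices are unseen (array 14), and their adjacency lists are empty (array 15). -/
def clearLists : Prog :=
  forLoop 21 27 0 (block [
    .setInt 14 (.get 25 (.get 21 (.const 0))) (.const (-1)),
    .setInt 15 (.get 25 (.get 21 (.const 0))) (.const (-1))])

/-- Build linked adjacency lists (array 16) of the active half-edges. -/
def buildLists : Prog :=
  forLoop 21 27 0 (.ifte (.intLE (.const 1) (.get 26 (.get 21 (.const 0))))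
    (block [
      .setInt 16 (.get 21 (.const 0)) (.get 15 (.get 25 (.get 21 (.const 0)))),
      .setInt 15 (.get 25 (.get 21 (.const 0))) (.get 21 (.const 0))])
    .skip)

/-- One step of the search: explore a half-edge at the top of the stack, or pop it. -/
def dfsStep : Prog := block [
  .setInt 22 (.const 0) (.get 19 (.sub (.get 20 (.const 0)) (.const 1))),
  .setInt 23 (.const 0) (.get 15 (.get 22 (.const 0))),
  .ifte (.intLE (.get 23 (.const 0)) (.const (-1)))
    (.setInt 20 (.const 0) (.sub (.get 20 (.const 0)) (.const 1)))
    (block [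
      .setInt 15 (.get 22 (.const 0)) (.get 16 (.get 23 (.const 0))),
      .setInt 24 (.const 0) (.get 17 (.get 23 (.const 0))),
      .ifte (.intLE (.get 14 (.get 24 (.const 0))) (.const (-1)))
        (block [
          .setInt 14 (.get 24 (.const 0)) (.sub (.get 18 (.const 0)) (.const 1)),
          .setInt 19 (.get 20 (.const 0)) (.get 24 (.const 0)),
          .setInt 20 (.const 0) (.add (.get 20 (.const 0)) (.const 1))])
        .skip])]

/-- Search from the source of the half-edge `21[0]`, unless it has been seen. -/
def dfsFrom : Prog :=
  .ifte (.intLE (.get 14 (.get 25 (.get 21 (.const 0)))) (.const (-1)))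
    (block [
      .setInt 14 (.get 25 (.get 21 (.const 0))) (.get 18 (.const 0)),
      .setInt 18 (.const 0) (.add (.get 18 (.const 0)) (.const 1)),
      .setInt 19 (.const 0) (.get 25 (.get 21 (.const 0))),
      .setInt 20 (.const 0) (.const 1),
      .while (.intLE (.const 1) (.get 20 (.const 0))) dfsStep])
    .skip

/-- Label the vertices of the graph given in the arrays 10, 11 and 12 by the numbers of their connected
components (array 14); the number of components is returned in `18[0]`. -/
def labelComponents : Prog := block [
  .setInt 27 (.const 0) (.add (.get 13 (.const 0)) (.get 13 (.const 0))),
  makeHalves,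
  clearLists,
  buildLists,
  .setInt 18 (.const 0) (.const 0),
  forLoop 21 27 0 dfsFrom]

/-- The half-edges `j` and `q + j` of the edge `j`, for `j < q`. -/
def halves (q : ℕ) (U V A : ℤ → ℤ) : HalfEdges where
  N := q + q
  src h := if h < q then U h else V ((h - q : ℕ) : ℤ)
  dst h := if h < q then V h else U ((h - q : ℕ) : ℤ)
  act h := if h < q then 1 ≤ A h else 1 ≤ A ((h - q : ℕ) : ℤ)

theorem halves_symm (q : ℕ) (U V A : ℤ → ℤ) : (halves q U V A).Symm := by
  intro h hh ha
  simp only [halves] at hh ha ⊢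
  by_cases e : h < q
  · refine ⟨q + h, by omega, ?_⟩
    simp [e] at ha ⊢
    exact ha
  · refine ⟨h - q, by omega, ?_⟩
    simp [e, show h - q < q by omega] at ha ⊢
    exact ha

/-- The memory holds the half-edges of `H`. -/
structure HoldsHalves (H : HalfEdges) (σ : State) : Prop where
  num : σ.int 27 0 = H.N
  src : ∀ h < H.N, σ.int 25 h = H.src h
  dst : ∀ h < H.N, σ.int 17 h = H.dst h
  act : ∀ h < H.N, 1 ≤ σ.int 26 h ↔ H.act h

theorem HoldsHalves.of_eq {H : HalfEdges} {σ σ' : State} (h : HoldsHalves H σ)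
    (h27 : σ'.int 27 = σ.int 27) (h25 : σ'.int 25 = σ.int 25) (h17 : σ'.int 17 = σ.int 17)
    (h26 : σ'.int 26 = σ.int 26) : HoldsHalves H σ' :=
  ⟨by rw [h27, h.num], by rw [h25]; exact h.src, by rw [h17]; exact h.dst, by rw [h26]; exact h.act⟩

theorem runs_makeHalves {σ : State} {q : ℕ} (hq : σ.int 13 0 = q) (h27 : σ.int 27 0 = q + q) :
    Runs makeHalves σ fun t σ' => t ≤ 9 * q + 2 ∧
      HoldsHalves (halves q (σ.int 10) (σ.int 11) (σ.int 12)) σ' := by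
  refine (runs_forLoop q 7 (fun i τ => ∀ j < i,
    (τ.int 25 j = σ.int 10 j ∧ τ.int 25 (q + j) = σ.int 11 j) ∧
    (τ.int 17 j = σ.int 11 j ∧ τ.int 17 (q + j) = σ.int 10 j) ∧
    τ.int 26 j = σ.int 12 j ∧ τ.int 26 (q + j) = σ.int 12 j) hq (by decide) (by decide)
    (by simp) ?_).mono ?_
  · intro i hi τ hs hiv hI
    have e10 := hs.1 10 (by decide)
    have e11 := hs.1 11 (by decide)
    have e12 := hs.1 12 (by decide)
    have e13 := hs.1 13 (by decide)
    simp only [runs_block_cons, runs_block_nil, runs_setInt, IExpr.eval, putInt_int, hiv, e10, e11,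
      e12, e13, hq, Nat.reduceEqDiff, if_true, if_false]
    refine ⟨by norm_num, fun j hj => ?_⟩
    have f1 : ¬ ((q : ℤ) + i = i) := by omega
    have f2 : ¬ ((j : ℤ) = q + i) := by omega
    have f3 : ¬ ((q : ℤ) + j = i) := by omega
    rcases Nat.lt_succ_iff_lt_or_eq.1 hj with h | rfl
    · have f4 : ¬ ((j : ℤ) = i) := by omega
      simpa [Function.update_apply, f1, f2, f3, f4] using hI j h
    · simp [f2]
  · rintro t σ' ⟨ht, hs, hI⟩
    refine ⟨ht, ?_, ?_, ?_, ?_⟩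
    · rw [hs.1 27 (by decide), h27]; simp [halves]
    all_goals
      intro h hh
      simp only [halves] at hh ⊢
      by_cases e : h < q
      · simp [hI h e, e]
      · obtain ⟨k, rfl⟩ : ∃ k, h = q + k := ⟨h - q, by omega⟩
        simp [hI k (by omega)]

theorem runs_clearLists {H : HalfEdges} {σ : State} (hH : HoldsHalves H σ) :
    Runs clearLists σ fun t σ' => t ≤ 5 * H.N + 2 ∧ HoldsHalves H σ' ∧
      ∀ v ∈ H.verts, σ'.int 14 v = -1 ∧ σ'.int 15 v = -1 := by
  refine (runs_forLoop H.N 3 (fun i τ => ∀ h < i, τ.int 14 (H.src h) = -1 ∧ τ.int 15 (H.src h) = -1)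
    hH.num (by decide) (by decide) (by simp) ?_).mono ?_
  · intro i hi τ hs hiv hI
    have e25 := hs.1 25 (by decide)
    simp only [runs_block_cons, runs_block_nil, runs_setInt, IExpr.eval, putInt_int, hiv, e25,
      Nat.reduceEqDiff, if_true, if_false, hH.src i hi]
    refine ⟨by norm_num, fun h hh => ?_⟩
    rcases Nat.lt_succ_iff_lt_or_eq.1 hh with h' | rfl
    · simp [Function.update_apply, hI h h']
    · simp
  · rintro t σ' ⟨ht, hs, hI⟩
    refine ⟨ht, hH.of_eq (hs.1 _ (by decide)) (hs.1 _ (by decide)) (hs.1 _ (by decide))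
      (hs.1 _ (by decide)), fun v hv => ?_⟩
    obtain ⟨h, hh, rfl⟩ := mem_image.1 hv
    exact hI h (mem_range.1 hh)

theorem runs_buildLists {H : HalfEdges} {σ : State} (hH : HoldsHalves H σ)
    (h15 : ∀ v ∈ H.verts, σ.int 15 v = -1) :
    Runs buildLists σ fun t σ' => t ≤ 6 * H.N + 2 ∧ HoldsHalves H σ' ∧ ∃ adj : ℤ → List ℕ,
      (∀ v ∈ H.verts, IsLinked (σ'.int 16) (σ'.int 15 v) (adj v)) ∧
      (∀ v h, h ∈ adj v ↔ h < H.N ∧ H.act h ∧ H.src h = v) ∧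
      ∑ v ∈ H.verts, (adj v).length ≤ H.N := by
  refine (runs_forLoop H.N 4 (fun i τ => ∃ adj : ℤ → List ℕ,
      (∀ v ∈ H.verts, IsLinked (τ.int 16) (τ.int 15 v) (adj v)) ∧
      (∀ v h, h ∈ adj v ↔ h < i ∧ H.act h ∧ H.src h = v) ∧
      ∑ v ∈ H.verts, (adj v).length ≤ i)
    hH.num (by decide) (by decide) ⟨fun _ => [], ?_⟩ ?_).mono ?_
  · simpa [IsLinked] using h15
  · rintro i hi τ hs hiv ⟨adj, hl, hm, hn⟩
    have e25 := hs.1 25 (by decide)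
    have e26 := hs.1 26 (by decide)
    simp only [runs_ifte, Test.holds, runs_block_cons, runs_block_nil, runs_setInt, runs_skip,
      IExpr.eval, putInt_int, hiv, e25, e26, Nat.reduceEqDiff, if_true, if_false, hH.src i hi,
      hH.act i hi]
    constructor
    · intro ha
      refine ⟨by norm_num, Function.update adj (H.src i) (i :: adj (H.src i)), ?_, ?_, ?_⟩
      · intro v hv
        have hfresh : i ∉ adj v := fun h => by have := (hm v i).1 h; omega
        by_cases e : v = H.src i
        · subst e
          simp only [Function.update_self]
          refine ⟨rfl, ?_⟩
          rw [Function.update_self]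
          exact (hl _ hv).update hfresh
        · simp only [Function.update_of_ne e]
          exact (hl _ hv).update hfresh
      · intro v h
        by_cases e : v = H.src i
        · subst e
          rw [Function.update_self, List.mem_cons, hm]
          constructor
          · rintro (rfl | h')
            · exact ⟨by omega, ha, rfl⟩
            · exact ⟨by omega, h'.2⟩
          · rintro ⟨h1, h2⟩
            rcases Nat.lt_succ_iff_lt_or_eq.1 h1 with h' | rfl
            · exact .inr ⟨h', h2⟩
            · exact .inl rfl
        · rw [Function.update_of_ne e, hm]
          constructor
          · rintro ⟨h1, h2⟩
            exact ⟨by omega, h2⟩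
          · rintro ⟨h1, h2, h3⟩
            refine ⟨?_, h2, h3⟩
            rcases Nat.lt_succ_iff_lt_or_eq.1 h1 with h' | rfl
            · exact h'
            · exact absurd h3.symm e
      · have hv : H.src i ∈ H.verts := HalfEdges.src_mem hi
        have h1 := sum_erase_add H.verts (fun v => (adj v).length) hv
        have h2 := sum_erase_add H.verts
          (fun v => (Function.update adj (H.src i) (i :: adj (H.src i)) v).length) hv
        have h3 : ∑ v ∈ H.verts.erase (H.src i),
            (Function.update adj (H.src i) (i :: adj (H.src i)) v).length =
            ∑ v ∈ H.verts.erase (H.src i), (adj v).length :=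
          sum_congr rfl fun v hv' => by rw [Function.update_of_ne (ne_of_mem_erase hv')]
        simp only [Function.update_self, List.length_cons] at h2
        omega
    · intro ha
      refine ⟨by norm_num, adj, hl, fun v h => ?_, by omega⟩
      rw [hm]
      constructor
      · rintro ⟨h1, h2⟩
        exact ⟨by omega, h2⟩
      · rintro ⟨h1, h2, h3⟩
        refine ⟨?_, h2, h3⟩
        rcases Nat.lt_succ_iff_lt_or_eq.1 h1 with h' | rfl
        · exact h'
        · exact absurd h2 ha
  · rintro t σ' ⟨ht, hs, hI⟩
    exact ⟨ht, hH.of_eq (hs.1 _ (by decide)) (hs.1 _ (by decide)) (hs.1 _ (by decide))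
      (hs.1 _ (by decide)), hI⟩

/-- The memory is in a state of the search; the vertices in `L` have been seen. -/
structure DfsState (H : HalfEdges) (nxt : ℤ → ℤ) (L : Finset ℤ) (cnt sp n : ℕ) (σ : State) : Prop where
  halves : HoldsHalves H σ
  nxt_eq : σ.int 16 = nxt
  cnt_eq : σ.int 18 0 = cnt
  seen : ∀ v ∈ L, 0 ≤ σ.int 14 v
  inv : ∃ adj, H.DfsInv nxt cnt (σ.int 14) (σ.int 15) (σ.int 19) sp adj ∧
    16 * H.pot (σ.int 14) sp adj ≤ n

theorem runs_dfsStep {H : HalfEdges} (hH : H.Symm) {nxt : ℤ → ℤ} {L : Finset ℤ} {cnt sp n : ℕ}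
    (hc : 0 < cnt) {σ : State} (hI : DfsState H nxt L cnt (sp + 1) n σ)
    (hsp : σ.int 20 0 = (sp + 1 : ℕ)) :
    Runs dfsStep σ fun t σ' => t ≤ 12 ∧ SameOff dfsStep.ints dfsStep.reals σ σ' ∧
      ∃ sp' n', σ'.int 20 0 = (sp' : ℕ) ∧ n' + 16 ≤ n ∧ DfsState H nxt L cnt sp' n' σ' := by
  suffices hS : Runs dfsStep σ fun t σ' => t ≤ 12 ∧
      ∃ sp' n', σ'.int 20 0 = (sp' : ℕ) ∧ n' + 16 ≤ n ∧ DfsState H nxt L cnt sp' n' σ' from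
    hS.sameOff.mono fun t σ' h => ⟨h.1.1, h.2, h.1.2⟩
  obtain ⟨adj, inv, hpot⟩ := hI.inv
  have e1 : ((sp + 1 : ℕ) : ℤ) - 1 = sp := by push_cast; ring
  obtain ⟨hv1, hv2⟩ := inv.stack_mem sp (by omega)
  have hlink := inv.linked _ hv1
  have hx : (σ.int 15 (σ.int 19 sp) ≤ -1 ↔ adj (σ.int 19 sp) = []) := by
    rcases hadj : adj (σ.int 19 sp) with _ | ⟨h, l⟩
    · rw [hadj] at hlink
      simp [hlink.le]
    · rw [hadj] at hlink
      simp [hlink.1]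
      omega
  simp only [dfsStep, runs_ifte, Test.holds, runs_block_cons, runs_block_nil, runs_setInt,
    runs_skip, IExpr.eval, putInt_int, Nat.reduceEqDiff, if_true, if_false, hsp, e1,
    Function.update_self, hx]
  constructor
  · intro hnil
    refine ⟨by norm_num, sp, n - 16, rfl, ?_, ?_⟩
    · unfold HalfEdges.pot at hpot
      omega
    · refine ⟨hI.halves.of_eq ?_ ?_ ?_ ?_, ?_, ?_, ?_, adj, ?_, ?_⟩
      any_goals simp [hI.nxt_eq, hI.cnt_eq, putInt_int]
      · exact hI.seen
      · exact inv.pop hnil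
      · unfold HalfEdges.pot at hpot ⊢
        omega
  · intro hne
    obtain ⟨h, l, hadj⟩ := List.exists_cons_of_ne_nil hne
    rw [hadj] at hlink
    obtain ⟨hN, ha, hs⟩ := inv.sound _ hv1 h (by simp [hadj])
    have hd := hH.dst_mem hN ha
    have hp := HalfEdges.pot_skip (lab := σ.int 14) hv1 hadj
    simp only [hlink.1, hI.halves.dst h hN, hI.nxt_eq, hI.cnt_eq]
    constructor
    · intro hlab
      have hcard := HalfEdges.card_unseen (lab := σ.int 14) (y := cnt - 1) hd (by omega) (by omega)
      refine ⟨by norm_num, sp + 1 + 1, n - 16, by simp, ?_, ?_⟩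
      · unfold HalfEdges.pot at hp hpot
        omega
      · refine ⟨hI.halves.of_eq ?_ ?_ ?_ ?_, ?_, ?_, ?_,
          Function.update adj (σ.int 19 sp) l, ?_, ?_⟩
        rotate_right 2
        · simpa using inv.push hH hadj hc (by omega)
        · unfold HalfEdges.pot at hp hpot ⊢
          simp [putInt_int] at hp hcard ⊢
          omega
        all_goals simp [hI.nxt_eq, hI.cnt_eq, putInt_int]
        intro v hv
        have := hI.seen v hv
        rw [Function.update_apply]
        split_ifs <;> omega
    · intro hlab
      refine ⟨by norm_num, sp + 1, n - 16, by simp, by omega, ?_⟩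
      refine ⟨hI.halves.of_eq ?_ ?_ ?_ ?_, ?_, ?_, ?_,
          Function.update adj (σ.int 19 sp) l, ?_, ?_⟩
      rotate_right 2
      · simpa using inv.skip hH hadj (by omega)
      · simp [putInt_int] at hp ⊢
        omega
      all_goals simp [hI.nxt_eq, hI.cnt_eq, putInt_int]
      exact hI.seen

theorem runs_dfsFrom {H : HalfEdges} (hH : H.Symm) {nxt : ℤ → ℤ} {L : Finset ℤ} {cnt n h : ℕ}
    {σ : State} (hI : DfsState H nxt L cnt 0 n σ) (hh : h < H.N) (h21 : σ.int 21 0 = h) :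
    Runs dfsFrom σ fun t σ' => ∃ cnt' n', t + n' ≤ 24 + n ∧
      DfsState H nxt (insert (H.src h) L) cnt' 0 n' σ' := by
  have hv : H.src h ∈ H.verts := HalfEdges.src_mem hh
  obtain ⟨adj, inv, hpot⟩ := hI.inv
  simp only [dfsFrom, runs_ifte, Test.holds, runs_block_cons, runs_block_nil, runs_setInt,
    runs_skip, IExpr.eval, putInt_int, Nat.reduceEqDiff, if_false, h21,
    hI.halves.src h hh, hI.cnt_eq]
  constructor
  · intro hlab
    have hcard := HalfEdges.card_unseen (lab := σ.int 14) (y := cnt) hv (by omega) (by omega)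
    refine (runs_while (n := n) (fun k τ => ∃ sp, τ.int 20 0 = (sp : ℕ) ∧
      DfsState H nxt (insert (H.src h) L) (cnt + 1) sp k τ) ?_ ⟨1, by simp, ?_⟩).mono ?_
    · rintro k τ ⟨sp, hsp, hτ⟩ hb
      simp only [Test.holds, IExpr.eval, hsp] at hb
      obtain ⟨sp, rfl⟩ : ∃ s, sp = s + 1 := ⟨sp - 1, by omega⟩
      refine (runs_dfsStep hH (Nat.succ_pos _) hτ hsp).mono ?_
      rintro t τ' ⟨ht, -, sp', k', h1, h2, h3⟩
      exact ⟨k', ⟨sp', h1, h3⟩, by omega⟩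
    · refine ⟨hI.halves.of_eq ?_ ?_ ?_ ?_, ?_, ?_, ?_, adj, ?_, ?_⟩
      rotate_right 2
      · simpa [putInt_int, Function.update_apply, h21, hI.halves.src h hh] using
          inv.start hv (by omega)
      · unfold HalfEdges.pot at hpot ⊢
        simp [putInt_int] at hcard ⊢
        omega
      all_goals simp [hI.nxt_eq, putInt_int]
      intro v hv
      have := hI.seen v hv
      rw [Function.update_apply]
      split_ifs <;> omega
    · rintro t τ ⟨k, ⟨sp, hsp, hτ⟩, hb, ht⟩
      simp only [Test.holds, IExpr.eval, hsp] at hb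
      obtain rfl : sp = 0 := by omega
      exact ⟨cnt + 1, k, by omega, hτ⟩
  · intro hlab
    refine ⟨cnt, n, by omega, hI.halves, hI.nxt_eq, hI.cnt_eq, ?_, adj, inv, hpot⟩
    intro v hv
    rcases mem_insert.1 hv with rfl | hv
    · omega
    · exact hI.seen v hv

/-- The vertices of the graph with the edges `U j`–`V j`, `j < q`. -/
def IsEnd (q : ℕ) (U V : ℤ → ℤ) (x : ℤ) : Prop := ∃ j : ℕ, j < q ∧ (x = U j ∨ x = V j)

/-- Two integers are joined by a path of edges `U j`–`V j` with `1 ≤ A j`, `j < q`. -/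
def Joined (q : ℕ) (U V A : ℤ → ℤ) : ℤ → ℤ → Prop :=
  Relation.EqvGen fun x y => ∃ j : ℕ, j < q ∧ 1 ≤ A j ∧ U j = x ∧ V j = y

/-- `lab` numbers the connected components `0, …, cnt - 1`. -/
structure IsLabelling (q : ℕ) (U V A lab : ℤ → ℤ) (cnt : ℕ) : Prop where
  nonneg : ∀ x, IsEnd q U V x → 0 ≤ lab x
  lt : ∀ x, IsEnd q U V x → lab x < cnt
  eq_iff : ∀ x y, IsEnd q U V x → IsEnd q U V y → (lab x = lab y ↔ Joined q U V A x y)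
  surj : ∀ c : ℕ, c < cnt → ∃ x, IsEnd q U V x ∧ lab x = c

theorem halves_verts {q : ℕ} {U V A : ℤ → ℤ} {x : ℤ} :
    x ∈ (halves q U V A).verts ↔ IsEnd q U V x := by
  simp only [HalfEdges.verts, halves, mem_image, mem_range]
  constructor
  · rintro ⟨h, hh, rfl⟩
    by_cases e : h < q
    · exact ⟨h, e, by simp [e]⟩
    · exact ⟨h - q, by omega, by simp [e]⟩
  · rintro ⟨j, hj, rfl | rfl⟩
    · exact ⟨j, by omega, by simp [hj]⟩
    · exact ⟨q + j, by omega, by simp⟩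

theorem eqvGen_le {α : Type*} {r s : α → α → Prop} (h : ∀ x y, r x y → Relation.EqvGen s x y)
    {x y : α} (hxy : Relation.EqvGen r x y) : Relation.EqvGen s x y := by
  induction hxy with
  | rel x y hr => exact h x y hr
  | refl x => exact .refl x
  | symm x y _ ih => exact ih.symm
  | trans x y z _ _ ih1 ih2 => exact ih1.trans _ _ _ ih2

theorem halves_linked {q : ℕ} {U V A : ℤ → ℤ} {x y : ℤ} :
    (halves q U V A).Linked x y ↔ Joined q U V A x y := by
  refine ⟨eqvGen_le ?_, eqvGen_le ?_⟩
  · rintro x y ⟨h, hh, ha, rfl, rfl⟩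
    simp only [halves] at hh ha ⊢
    by_cases e : h < q
    · simp only [e, if_true] at ha ⊢
      exact .rel _ _ ⟨h, e, ha, rfl, rfl⟩
    · simp only [e, if_false] at ha ⊢
      exact .symm _ _ (.rel _ _ ⟨h - q, by omega, ha, rfl, rfl⟩)
  · rintro x y ⟨j, hj, ha, rfl, rfl⟩
    refine .rel _ _ ⟨j, ?_, ?_, ?_, ?_⟩
    · simp only [halves]; omega
    · simpa [halves, hj] using ha
    · simp [halves, hj]
    · simp [halves, hj]

theorem runs_labelComponents {σ : State} {q : ℕ} (hq : σ.int 13 0 = q) :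
    Runs labelComponents σ fun t σ' => t ≤ 200 * q + 20 ∧
      SameOff labelComponents.ints labelComponents.reals σ σ' ∧
      ∃ cnt : ℕ, σ'.int 18 0 = cnt ∧
        IsLabelling q (σ.int 10) (σ.int 11) (σ.int 12) (σ'.int 14) cnt := by
  suffices hS : Runs labelComponents σ fun t σ' => t ≤ 200 * q + 20 ∧
      ∃ cnt : ℕ, σ'.int 18 0 = cnt ∧
        IsLabelling q (σ.int 10) (σ.int 11) (σ.int 12) (σ'.int 14) cnt from
    hS.sameOff.mono fun t σ' h => ⟨h.1.1, h.2, h.1.2⟩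
  set H := halves q (σ.int 10) (σ.int 11) (σ.int 12) with hHdef
  have hH : H.Symm := halves_symm _ _ _ _
  have hN : H.N = q + q := rfl
  rw [labelComponents, runs_block_cons, runs_setInt, runs_block_cons]
  refine (runs_makeHalves (q := q) (by simpa using hq) (by simp [hq])).mono ?_
  rintro t1 σ1 ⟨ht1, h1⟩
  simp only [putInt_int, Nat.reduceEqDiff, if_false] at h1
  rw [← hHdef] at h1
  rw [runs_block_cons]
  refine (runs_clearLists h1).mono ?_
  rintro t2 σ2 ⟨ht2, h2, h14⟩
  rw [runs_block_cons]
  refine ((runs_buildLists h2 fun v hv => (h14 v hv).2).sameOff).mono ?_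
  rintro t3 σ3 ⟨⟨ht3, h3, adj, hl, hm, hn⟩, hs3⟩
  rw [runs_block_cons, runs_setInt, runs_block_cons]
  have hlab : ∀ v ∈ H.verts, σ3.int 14 v = -1 := fun v hv => by
    rw [hs3.1 14 (by decide), (h14 v hv).1]
  have hverts : #H.verts ≤ H.N := card_image_le.trans (by simp)
  have hpot : H.pot (σ3.int 14) 0 adj ≤ 2 * H.N := by
    have := card_filter_le H.verts (fun v => σ3.int 14 v < 0)
    unfold HalfEdges.pot
    omega
  refine (runs_forLoop_amortized H.N 24 (fun i n τ => ∃ cnt,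
    DfsState H (σ3.int 16) ((range i).image H.src) cnt 0 n τ) (n₀ := 16 * (2 * H.N)) ?_
    (by decide) (by decide) ⟨0, ?_⟩ ?_).mono ?_
  · simpa using h3.num
  · refine ⟨h3.of_eq ?_ ?_ ?_ ?_, ?_, ?_, ?_, adj, ?_, ?_⟩
    rotate_right 2
    · simp only [IExpr.eval, putInt_int, Nat.reduceEqDiff, if_false]
      refine ⟨hl, fun v _ h hh => (hm v h).1 hh, fun v hv => (hlab v hv).ge, fun v hv => ?_,
        fun v hv w _ h0 => ?_, fun h hh ha hh' => ?_, fun i hi => ?_, fun v hv h0 => ?_, fun c hc => ?_⟩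
      · rw [hlab v hv]; norm_num
      · rw [hlab v hv] at h0; omega
      · exact absurd ((hm _ h).2 ⟨hh, ha, rfl⟩) hh'
      · omega
      · rw [hlab v hv] at h0; omega
      · omega
    · simp [putInt_int]
      omega
    all_goals simp [putInt_int]
  · rintro i hi n τ - h21 ⟨cnt, hτ⟩
    refine (runs_dfsFrom hH hτ hi h21).mono ?_
    rintro t τ' ⟨cnt', n', ht, hτ'⟩
    refine ⟨n', ht, cnt', hτ'.halves.of_eq ?_ ?_ ?_ ?_, ?_, ?_, ?_, ?_⟩
    any_goals simp [putInt_int, hτ'.nxt_eq, hτ'.cnt_eq]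
    · intro j hj
      refine hτ'.seen _ ?_
      rcases hj.eq_or_lt with rfl | hj
      · exact mem_insert_self _ _
      · exact mem_insert_of_mem (mem_image.2 ⟨j, mem_range.2 hj, rfl⟩)
    · exact hτ'.inv
  · rintro t τ ⟨n, ht, -, cnt, hτ⟩
    obtain ⟨adj', inv, -⟩ := hτ.inv
    simp only [runs_block_nil]
    refine ⟨by omega, cnt, hτ.cnt_eq, ?_⟩
    have hseen : ∀ v ∈ H.verts, 0 ≤ τ.int 14 v := hτ.seen
    have hstep : ∀ h < H.N, H.act h → τ.int 14 (H.src h) = τ.int 14 (H.dst h) := fun h hh ha => by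
      refine (inv.explored h hh ha fun hmem => ?_).1
      have hv := HalfEdges.src_mem hh
      obtain ⟨i, hi, -⟩ := inv.pending _ hv (hseen _ hv) (List.ne_nil_of_mem hmem)
      omega
    refine ⟨fun x hx => hseen x (halves_verts.2 hx), fun x hx => inv.lab_lt x (halves_verts.2 hx),
      fun x y hx hy => ?_, fun c hc => ?_⟩
    · rw [← halves_linked]
      refine ⟨inv.same x (halves_verts.2 hx) y (halves_verts.2 hy) (hseen x (halves_verts.2 hx)),
        fun h => ?_⟩
      change H.Linked x y at h
      have : ∀ x y, H.Linked x y → τ.int 14 x = τ.int 14 y := by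
        intro x y h
        induction h with
        | rel x y h => obtain ⟨h, hh, ha, rfl, rfl⟩ := h; exact hstep h hh ha
        | refl x => rfl
        | symm x y _ ih => exact ih.symm
        | trans x y z _ _ ih1 ih2 => exact ih1.trans ih2
      exact this x y h
    · obtain ⟨v, hv, e⟩ := inv.surj c hc
      exact ⟨v, halves_verts.1 hv, e⟩

/-! ### Counting connected components -/

section Components

variable {α ι : Type*} {s t : ι → α} {A B : Set ι} {x y : α}

/-- The vertices are joined by a path of the edges `s i`–`t i`, `i ∈ A`. -/
def Conn (s t : ι → α) (A : Set ι) : α → α → Prop :=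
  Relation.EqvGen fun x y => ∃ i ∈ A, s i = x ∧ t i = y

/-- The number of connected components of the graph with the edges `s i`–`t i`, `i ∈ A`. -/
noncomputable def numComp (s t : ι → α) (A : Set ι) : ℕ :=
  Nat.card (Quot fun x y => ∃ i ∈ A, s i = x ∧ t i = y)

theorem Conn.edge {i : ι} (hi : i ∈ A) : Conn s t A (s i) (t i) := .rel _ _ ⟨i, hi, rfl, rfl⟩

theorem Conn.refl' (x : α) : Conn s t A x x := Relation.EqvGen.refl x

theorem Conn.symm' (h : Conn s t A x y) : Conn s t A y x := Relation.EqvGen.symm _ _ h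

theorem Conn.trans' {z : α} (h : Conn s t A x y) (h' : Conn s t A y z) : Conn s t A x z :=
  Relation.EqvGen.trans _ _ _ h h'

theorem Conn.of_edges (h : ∀ i ∈ A, Conn s t B (s i) (t i)) (hxy : Conn s t A x y) :
    Conn s t B x y :=
  eqvGen_le (fun _ _ ⟨i, hi, h1, h2⟩ => h1 ▸ h2 ▸ h i hi) hxy

theorem Conn.mono (h : A ⊆ B) (hxy : Conn s t A x y) : Conn s t B x y :=
  hxy.of_edges fun _ hi => .edge (h hi)

theorem Conn.map_eq {β : Type*} {φ : α → β} (h : ∀ i ∈ A, φ (s i) = φ (t i))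
    (hxy : Conn s t A x y) : φ x = φ y := by
  induction hxy with
  | rel x y hr => obtain ⟨i, hi, rfl, rfl⟩ := hr; exact h i hi
  | refl x => rfl
  | symm x y _ ih => exact ih.symm
  | trans x y z _ _ ih1 ih2 => exact ih1.trans ih2

theorem Conn.map {β κ : Type*} {s' t' : κ → β} {B : Set κ} {φ : α → β}
    (h : ∀ i ∈ A, Conn s' t' B (φ (s i)) (φ (t i))) (hxy : Conn s t A x y) :
    Conn s' t' B (φ x) (φ y) := by
  induction hxy with
  | rel x y hr => obtain ⟨i, hi, rfl, rfl⟩ := hr; exact h i hi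
  | refl x => exact .refl' _
  | symm x y _ ih => exact ih.symm'
  | trans x y z _ _ ih1 ih2 => exact ih1.trans' ih2

theorem Conn.eq_or_mem (h : Conn s t A x y) : x = y ∨ ∃ i ∈ A, s i = y ∨ t i = y := by
  have key : (x = y ∨ ∃ i ∈ A, s i = y ∨ t i = y) ∧ (x = y ∨ ∃ i ∈ A, s i = x ∨ t i = x) := by
    induction h with
    | rel x y h =>
      obtain ⟨i, hi, h1, h2⟩ := h
      exact ⟨.inr ⟨i, hi, .inr h2⟩, .inr ⟨i, hi, .inl h1⟩⟩
    | refl x => simp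
    | symm x y _ ih => exact ⟨ih.2.imp_left Eq.symm, ih.1.imp_left Eq.symm⟩
    | trans x y z _ _ ih1 ih2 =>
      constructor
      · rcases ih2.1 with rfl | h
        · exact ih1.1
        · exact .inr h
      · rcases ih1.2 with rfl | h
        · exact ih2.2
        · exact .inr h
  exact key.1

theorem conn_iff_mk_eq :
    Conn s t A x y ↔ Quot.mk (fun x y => ∃ i ∈ A, s i = x ∧ t i = y) x = Quot.mk _ y :=
  ⟨Quot.eqvGen_sound, Quot.eqvGen_exact⟩

theorem numComp_empty : numComp s t ∅ = Nat.card α := by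
  refine (Nat.card_eq_of_bijective (Quot.mk _) ⟨fun x y h => ?_, Quot.mk_surjective⟩).symm
  rcases (conn_iff_mk_eq.2 h).eq_or_mem with h | ⟨i, hi, -⟩
  · exact h
  · exact absurd hi (Set.notMem_empty i)

/-- Isolated vertices are joined to no other vertex. -/
theorem Conn.eq_of_isolated (hx : ∀ i ∈ A, s i ≠ x ∧ t i ≠ x) (h : Conn s t A x y) : x = y := by
  rcases h.symm'.eq_or_mem with h | ⟨i, hi, h⟩
  · exact h.symm
  · exact absurd h (not_or.2 (hx i hi))

variable [Finite α]

theorem numComp_insert (i : ι) : numComp s t A ≤ numComp s t (insert i A) + 1 := by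
  classical
  set r := fun x y => ∃ i ∈ A, s i = x ∧ t i = y with hr
  -- merging the components of the two ends of `i` loses at most the component of `t i`
  let φ : α → Quot r := fun x => if Quot.mk r x = Quot.mk r (t i) then Quot.mk r (s i)
    else Quot.mk r x
  have hφ : ∀ j ∈ insert i A, φ (s j) = φ (t j) := by
    rintro j (rfl | hj)
    · simp only [φ, if_true]
      split_ifs <;> rfl
    · have : Quot.mk r (s j) = Quot.mk r (t j) := Quot.sound ⟨j, hj, rfl, rfl⟩
      simp only [φ, this]
  let ψ : Option (Quot fun x y => ∃ j ∈ insert i A, s j = x ∧ t j = y) → Quot r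
    | none => Quot.mk r (t i)
    | some c => Quot.lift φ (by rintro x y ⟨j, hj, rfl, rfl⟩; exact hφ j hj) c
  have hψ : Function.Surjective ψ := by
    intro c
    induction c using Quot.ind with
    | _ x =>
      by_cases h : Quot.mk r x = Quot.mk r (t i)
      · exact ⟨none, h.symm⟩
      · exact ⟨some (Quot.mk _ x), by simp [ψ, φ, h]⟩
  have := Nat.card_le_card_of_surjective ψ hψ
  rwa [Finite.card_option] at this

theorem numComp_union (B : Finset ι) : numComp s t A ≤ numComp s t (A ∪ B) + #B := by
  classical
  induction B using Finset.induction_on with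
  | empty => simp
  | insert i B hi ih =>
    have := numComp_insert (s := s) (t := t) (A := A ∪ B) i
    rw [card_insert_of_notMem hi, coe_insert, Set.union_insert]
    omega

/-- An edge between two components joins them. -/
theorem numComp_insert_lt {i : ι} (h : ¬ Conn s t A (s i) (t i)) :
    numComp s t (insert i A) < numComp s t A := by
  let π : Quot (fun x y => ∃ j ∈ A, s j = x ∧ t j = y) →
      Quot (fun x y => ∃ j ∈ insert i A, s j = x ∧ t j = y) :=
    Quot.map id fun x y ⟨j, hj, h⟩ => ⟨j, Set.mem_insert_of_mem i hj, h⟩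
  refine lt_of_not_ge fun hle => h ?_
  have hsurj : Function.Surjective π := by
    intro c
    induction c using Quot.ind with
    | _ x => exact ⟨Quot.mk _ x, rfl⟩
  have hbij := (Nat.bijective_iff_surjective_and_card π).2 
    ⟨hsurj, le_antisymm hle (Nat.card_le_card_of_surjective π hsurj)⟩
  refine conn_iff_mk_eq.2 (hbij.1 ?_)
  exact Quot.sound ⟨i, Set.mem_insert i A, rfl, rfl⟩

/-- Greedy choice of edges of `B`: each of them reduces the number of components. -/
theorem exists_greedy (A : Set ι) (B : Finset ι) : ∃ B' ⊆ B,
    (∀ x y, Conn s t (A ∪ B) x y → Conn s t (A ∪ B') x y) ∧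
    #B' + numComp s t (A ∪ B') ≤ numComp s t A := by
  classical
  induction B using Finset.induction_on with
  | empty => exact ⟨∅, Subset.rfl, fun _ _ h => h, by simp⟩
  | insert i B hi ih =>
    obtain ⟨B', hB', h1, h2⟩ := ih
    have h3 : ∀ B'' : Set ι, A ∪ B' ⊆ B'' → Conn s t B'' (s i) (t i) →
        ∀ x y, Conn s t (A ∪ (insert i B : Finset ι)) x y → Conn s t B'' x y := by
      intro B'' hB'' hi' x y h
      refine h.of_edges fun j hj => ?_
      rw [coe_insert, Set.union_insert] at hj
      rcases hj with rfl | hj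
      · exact hi'
      · exact (h1 _ _ (.edge hj)).mono hB''
    by_cases hc : Conn s t (A ∪ B') (s i) (t i)
    · exact ⟨B', hB'.trans (subset_insert i B), h3 _ Set.Subset.rfl hc, h2⟩
    · refine ⟨insert i B', insert_subset_insert i hB', h3 _ ?_ (.edge ?_), ?_⟩
      · exact Set.union_subset_union_right _ (by simp)
      · simp
      · have := numComp_insert_lt hc
        rw [card_insert_of_notMem (fun h => hi (hB' h)), coe_insert, Set.union_insert]
        omega

theorem numComp_le_card {K : Finset α} (h : ∀ x, ∃ y ∈ K, Conn s t A x y) :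
    numComp s t A ≤ #K := by
  rw [← Nat.card_eq_finsetCard]
  refine Nat.card_le_card_of_surjective (fun y : K => Quot.mk _ y.1) fun c => ?_
  induction c using Quot.ind with
  | _ x =>
    obtain ⟨y, hy, hxy⟩ := h x
    exact ⟨⟨y, hy⟩, (conn_iff_mk_eq.1 hxy).symm⟩

/-- Vertices in different components. -/
theorem card_le_numComp {K : Finset α} (h : ∀ x ∈ K, ∀ y ∈ K, Conn s t A x y → x = y) :
    #K ≤ numComp s t A := by
  rw [← Nat.card_eq_finsetCard]
  refine Nat.card_le_card_of_injective (fun y : K => Quot.mk _ y.1) fun x y hxy => ?_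
  exact Subtype.ext (h _ x.2 _ y.2 (conn_iff_mk_eq.2 hxy))

theorem add_one_le_numComp {J : Finset α} (hJ : ∀ x ∈ J, ∀ i ∈ A, s i ≠ x ∧ t i ≠ x) {r : α}
    (hr : r ∉ J) : #J + 1 ≤ numComp s t A := by
  classical
  rw [← card_insert_of_notMem hr]
  refine card_le_numComp fun x hx y hy hxy => ?_
  rcases mem_insert.1 hx with rfl | hx
  · rcases mem_insert.1 hy with rfl | hy
    · rfl
    · exact (hxy.symm'.eq_of_isolated (hJ y hy)).symm
  · exact hxy.eq_of_isolated (hJ x hx)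

/-- If there are no more components than the isolated vertices `J` and one more, then the other
vertices are connected. -/
theorem conn_of_numComp_le {J : Finset α} (hJ : ∀ x ∈ J, ∀ i ∈ A, s i ≠ x ∧ t i ≠ x) {r : α}
    (hr : r ∉ J) (hle : numComp s t A ≤ #J + 1) (hx : x ∉ J) : Conn s t A x r := by
  classical
  by_contra hc
  have hne : x ≠ r := fun h => hc (h ▸ .refl' _)
  have : #(insert x (insert r J)) ≤ numComp s t A := by
    refine card_le_numComp fun y hy z hz hyz => ?_
    rcases mem_insert.1 hy with rfl | hy
    · rcases mem_insert.1 hz with rfl | hz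
      · rfl
      · rcases mem_insert.1 hz with rfl | hz
        · exact absurd hyz hc
        · exact (hyz.symm'.eq_of_isolated (hJ z hz)).symm
    · rcases mem_insert.1 hy with rfl | hy
      · rcases mem_insert.1 hz with rfl | hz
        · exact absurd hyz.symm' hc
        · rcases mem_insert.1 hz with rfl | hz
          · rfl
          · exact (hyz.symm'.eq_of_isolated (hJ z hz)).symm
      · exact hyz.eq_of_isolated (hJ y hy)
  rw [card_insert_of_notMem (by simp [hne, hx]), card_insert_of_notMem hr] at this
  omega

end Components

/-! ### Steiner trees -/

section

open scoped Classical

/-- A connected graph with edges `E ⊕ R`, in which the edges in `Q`, among them those in `R`, are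
connected with each other free of charge (as the terminals).  There may be loops, but only at the
vertex `r₀`, which counts as a terminal. -/
structure Steiner (V E R : Type) where
  s : E ⊕ R → V
  t : E ⊕ R → V
  r₀ : V
  Q : Set (E ⊕ R)
  c : E → ℝ
  c_pos : ∀ e, 0 < c e
  mem_Q : ∀ a, .inr a ∈ Q
  conn : ∀ i, Conn s t Set.univ (s i) r₀
  loop : ∀ e, s (.inl e) = t (.inl e) → s (.inl e) = r₀

namespace Steiner

variable {V E R : Type} (S : Steiner V E R)

/-- The vertices at free edges, and the root. -/
def Touched (v : V) : Prop := v = S.r₀ ∨ ∃ i ∈ S.Q, S.s i = v ∨ S.t i = v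

/-- The vertices of the graph; all other elements of `V` are isolated. -/
def Cov (v : V) : Prop := Conn S.s S.t Set.univ v S.r₀

/-- The edge `e` has the end `v`. -/
def Inc (v : V) (e : E) : Prop := S.s (.inl e) = v ∨ S.t (.inl e) = v

/-- The purchase of the edges in `D` connects all terminals, and these edges with them. -/
def Feasible (D : Finset E) : Prop :=
  ∀ i ∈ S.Q ∪ Sum.inl '' (D : Set E), Conn S.s S.t (S.Q ∪ Sum.inl '' (D : Set E)) (S.s i) S.r₀

variable {S}

theorem cov_t (i : E ⊕ R) : S.Cov (S.t i) := (Conn.edge (Set.mem_univ i)).symm'.trans' (S.conn i)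

theorem cov_r₀ : S.Cov S.r₀ := .refl' _

theorem Inc.cov {v : V} {e : E} (h : S.Inc v e) : S.Cov v := by
  rcases h with rfl | rfl
  · exact S.conn _
  · exact cov_t _

theorem Feasible.inc {D : Finset E} (hD : S.Feasible D) {e : E} (he : e ∈ D) {v : V}
    (hv : S.Inc v e) : Conn S.s S.t (S.Q ∪ Sum.inl '' (D : Set E)) v S.r₀ := by
  have hm : Sum.inl e ∈ S.Q ∪ Sum.inl '' (D : Set E) := .inr ⟨e, he, rfl⟩
  rcases hv with rfl | rfl
  · exact hD _ hm
  · exact (Conn.edge hm).symm'.trans' (hD _ hm)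

theorem Feasible.touched {D : Finset E} (hD : S.Feasible D) {v : V} (hv : S.Touched v) :
    Conn S.s S.t (S.Q ∪ Sum.inl '' (D : Set E)) v S.r₀ := by
  rcases hv with rfl | ⟨i, hi, hv⟩
  · exact .refl' _
  · have hm : i ∈ S.Q ∪ Sum.inl '' (D : Set E) := .inl hi
    rcases hv with rfl | rfl
    · exact hD _ hm
    · exact (Conn.edge hm).symm'.trans' (hD _ hm)

variable [Fintype E]

variable (S) in
/-- The number of edges at a vertex; arcs, which are all free, do not count. -/
noncomputable def deg (v : V) : ℕ := #{e : E | S.Inc v e}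

variable (S) in
/-- The vertices that are of no use for branching. -/
def Thin (v : V) : Prop := ¬ S.Touched v ∧ S.deg v = 2

variable (S) in
/-- Two edges share a thin vertex. -/
def Link (e e' : E) : Prop := ∃ v, S.Thin v ∧ S.Inc v e ∧ S.Inc v e'

/-- An edge at a vertex of `X` cannot be bought, nor can the rest of its thread. -/
def Dead (S : Steiner V E R) (X : Finset V) (e : E) : Prop :=
  ∃ e', Relation.EqvGen S.Link e e' ∧ ∃ x ∈ X, S.Inc x e'

theorem Dead.congr {X : Finset V} {e e' : E} (h : Relation.EqvGen S.Link e e') :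
    Dead S X e ↔ Dead S X e' :=
  ⟨fun ⟨f, hf, hx⟩ => ⟨f, (h.symm _ _).trans _ _ _ hf, hx⟩,
    fun ⟨f, hf, hx⟩ => ⟨f, h.trans _ _ _ hf, hx⟩⟩

variable (S) in
/-- The threads are the classes of edges linked by thin vertices; `rep` picks a representative of
each. -/
structure IsRep (rep : E → E) : Prop where
  eq_iff : ∀ e e', rep e = rep e' ↔ Relation.EqvGen S.Link e e'
  idem : ∀ e, rep (rep e) = rep e

/-- The edges that are contracted: the free ones, and all edges of a thread but its representative. -/
def contracted (S : Steiner V E R) (rep : E → E) : Set (E ⊕ R) :=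
  S.Q ∪ Sum.inl '' {e | rep e ≠ e}

/-- After the contraction, the edges in `T` connect all vertices. -/
def SpansContracted (S : Steiner V E R) (rep : E → E) (T : Finset E) : Prop :=
  ∀ v, S.Cov v → Conn S.s S.t (contracted S rep ∪ Sum.inl '' (T : Set E)) v S.r₀

/-- The representative of a thread has the cost of the thread, or the cost `b` if the thread is
dead. -/
noncomputable def weight (S : Steiner V E R) (rep : E → E) (X : Finset V) (b : ℝ) (e : E) : ℝ :=
  if rep e = e then if Dead S X e then b else ∑ e' with rep e' = e, S.c e' else S.c e

/-- The union of the living threads whose representatives are in `T`. -/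
noncomputable def purchase (S : Steiner V E R) (rep : E → E) (X : Finset V) (T : Finset E) :
    Finset E :=
  {e | Sum.inl e ∉ S.Q ∧ rep e ∈ T ∧ ¬ Dead S X e}

/-- The representatives in `T` of dead threads. -/
noncomputable def deadReps (S : Steiner V E R) (rep : E → E) (X : Finset V) (T : Finset E) :
    Finset E :=
  {e ∈ T | rep e = e ∧ Dead S X e}

theorem Thin.exists_pair {v : V} (hv : S.Thin v) : ∃ e₁ e₂, ∀ e, S.Inc v e ↔ e = e₁ ∨ e = e₂ := by
  obtain ⟨e₁, e₂, -, h⟩ := card_eq_two.1 hv.2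
  refine ⟨e₁, e₂, fun e => ?_⟩
  have := congrArg (e ∈ ·) h
  simpa using this

variable {rep : E → E} {X : Finset V} {T : Finset E}

/-- A set of threads with few thin vertices has few edges, as each thin vertex links only two. -/
theorem card_nonrep_le (hrep : S.IsRep rep) {bad : E → Prop}
    (hbad : ∀ e e', S.Link e e' → bad e → bad e') {U : Finset E}
    (hU : ∀ e ∈ U, bad e ∧ rep e ≠ e) {Z : Finset V}
    (hZ : ∀ v, S.Thin v → (∀ e, S.Inc v e → bad e) → v ∈ Z) : #U ≤ #Z := by
  rcases U.eq_empty_or_nonempty with rfl | ⟨e₀, -⟩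
  · simp
  have : Nonempty E := ⟨e₀⟩
  have hpair : ∀ v, S.Thin v → ∃ e₁ e₂, ∀ e, S.Inc v e ↔ e = e₁ ∨ e = e₂ :=
    fun v hv => hv.exists_pair
  choose! e₁ e₂ h12 using hpair
  have hlink : ∀ e e', S.Link e e' → (bad e ↔ bad e') ∧ (bad e → Conn e₁ e₂ (Z : Set V) e e') := by
    intro e e' h
    obtain ⟨v, hv, he, he'⟩ := h
    have hb : ∀ f f', S.Inc v f → S.Inc v f' → bad f → bad f' :=
      fun f f' h h' => hbad f f' ⟨v, hv, h, h'⟩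
    refine ⟨⟨hb _ _ he he', hb _ _ he' he⟩, fun hbe => ?_⟩
    have hvZ : v ∈ (Z : Set V) := hZ v hv fun f hf => hb _ _ he hf hbe
    have hedge : Conn e₁ e₂ (Z : Set V) (e₁ v) (e₂ v) := .edge hvZ
    rcases (h12 v hv e).1 he with rfl | rfl <;> rcases (h12 v hv e').1 he' with rfl | rfl
    · exact .refl' _
    · exact hedge
    · exact hedge.symm'
    · exact .refl' _
  have hclass : ∀ e e', Relation.EqvGen S.Link e e' →
      (bad e ↔ bad e') ∧ (bad e → Conn e₁ e₂ (Z : Set V) e e') := by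
    intro e e' h
    induction h with
    | rel x y h => exact hlink x y h
    | refl x => exact ⟨Iff.rfl, fun _ => .refl' _⟩
    | symm x y _ ih => exact ⟨ih.1.symm, fun h => (ih.2 (ih.1.2 h)).symm'⟩
    | trans x y z _ _ ih1 ih2 =>
      exact ⟨ih1.1.trans ih2.1, fun h => (ih1.2 h).trans' (ih2.2 (ih1.1.1 h))⟩
  have h1 : numComp e₁ e₂ (Z : Set V) ≤ #(univ \ U) := by
    refine numComp_le_card fun e => ?_
    by_cases he : e ∈ U
    · refine ⟨rep e, ?_, (hclass e (rep e) ?_).2 (hU e he).1⟩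
      · simp only [mem_sdiff, mem_univ, true_and]
        exact fun h => (hU _ h).2 (hrep.idem e)
      · exact (hrep.eq_iff _ _).1 (hrep.idem e).symm
    · exact ⟨e, by simp [he], .refl' _⟩
  have h2 := numComp_union (s := e₁) (t := e₂) (A := ∅) Z
  rw [numComp_empty, Set.empty_union, Nat.card_eq_fintype_card] at h2
  have h3 := card_sdiff_add_card_eq_card (subset_univ U)
  rw [card_univ] at h3
  omega

theorem weight_nonneg {b : ℝ} (hb : 0 ≤ b) (e : E) : 0 ≤ weight S rep X b e := by
  unfold weight
  split_ifs
  · exact hb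
  · exact sum_nonneg fun e _ => (S.c_pos e).le
  · exact (S.c_pos e).le

theorem cost_purchase_le (hrep : S.IsRep rep) {b : ℝ} (hb : 0 ≤ b) :
    ∑ e ∈ purchase S rep X T, S.c e + #(deadReps S rep X T) * b ≤ ∑ e ∈ T, weight S rep X b e := by
  have hsub : deadReps S rep X T ⊆ T := filter_subset _ _
  rw [← sum_sdiff hsub]
  refine add_le_add ?_ (le_of_eq ?_)
  · have hmaps : ∀ e ∈ purchase S rep X T, rep e ∈ {r ∈ T \ deadReps S rep X T | rep r = r} := by
      intro e he
      simp only [purchase, mem_filter, mem_univ, true_and] at he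
      simp only [deadReps, mem_filter, mem_sdiff, he.2.1, true_and, hrep.idem, and_true]
      rw [Dead.congr ((hrep.eq_iff _ _).1 (hrep.idem e))]
      exact he.2.2
    rw [← sum_fiberwise_of_maps_to hmaps]
    refine (sum_le_sum fun r hr => ?_).trans
      (sum_le_sum_of_subset_of_nonneg (filter_subset _ _) fun e _ _ => weight_nonneg hb e)
    simp only [deadReps, mem_filter, mem_sdiff, not_and] at hr
    rw [weight, if_pos hr.2, if_neg (hr.1.2 hr.1.1 hr.2)]
    exact sum_le_sum_of_subset_of_nonneg (fun e he => by simpa using (mem_filter.1 he).2)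
      fun e _ _ => (S.c_pos e).le
  · rw [sum_congr rfl fun e he => ?_, sum_const, nsmul_eq_mul]
    simp only [deadReps, mem_filter] at he
    rw [weight, if_pos he.2.1, if_pos he.2.2]

variable [Fintype V]

/-- Compare the numbers of components of the graph of the purchase and of the contracted graph. -/
theorem feasible_purchase (hrep : S.IsRep rep)
    (hX : ∀ x ∈ X, S.Cov x ∧ ¬ S.Touched x ∧ ¬ S.Thin x) (hT : SpansContracted S rep T) :
    #X ≤ #(deadReps S rep X T) ∧
      (#(deadReps S rep X T) ≤ #X → S.Feasible (purchase S rep X T)) := by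
  set D := purchase S rep X T with hD
  set bad : E → Prop := fun e => rep e ∉ T ∨ Dead S X e with hbad
  set U : Finset E := {e | bad e ∧ rep e ≠ e} with hU
  set Z : Finset V := {v | S.Thin v ∧ ∀ e, S.Inc v e → bad e} with hZ
  set N : Finset V := {v | ¬ S.Cov v} with hN
  set A : Set (E ⊕ R) := S.Q ∪ Sum.inl '' (D : Set E) with hA
  have hDbad : ∀ e ∈ D, ¬ bad e := by
    intro e he
    simp only [hD, purchase, mem_filter, mem_univ, true_and] at he
    simp [hbad, he]
  have hUZ : #U ≤ #Z := by
    refine card_nonrep_le hrep (bad := bad) ?_ (fun e he => by simpa [hU] using he)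
      fun v h1 h2 => by simpa [hZ] using ⟨h1, h2⟩
    intro e e' h
    have h' := Relation.EqvGen.rel e e' h
    simp only [hbad, (hrep.eq_iff e e').2 h', Dead.congr h']
    exact id
  have hXZ : Disjoint X Z := disjoint_left.2 fun x hx hz =>
    (hX x hx).2.2 (by simp only [hZ, mem_filter] at hz; exact hz.2.1)
  have hXZN : Disjoint (X ∪ Z) N := by
    refine disjoint_left.2 fun x hx hn => ?_
    simp only [hN, mem_filter, mem_univ, true_and] at hn
    rcases mem_union.1 hx with hx | hx
    · exact hn (hX x hx).1
    · simp only [hZ, mem_filter, mem_univ, true_and] at hx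
      obtain ⟨e₁, e₂, h⟩ := hx.1.exists_pair
      exact hn ((h e₁).2 (.inl rfl)).cov
  have hJcard : #((X ∪ Z) ∪ N) = #X + #Z + #N := by
    rw [card_union_of_disjoint hXZN, card_union_of_disjoint hXZ]
  have hJ : ∀ x ∈ (X ∪ Z) ∪ N, ∀ i ∈ A, S.s i ≠ x ∧ S.t i ≠ x := by
    intro x hx i hi
    rw [← not_or]
    intro hinc
    rcases mem_union.1 hx with hx | hx
    · have hunt : ¬ S.Touched x := by
        rcases mem_union.1 hx with hx | hx
        · exact (hX x hx).2.1
        · simp only [hZ, mem_filter, mem_univ, true_and] at hx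
          exact hx.1.1
      rcases hi with hi | ⟨e, he, rfl⟩
      · exact hunt (.inr ⟨i, hi, hinc⟩)
      · rcases mem_union.1 hx with hx | hx
        · exact hDbad e he (.inr ⟨e, .refl _, x, hx, hinc⟩)
        · simp only [hZ, mem_filter, mem_univ, true_and] at hx
          exact hDbad e he (hx.2 e hinc)
    · simp only [hN, mem_filter, mem_univ, true_and] at hx
      rcases hinc with rfl | rfl
      · exact hx (S.conn i)
      · exact hx (cov_t i)
  have hr : S.r₀ ∉ (X ∪ Z) ∪ N := by
    simp only [mem_union, not_or]
    refine ⟨⟨fun h => (hX _ h).2.1 (.inl rfl), fun h => ?_⟩, fun h => ?_⟩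
    · simp only [hZ, mem_filter, mem_univ, true_and] at h
      exact h.1.1 (.inl rfl)
    · simp only [hN, mem_filter, mem_univ, true_and] at h
      exact h cov_r₀
  -- the purchase, the other contracted edges and the dead representatives connect the graph
  have hsub : contracted S rep ∪ Sum.inl '' (T : Set E) ⊆
      (A ∪ (U.image Sum.inl : Finset (E ⊕ R))) ∪
        ((deadReps S rep X T).image Sum.inl : Finset (E ⊕ R)) := by
    have hcon : contracted S rep ⊆ A ∪ (U.image Sum.inl : Finset (E ⊕ R)) := by
      rintro i (hi | ⟨e, he, rfl⟩)
      · exact .inl (.inl hi)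
      · by_cases hb : bad e
        · refine .inr ?_
          rw [coe_image]
          exact ⟨e, by simpa [hU] using ⟨hb, he⟩, rfl⟩
        · by_cases hQ : Sum.inl e ∈ S.Q
          · exact .inl (.inl hQ)
          · refine .inl (.inr ⟨e, ?_, rfl⟩)
            simp only [hbad, not_or, not_not] at hb
            simpa [hD, purchase] using ⟨hQ, hb⟩
    rintro i (hi | ⟨e, he, rfl⟩)
    · exact .inl (hcon hi)
    · by_cases hre : rep e = e
      · by_cases hd : Dead S X e
        · refine .inr ?_
          rw [coe_image]
          exact ⟨e, by simpa [deadReps] using ⟨he, hre, hd⟩, rfl⟩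
        · by_cases hQ : Sum.inl e ∈ S.Q
          · exact .inl (.inl (.inl hQ))
          · refine .inl (.inl (.inr ⟨e, ?_, rfl⟩))
            have he' : e ∈ T := he
            simp [hD, purchase, hQ, hd, hre, he']
      · exact .inl (hcon (.inr ⟨e, hre, rfl⟩))
  have hup : numComp S.s S.t ((A ∪ (U.image Sum.inl : Finset (E ⊕ R))) ∪
      ((deadReps S rep X T).image Sum.inl : Finset (E ⊕ R))) ≤ #N + 1 := by
    rw [← card_insert_of_notMem (fun h => hr (mem_union_right _ h))]
    refine numComp_le_card fun v => ?_
    by_cases hv : S.Cov v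
    · exact ⟨S.r₀, mem_insert_self _ _, (hT v hv).mono hsub⟩
    · exact ⟨v, mem_insert_of_mem (by simpa [hN] using hv), .refl' _⟩
  have hlow := add_one_le_numComp hJ hr
  have h1 := numComp_union (s := S.s) (t := S.t) (A := A) (U.image Sum.inl)
  have h2 := numComp_union (s := S.s) (t := S.t) (A := A ∪ (U.image Sum.inl : Finset (E ⊕ R)))
    ((deadReps S rep X T).image Sum.inl)
  have h3 := card_image_le (s := U) (f := (Sum.inl : E → E ⊕ R))
  have h4 := card_image_le (s := deadReps S rep X T) (f := (Sum.inl : E → E ⊕ R))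
  refine ⟨by omega, fun hle i hi => conn_of_numComp_le hJ hr (by omega) fun h => ?_⟩
  exact (hJ _ h i hi).1 rfl

end Steiner

end

section

open scoped Classical

namespace Steiner

variable {V E R : Type} {S : Steiner V E R}

/-! ### Optimal Steiner trees consist of threads -/

/-- A feasible purchase of minimum cost. -/
def Optimal (S : Steiner V E R) (D : Finset E) : Prop :=
  S.Feasible D ∧ ∀ D', S.Feasible D' → ∑ e ∈ D, S.c e ≤ ∑ e ∈ D', S.c e

/-- A Steiner vertex is no leaf of an optimal tree. -/
theorem Optimal.exists_ne {D : Finset E} (hD : S.Optimal D) {v : V} (hv : ¬ S.Touched v) {e : E}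
    (he : e ∈ D) (hve : S.Inc v e) : ∃ e' ∈ D, e' ≠ e ∧ S.Inc v e' := by
  by_contra! hne
  have hvr : v ≠ S.r₀ := fun h => hv (.inl h)
  have hloop : S.s (.inl e) ≠ S.t (.inl e) := by
    intro h
    have := S.loop e h
    rcases hve with h' | h'
    · exact hvr (h'.symm.trans this)
    · exact hvr (h'.symm.trans (h.symm.trans this))
  -- remove the edge, and map `v` to the other end of it
  set u := if S.s (.inl e) = v then S.t (.inl e) else S.s (.inl e) with hu
  set φ : V → V := fun x => if x = v then u else x with hφ
  set B : Set (E ⊕ R) := S.Q ∪ Sum.inl '' ((D.erase e : Finset E) : Set E) with hB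
  have hnot : ∀ i ∈ B, S.s i ≠ v ∧ S.t i ≠ v := by
    intro i hi
    rw [← not_or]
    intro hinc
    rcases hi with hi | ⟨e', he', rfl⟩
    · exact hv (.inr ⟨i, hi, hinc⟩)
    · have := mem_erase.1 he'
      exact hne e' this.2 this.1 hinc
  have hmap : ∀ i ∈ S.Q ∪ Sum.inl '' (D : Set E), Conn S.s S.t B (φ (S.s i)) (φ (S.t i)) := by
    intro i hi
    by_cases hie : i = Sum.inl e
    · subst hie
      have : φ (S.s (.inl e)) = φ (S.t (.inl e)) := by
        simp only [hφ, hu]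
        by_cases h1 : S.s (.inl e) = v
        · simp [h1, show S.t (.inl e) ≠ v from fun h => hloop (h1.trans h.symm)]
        · simp [h1, show S.t (.inl e) = v from hve.resolve_left h1]
      rw [this]
      exact .refl' _
    · have hiB : i ∈ B := by
        rcases hi with hi | ⟨e', he', rfl⟩
        · exact .inl hi
        · exact .inr ⟨e', mem_erase.2 ⟨fun h => hie (by rw [h]), he'⟩, rfl⟩
      simp only [hφ, (hnot i hiB).1, (hnot i hiB).2, if_false]
      exact .edge hiB
  have hfeas : S.Feasible (D.erase e) := by
    intro i hi
    have hi' : i ∈ S.Q ∪ Sum.inl '' (D : Set E) :=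
      Set.union_subset_union_right _ (Set.image_mono (by simp)) hi
    have := (hD.1 i hi').map hmap
    simpa only [hφ, (hnot i hi).1, if_false, hvr.symm] using this
  have h1 := hD.2 _ hfeas
  have h2 := add_sum_erase D S.c he
  have h3 := S.c_pos e
  linarith

variable [Fintype E]

theorem Optimal.mem_of_link {D : Finset E} (hD : S.Optimal D) {e e' : E}
    (h : Relation.EqvGen S.Link e e') : e ∈ D ↔ e' ∈ D := by
  have key : ∀ e e', S.Link e e' → e ∈ D → e' ∈ D := by
    rintro e e' ⟨v, hv, he, he'⟩ heD
    obtain ⟨f, hf, hne, hvf⟩ := hD.exists_ne hv.1 heD he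
    obtain ⟨e₁, e₂, h12⟩ := hv.exists_pair
    rcases (h12 e).1 he with rfl | rfl <;> rcases (h12 e').1 he' with rfl | rfl <;>
      rcases (h12 f).1 hvf with rfl | rfl <;> first | assumption | exact absurd rfl hne
  induction h with
  | rel x y h => exact ⟨key x y h, key y x (by obtain ⟨v, h1, h2, h3⟩ := h; exact ⟨v, h1, h3, h2⟩)⟩
  | refl x => exact Iff.rfl
  | symm x y _ ih => exact ih.symm
  | trans x y z _ _ ih1 ih2 => exact ih1.trans ih2

variable [Fintype V] {rep : E → E} {X : Finset V}

/-- From any end of an edge, the thread of the edge without the representative leads to a vertex that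
is not thin.  Otherwise the set `W` of vertices reached would consist of vertices of degree two, and by
parity the representative could not be the only edge leaving it. -/
theorem Inc.exists_end (hrep : S.IsRep rep) {z : V} {e : E} (he : S.Inc z e) :
    ∃ y, ¬ S.Thin y ∧ Conn S.s S.t (Sum.inl '' {e | rep e ≠ e}) z y ∧
      ∃ e', S.Inc y e' ∧ Relation.EqvGen S.Link e e' := by
  by_contra! hno
  set K : Set (E ⊕ R) := Sum.inl '' {f | rep f ≠ f ∧ Relation.EqvGen S.Link e f} with hK
  set W : Finset V := {w | Conn S.s S.t K z w} with hW
  have hmemW : ∀ w, w ∈ W ↔ Conn S.s S.t K z w := fun w => by simp [hW]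
  have hKsub : K ⊆ Sum.inl '' {e | rep e ≠ e} := Set.image_mono fun f hf => hf.1
  have hthin : ∀ w ∈ W, S.Thin w ∧ ∃ f, S.Inc w f ∧ Relation.EqvGen S.Link e f := by
    intro w hw
    rw [hmemW] at hw
    have hf : ∃ f, S.Inc w f ∧ Relation.EqvGen S.Link e f := by
      rcases hw.eq_or_mem with rfl | ⟨_, ⟨f, hf, rfl⟩, hinc⟩
      · exact ⟨e, he, .refl _⟩
      · exact ⟨f, hinc, hf.2⟩
    refine ⟨?_, hf⟩
    by_contra hw'
    obtain ⟨f, h1, h2⟩ := hf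
    exact hno w hw' (hw.mono hKsub) f h1 h2
  have hlink : ∀ w ∈ W, ∀ f, S.Inc w f → Relation.EqvGen S.Link e f := by
    intro w hw f hf
    obtain ⟨hwt, f', h1, h2⟩ := hthin w hw
    exact h2.trans _ _ _ (.rel _ _ ⟨w, hwt, h1, hf⟩)
  have hr : S.r₀ ∉ W := fun h => (hthin _ h).1.1 (.inl rfl)
  have hstep : ∀ f, rep f ≠ f → (S.s (.inl f) ∈ W ↔ S.t (.inl f) ∈ W) := by
    intro f hf
    constructor
    · intro h
      have := hlink _ h f (.inl rfl)
      rw [hmemW] at h ⊢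
      exact h.trans' (Conn.edge (show Sum.inl f ∈ K from ⟨f, ⟨hf, this⟩, rfl⟩))
    · intro h
      have := hlink _ h f (.inr rfl)
      rw [hmemW] at h ⊢
      exact h.trans' (Conn.edge (show Sum.inl f ∈ K from ⟨f, ⟨hf, this⟩, rfl⟩)).symm'
  have hdouble : ∑ f : E, #{w ∈ W | S.Inc w f} = 2 * #W := by
    have h1 := sum_card_bipartiteAbove_eq_sum_card_bipartiteBelow (s := W) (t := (univ : Finset E))
      (fun w f => S.Inc w f)
    simp only [bipartiteAbove, bipartiteBelow] at h1
    rw [← h1]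
    exact (sum_congr rfl fun w hw => (hthin w hw).1.2).trans (by simp [mul_comm])
  have hcount : ∀ f : E, #{w ∈ W | S.Inc w f} =
      (if S.s (.inl f) ∈ W then 1 else 0) + if S.t (.inl f) ∈ W then 1 else 0 := by
    intro f
    by_cases hl : S.s (.inl f) = S.t (.inl f)
    · have h1 : S.s (.inl f) ∉ W := by rw [S.loop f hl]; exact hr
      have h2 : S.t (.inl f) ∉ W := hl ▸ h1
      rw [if_neg h1, if_neg h2, card_eq_zero, filter_eq_empty_iff]
      rintro w hw (rfl | rfl)
      · exact h1 hw
      · exact h2 hw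
    · have : ({w ∈ W | S.Inc w f} : Finset V) =
          (if S.s (.inl f) ∈ W then {S.s (.inl f)} else ∅) ∪
            if S.t (.inl f) ∈ W then {S.t (.inl f)} else ∅ := by
        ext w
        rw [mem_filter, mem_union]
        constructor
        · rintro ⟨hw, rfl | rfl⟩
          · left; simp [hw]
          · right; simp [hw]
        · rintro (h | h) <;> split_ifs at h with h' <;> simp at h
          · subst h; exact ⟨h', .inl rfl⟩
          · subst h; exact ⟨h', .inr rfl⟩
      rw [this, card_union_of_disjoint]
      · split_ifs <;> simp
      · split_ifs <;> simp [hl]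
  have hrest : ∀ f ∈ univ.erase (rep e), 2 ∣ #{w ∈ W | S.Inc w f} := by
    intro f hf
    rw [hcount]
    by_cases hinc : S.s (.inl f) ∈ W ∨ S.t (.inl f) ∈ W
    · have hf' : Relation.EqvGen S.Link e f := by
        rcases hinc with h | h
        · exact hlink _ h f (.inl rfl)
        · exact hlink _ h f (.inr rfl)
      have h1 : rep f ≠ f := by
        rw [← (hrep.eq_iff _ _).2 hf']
        exact (ne_of_mem_erase hf).symm
      have h2 := hstep f h1
      by_cases h3 : S.s (.inl f) ∈ W
      · simp [h3, h2.1 h3]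
      · have h4 : S.t (.inl f) ∉ W := fun h => h3 (h2.2 h)
        simp [h3, h4]
    · rw [not_or] at hinc
      simp [hinc]
  have hclosed : ∀ f : E, S.s (.inl f) ∈ W ↔ S.t (.inl f) ∈ W := by
    intro f
    by_cases hf : rep f = f
    · by_cases hfe : f = rep e
      · have h1 := add_sum_erase univ (fun f => #{w ∈ W | S.Inc w f}) (mem_univ (rep e))
        rw [hdouble] at h1
        have h2 : 2 ∣ ∑ f ∈ univ.erase (rep e), #{w ∈ W | S.Inc w f} := dvd_sum hrest
        have h3 : 2 ∣ #{w ∈ W | S.Inc w (rep e)} := by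
          rw [Nat.dvd_add_iff_left h2, h1]
          exact dvd_mul_right _ _
        rw [hcount, ← hfe] at h3
        by_cases h4 : S.s (.inl f) ∈ W <;> by_cases h5 : S.t (.inl f) ∈ W <;> simp [h4, h5] at h3 ⊢
      · have hnot : ∀ w ∈ W, ¬ S.Inc w f := fun w hw hinc =>
          hfe (((hrep.eq_iff _ _).2 (hlink w hw f hinc)).trans hf).symm
        exact ⟨fun h => absurd (.inl rfl) (hnot _ h), fun h => absurd (.inr rfl) (hnot _ h)⟩
    · exact hstep f hf
  have hz : (z ∈ W) = (S.r₀ ∈ W) := by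
    refine Conn.map_eq (φ := (· ∈ W)) ?_ he.cov
    rintro (f | a) -
    · exact propext (hclosed f)
    · refine propext ⟨fun h => ?_, fun h => ?_⟩
      · exact absurd (.inr ⟨_, S.mem_Q a, .inl rfl⟩) (hthin _ h).1.1
      · exact absurd (.inr ⟨_, S.mem_Q a, .inr rfl⟩) (hthin _ h).1.1
  exact hr (hz ▸ (hmemW z).2 (.refl' _))

/-- The representatives of the threads of an optimal tree and, for each unused vertex that is not
thin, a dead representative are enough to connect the contracted graph. -/
theorem Optimal.exists_spans {D : Finset E} (hD : S.Optimal D) (hrep : S.IsRep rep)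
    (hX : ∀ v, v ∈ X ↔ S.Cov v ∧ ¬ S.Touched v ∧ S.deg v ≠ 2 ∧ ∀ e ∈ D, ¬ S.Inc v e) {b : ℝ}
    (hb : 0 ≤ b) : ∃ T, SpansContracted S rep T ∧
      ∑ e ∈ T, weight S rep X b e ≤ ∑ e ∈ D, S.c e + #X * b := by
  set C := contracted S rep with hC
  set A : Finset E := {e ∈ D | rep e = e} with hA
  set H : Finset E := {e | rep e = e ∧ Dead S X e} with hH
  set N : Finset V := {v | ¬ S.Cov v} with hN
  have hrN : S.r₀ ∉ N := by simpa [hN] using cov_r₀ (S := S)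
  have hCA : S.Q ∪ Sum.inl '' (D : Set E) ⊆ C ∪ Sum.inl '' (A : Set E) := by
    rintro i (hi | ⟨e, he, rfl⟩)
    · exact .inl (.inl hi)
    · by_cases h : rep e = e
      · exact .inr ⟨e, by simpa [hA] using ⟨he, h⟩, rfl⟩
      · exact .inl (.inr ⟨e, h, rfl⟩)
  -- a vertex that is not thin is in `X`, or it belongs to the optimal tree
  have hfat : ∀ v, S.Cov v → ¬ S.Thin v → v ∉ X →
      Conn S.s S.t (C ∪ Sum.inl '' (A : Set E)) v S.r₀ := by
    intro v hv hthin hvX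
    by_cases ht : S.Touched v
    · exact (hD.1.touched ht).mono hCA
    · rw [hX] at hvX
      push Not at hvX
      obtain ⟨e, he, hve⟩ := hvX hv ht fun h => hthin ⟨ht, h⟩
      exact (hD.1.inc he hve).mono hCA
  have hendC : Sum.inl '' {e | rep e ≠ e} ⊆ C ∪ Sum.inl '' (A : Set E) := fun i hi => .inl (.inr hi)
  have hend : ∀ z e, S.Inc z e → ∃ y, S.Cov y ∧ ¬ S.Thin y ∧
      Conn S.s S.t (C ∪ Sum.inl '' (A : Set E)) z y ∧ (y ∈ X → Dead S X e) := by
    intro z e he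
    obtain ⟨y, h1, h2, e', h3, h4⟩ := he.exists_end hrep
    exact ⟨y, h3.cov, h1, h2.mono hendC, fun hy => ⟨e', h4, y, hy, h3⟩⟩
  have hcomp : numComp S.s S.t (C ∪ Sum.inl '' (A : Set E)) ≤ #X + #N + 1 := by
    have h1 : numComp S.s S.t (C ∪ Sum.inl '' (A : Set E)) ≤ #(insert S.r₀ (X ∪ N)) := by
      refine numComp_le_card fun v => ?_
      by_cases hv : S.Cov v
      · have hnt : ∀ y, S.Cov y → ¬ S.Thin y → ∃ x ∈ insert S.r₀ (X ∪ N),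
            Conn S.s S.t (C ∪ Sum.inl '' (A : Set E)) y x := by
          intro y hy hyt
          by_cases hyX : y ∈ X
          · exact ⟨y, by simp [hyX], .refl' _⟩
          · exact ⟨S.r₀, by simp, hfat y hy hyt hyX⟩
        by_cases hvt : S.Thin v
        · obtain ⟨e₁, e₂, h12⟩ := hvt.exists_pair
          obtain ⟨y, hy1, hy2, hy3, -⟩ := hend v e₁ ((h12 e₁).2 (.inl rfl))
          obtain ⟨x, hx, hyx⟩ := hnt y hy1 hy2
          exact ⟨x, hx, hy3.trans' hyx⟩
        · exact hnt v hv hvt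
      · exact ⟨v, by simp [hN, hv], .refl' _⟩
    have h2 := card_insert_le S.r₀ (X ∪ N)
    have h3 := card_union_le X N
    omega
  have hspan : ∀ v, S.Cov v →
      Conn S.s S.t ((C ∪ Sum.inl '' (A : Set E)) ∪ (H.image Sum.inl : Finset (E ⊕ R))) v S.r₀ := by
    intro v hv
    refine hv.of_edges fun i _ => ?_
    have hsub : C ∪ Sum.inl '' (A : Set E) ⊆
        (C ∪ Sum.inl '' (A : Set E)) ∪ (H.image Sum.inl : Finset (E ⊕ R)) := Set.subset_union_left
    rcases i with e | a
    · by_cases hre : rep e = e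
      · by_cases hdead : Dead S X e
        · refine .edge (.inr ?_)
          rw [coe_image]
          exact ⟨e, by simpa [hH] using ⟨hre, hdead⟩, rfl⟩
        · -- both ends of a living edge are joined to the optimal tree
          have hends : ∀ v, S.Inc v e → Conn S.s S.t (C ∪ Sum.inl '' (A : Set E)) v S.r₀ := by
            intro v hve
            by_cases hvt : S.Thin v
            · obtain ⟨y, hy1, hy2, hy3, hy4⟩ := hend v e hve
              exact hy3.trans' (hfat y hy1 hy2 fun h => hdead (hy4 h))
            · exact hfat v hve.cov hvt fun h => hdead ⟨e, .refl _, v, h, hve⟩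
          exact ((hends _ (.inl rfl)).trans' (hends _ (.inr rfl)).symm').mono hsub
      · exact .edge (.inl (.inl (.inr ⟨e, hre, rfl⟩)))
    · exact .edge (.inl (.inl (.inl (S.mem_Q a))))
  obtain ⟨B', hB', h1, h2⟩ := exists_greedy (s := S.s) (t := S.t) (C ∪ Sum.inl '' (A : Set E))
    (H.image Sum.inl)
  have hlow : #N + 1 ≤ numComp S.s S.t ((C ∪ Sum.inl '' (A : Set E)) ∪ B') := by
    refine add_one_le_numComp (fun x hx i _ => ?_) hrN
    have hx' : ¬ S.Cov x := by simpa [hN] using hx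
    refine ⟨?_, ?_⟩ <;> rintro rfl
    · exact hx' (S.conn i)
    · exact hx' (cov_t i)
  obtain ⟨B, hBH, rfl⟩ := subset_image_iff.1 hB'
  rw [card_image_of_injective _ Sum.inl_injective] at h2
  have hBX : #B ≤ #X := by omega
  refine ⟨A ∪ B, fun v hv => (h1 _ _ (hspan v hv)).mono ?_, ?_⟩
  · rw [coe_union, Set.image_union, ← Set.union_assoc, coe_image]
  · have hle : ∑ e ∈ A ∪ B, weight S rep X b e ≤
        ∑ e ∈ A, weight S rep X b e + ∑ e ∈ B, weight S rep X b e := by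
      rw [← sum_union_inter]
      have : 0 ≤ ∑ e ∈ A ∩ B, weight S rep X b e := sum_nonneg fun e _ => weight_nonneg hb e
      linarith
    refine hle.trans (add_le_add (le_of_eq ?_) ?_)
    · have hmaps : ∀ e ∈ D, rep e ∈ A := by
        intro e he
        have := (hD.mem_of_link ((hrep.eq_iff _ _).1 (hrep.idem e).symm)).1 he
        simpa [hA, hrep.idem] using this
      rw [← sum_fiberwise_of_maps_to hmaps]
      refine sum_congr rfl fun r hr => ?_
      have hr' : r ∈ D ∧ rep r = r := by simpa [hA] using hr
      have halive : ¬ Dead S X r := by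
        rintro ⟨e', he', x, hx, hxe⟩
        exact ((hX x).1 hx).2.2.2 e' ((hD.mem_of_link he').1 hr'.1) hxe
      rw [weight, if_pos hr'.2, if_neg halive]
      refine sum_congr ?_ fun _ _ => rfl
      ext e
      simp only [mem_filter, mem_univ, true_and]
      refine ⟨fun he => ⟨?_, he⟩, fun h => h.2⟩
      refine (hD.mem_of_link ((hrep.eq_iff e r).1 ?_)).2 hr'.1
      rw [he, hr'.2]
    · have : ∀ e ∈ B, weight S rep X b e = b := by
        intro e he
        have := hBH he
        simp only [hH, mem_filter, mem_univ, true_and] at this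
        rw [weight, if_pos this.1, if_pos this.2]
      rw [sum_congr rfl this, sum_const, nsmul_eq_mul]
      exact mul_le_mul_of_nonneg_right (by exact_mod_cast hBX) hb

end Steiner

end

namespace MixedGraph

variable {G : MixedGraph}

/-! ### Eulerian tours -/

theorem IsWalk.append {u v w : Fin G.n} {L L' : List G.Step} (h : IsWalk u L v)
    (h' : IsWalk v L' w) : IsWalk u (L ++ L') w := by
  induction L generalizing u with
  | nil => obtain rfl : u = v := h; exact h'
  | cons s L ih => exact ⟨h.1, ih h.2⟩

theorem IsWalk.split {u v : Fin G.n} {L : List G.Step} (h : IsWalk u L v) {s : G.Step}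
    (hs : s ∈ L) : ∃ L₁ L₂, L = L₁ ++ s :: L₂ ∧ IsWalk u L₁ s.source ∧ IsWalk s.target L₂ v := by
  induction L generalizing u with
  | nil => simp at hs
  | cons s' L ih =>
    rcases List.mem_cons.1 hs with rfl | hs
    · exact ⟨[], L, rfl, h.1.symm, h.2⟩
    · obtain ⟨L₁, L₂, rfl, h1, h2⟩ := ih h.2 hs
      exact ⟨s' :: L₁, L₂, rfl, ⟨h.1, h1⟩, h2⟩

theorem IsWalk.map_source {u v : Fin G.n} {L : List G.Step} (h : IsWalk u L v) :
    v ::ₘ (L : Multiset G.Step).map Step.source = u ::ₘ (L : Multiset G.Step).map Step.target := by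
  induction L generalizing u with
  | nil => obtain rfl : u = v := h; rfl
  | cons s L ih =>
    rw [← Multiset.cons_coe, Multiset.map_cons, Multiset.map_cons, Multiset.cons_swap, ih h.2, h.1]

/-- A multiset of steps with the balance of a walk from `u` to `v` contains such a walk. -/
theorem exists_isWalk_le (N : Multiset G.Step) {u v : Fin G.n}
    (h : v ::ₘ N.map Step.source = u ::ₘ N.map Step.target) :
    ∃ L : List G.Step, IsWalk u L v ∧ (L : Multiset G.Step) ≤ N := by
  induction hn : N.card generalizing N u with
  | zero =>
    obtain rfl := Multiset.card_eq_zero.1 hn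
    have : v = u := by simpa using h
    exact ⟨[], this.symm, le_rfl⟩
  | succ n ih =>
    by_cases huv : u = v
    · exact ⟨[], huv, Multiset.zero_le _⟩
    have hu : u ∈ N.map Step.source := by
      have : u ∈ v ::ₘ N.map Step.source := h ▸ Multiset.mem_cons_self _ _
      exact (Multiset.mem_cons.1 this).resolve_left huv
    obtain ⟨s, hs, rfl⟩ := Multiset.mem_map.1 hu
    obtain ⟨N, rfl⟩ := Multiset.exists_cons_of_mem hs
    rw [Multiset.map_cons, Multiset.map_cons, Multiset.cons_swap, Multiset.cons_inj_right] at h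
    obtain ⟨L, hL, hle⟩ := ih N h (by simpa using hn)
    exact ⟨s :: L, ⟨rfl, hL⟩, by rw [← Multiset.cons_coe]; exact (Multiset.cons_le_cons_iff s).2 hle⟩

/-- Euler's theorem: a balanced connected multiset of steps forms a closed walk.  A closed walk of
maximal length that does not use all the steps could be extended at a vertex that it shares with
the rest. -/
theorem exists_eulerian (N : Multiset G.Step) (hN : N.map Step.source = N.map Step.target)
    (r : Fin G.n) (hconn : ∀ s ∈ N, Conn Step.source Step.target {s | s ∈ N} s.source r) :
    ∃ L : List G.Step, IsWalk r L r ∧ (L : Multiset G.Step) = N := by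
  by_contra! hne
  have key : ∀ n, ∃ L : List G.Step, IsWalk r L r ∧ (L : Multiset G.Step) ≤ N ∧ n ≤ L.length := by
    intro n
    induction n with
    | zero => exact ⟨[], rfl, Multiset.zero_le _, le_rfl⟩
    | succ n ih =>
      obtain ⟨L, hL, hle, hn⟩ := ih
      obtain ⟨N', rfl⟩ := Multiset.le_iff_exists_add.1 hle
      have hbal : N'.map Step.source = N'.map Step.target := by
        have h1 := hL.map_source
        rw [Multiset.cons_inj_right] at h1
        rwa [Multiset.map_add, Multiset.map_add, h1, add_right_inj] at hN
      let Vis : Fin G.n → Prop := fun w => ∃ L₁ L₂, L = L₁ ++ L₂ ∧ IsWalk r L₁ w ∧ IsWalk w L₂ r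
      have hvr : Vis r := ⟨[], L, rfl, rfl, hL⟩
      have hvis : ∀ s ∈ L, Vis s.source ∧ Vis s.target := by
        intro s hs
        obtain ⟨L₁, L₂, rfl, h1, h2⟩ := hL.split hs
        exact ⟨⟨L₁, s :: L₂, rfl, h1, rfl, h2⟩,
          ⟨L₁ ++ [s], L₂, by simp, h1.append ⟨rfl, rfl⟩, h2⟩⟩
      obtain ⟨s, hs, L₁, L₂, rfl, h1, h2⟩ : ∃ s ∈ N', Vis s.source := by
        by_contra! hno
        have hno' : ∀ s ∈ N', ¬ Vis s.target := by
          intro s hs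
          have : s.target ∈ N'.map Step.source := hbal ▸ Multiset.mem_map_of_mem _ hs
          obtain ⟨s', hs', e⟩ := Multiset.mem_map.1 this
          exact e ▸ hno s' hs'
        obtain ⟨s, hs⟩ : ∃ s, s ∈ N' := by
          refine Multiset.exists_mem_of_ne_zero fun h0 => hne L hL ?_
          rw [h0, add_zero]
        have := (hconn s (by simp [hs])).map_eq (φ := Vis) fun s' hs' => by
          rcases Multiset.mem_add.1 hs' with h | h
          · exact propext ⟨fun _ => (hvis s' h).2, fun _ => (hvis s' h).1⟩
          · exact propext ⟨fun h' => absurd h' (hno s' h), fun h' => absurd h' (hno' s' h)⟩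
        exact hno s hs (this ▸ hvr)
      obtain ⟨N', rfl⟩ := Multiset.exists_cons_of_mem hs
      rw [Multiset.map_cons, Multiset.map_cons] at hbal
      obtain ⟨L', hL', hle'⟩ := exists_isWalk_le N' hbal
      refine ⟨L₁ ++ (s :: L') ++ L₂, (h1.append
        (show IsWalk s.source (s :: L') s.source from ⟨rfl, hL'⟩)).append h2, ?_, ?_⟩
      · have : ((L₁ ++ (s :: L') ++ L₂ : List G.Step) : Multiset G.Step) =
            ((L₁ ++ L₂ : List G.Step) : Multiset G.Step) + (s ::ₘ (L' : Multiset G.Step)) := by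
          simp only [← Multiset.coe_add, ← Multiset.cons_coe]
          abel
        rw [this]
        exact add_le_add_right ((Multiset.cons_le_cons_iff s).2 hle') _
      · simp at hn ⊢
        omega
  obtain ⟨L, -, hle, hlen⟩ := key (N.card + 1)
  have := Multiset.card_le_card hle
  rw [Multiset.coe_card] at this
  omega

/-! ### Tours in a homology class -/

theorem tourCost_eq (W : List G.Step) : tourCost W =
    ∑ i, W.count (.along i) * G.cost i + ∑ e, W.count (.back e) * G.cost (.inl e) := by
  induction W with
  | nil => simp [tourCost]
  | cons s W ih =>
    have : tourCost (s :: W) = s.cost + tourCost W := by simp [tourCost]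
    rw [this, ih]
    cases s with
    | along i =>
      simp [List.count_cons, Step.cost, add_mul, sum_add_distrib, ite_mul]
      ring
    | back e =>
      simp [List.count_cons, Step.cost, add_mul, sum_add_distrib, ite_mul]
      ring

/-- The edges and arcs that every tour in the homology class uses. -/
def supp (f : Fin G.m ⊕ Fin G.p → ℤ) : Set (Fin G.m ⊕ Fin G.p) := {i | f i ≠ 0}

/-- A set of edges that connects the support. -/
def Connects (f : Fin G.m ⊕ Fin G.p → ℤ) (r : Fin G.n) (D : Finset (Fin G.m)) : Prop :=
  ∀ i ∈ supp f ∪ Sum.inl '' (D : Set (Fin G.m)),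
    Conn G.tail G.head (supp f ∪ Sum.inl '' (D : Set (Fin G.m))) (G.tail i) r

/-- The cost of the traversals that every tour in the homology class contains. -/
noncomputable def baseCost (f : Fin G.m ⊕ Fin G.p → ℤ) : ℝ := ∑ i, |(f i : ℝ)| * G.cost i

variable {f : Fin G.m ⊕ Fin G.p → ℤ}

theorem toNat_add_toNat_neg (z : ℤ) : (z.toNat : ℝ) + ((-z).toNat : ℝ) = |(z : ℝ)| := by
  have : ((z.toNat : ℤ) + ((-z).toNat : ℤ)) = |z| := by
    rcases le_total 0 z with h | h
    · rw [abs_of_nonneg h]; omega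
    · rw [abs_of_nonpos h]; omega
  exact_mod_cast congrArg (Int.cast : ℤ → ℝ) this

theorem multiset_map_sum {ι α β : Type*} (g : α → β) (F : ι → Multiset α) (A : Finset ι) :
    (∑ i ∈ A, F i).map g = ∑ i ∈ A, (F i).map g :=
  map_sum (Multiset.mapAddMonoidHom g) F A

/-- Traverse every edge and arc of the support as often as necessary, and every edge of `D` once in
both directions. -/
theorem exists_tour (hf : G.IsCirculation f) (h1 : ∀ a, f (.inr a) = 1) {r : Fin G.n}
    {D : Finset (Fin G.m)} (hD : Connects f r D) : ∃ W ∈ homologyClass f,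
      (∀ e, W.count (.along (.inl e)) = (f (.inl e)).toNat + (if e ∈ D then 1 else 0)) ∧
      (∀ e, W.count (.back e) = (-f (.inl e)).toNat + (if e ∈ D then 1 else 0)) ∧
      (∀ a, W.count (.along (.inr a)) = 1) ∧
      tourCost W = baseCost f + 2 * ∑ e ∈ D, G.cost (.inl e) := by
  let x : Fin G.m ⊕ Fin G.p → ℕ := Sum.elim (fun e => if e ∈ D then 1 else 0) fun _ => 0
  let N : Multiset G.Step := ∑ i, ((f i).toNat + x i) • {Step.along i} +
    ∑ e : Fin G.m, ((-f (.inl e)).toNat + x (.inl e)) • {Step.back e}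
  have hca : ∀ i, N.count (.along i) = (f i).toNat + x i := by
    intro i
    simp only [N, Multiset.count_add, Multiset.count_sum', Multiset.count_nsmul,
      Multiset.count_singleton]
    simp
  have hcb : ∀ e, N.count (.back e) = (-f (.inl e)).toNat + x (.inl e) := by
    intro e
    simp only [N, Multiset.count_add, Multiset.count_sum', Multiset.count_nsmul,
      Multiset.count_singleton]
    simp
  have hbal : N.map Step.source = N.map Step.target := by
    ext v
    have hcv := hf v
    simp only [N, Multiset.map_add, multiset_map_sum, Multiset.map_nsmul, Multiset.map_singleton,
      Multiset.count_add, Multiset.count_sum', Multiset.count_nsmul, Multiset.count_singleton,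
      Step.source, Step.target, Fintype.sum_sum_type, h1]
    simp only [sum_filter, Fintype.sum_sum_type, h1] at hcv
    zify
    have hz : ∀ (z : ℤ) (y : ℕ) (b : Prop) [Decidable b],
        (((z.toNat : ℤ) + y) * if b then 1 else 0) =
          (if b then z else 0) + ((((-z).toNat : ℤ) + y) * if b then 1 else 0) := by
      intro z y b _
      split_ifs <;> omega
    have e1 := sum_congr (rfl : (univ : Finset (Fin G.m)) = univ) fun e _ =>
      hz (f (.inl e)) (x (.inl e)) (v = G.tail (.inl e))
    have e2 := sum_congr (rfl : (univ : Finset (Fin G.m)) = univ) fun e _ =>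
      hz (f (.inl e)) (x (.inl e)) (v = G.head (.inl e))
    rw [sum_add_distrib] at e1 e2
    simp only [eq_comm (b := v)] at hcv
    simp only [x, Sum.elim_inr, Sum.elim_inl] at e1 e2 ⊢
    push_cast at e1 e2 ⊢
    rw [e1, e2]
    simp at hcv ⊢
    linarith
  have hmem : ∀ i, (Step.along i ∈ N ∨ ∃ e, i = .inl e ∧ Step.back e ∈ N) ↔
      i ∈ supp f ∪ Sum.inl '' (D : Set (Fin G.m)) := by
    rintro (e | a)
    · simp only [← Multiset.count_pos, hca, hcb, Sum.inl.injEq, exists_eq_left', supp, x,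
        Set.mem_union, Set.mem_ofPred_eq, Set.mem_image, mem_coe, exists_eq_right, Sum.elim_inl]
      by_cases h : e ∈ D <;> simp [h]
      omega
    · simp [← Multiset.count_pos, hca, hcb, supp, h1]
  have hedge : ∀ i ∈ supp f ∪ Sum.inl '' (D : Set (Fin G.m)),
      Conn Step.source Step.target {s | s ∈ N} (G.tail i) (G.head i) := by
    intro i hi
    rcases (hmem i).2 hi with h | ⟨e, rfl, h⟩
    · exact .edge (i := Step.along i) (s := Step.source) (t := Step.target) h
    · exact (Conn.edge (i := Step.back e) (s := Step.source) (t := Step.target) h).symm'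
  have hconn : ∀ s ∈ N, Conn Step.source Step.target {s | s ∈ N} s.source r := by
    intro s hs
    cases s with
    | along i =>
      have hi := (hmem i).1 (.inl hs)
      exact (hD i hi).map (φ := id) hedge
    | back e =>
      have hi := (hmem (.inl e)).1 (.inr ⟨e, rfl, hs⟩)
      exact (hedge _ hi).symm'.trans' ((hD _ hi).map (φ := id) hedge)
  obtain ⟨W, hW, hWN⟩ := exists_eulerian N hbal r hconn
  rw [← hWN] at hca hcb
  simp only [Multiset.coe_count] at hca hcb
  refine ⟨W, ⟨⟨r, hW⟩, fun e => ?_, fun a => ?_⟩, fun e => hca _, fun e => hcb e, fun a => ?_, ?_⟩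
  · rw [hca, hcb]; push_cast; omega
  · rw [hca, h1]; simp [x]
  · rw [hca, h1]; simp [x]
  · rw [tourCost_eq, baseCost]
    simp only [hca, hcb, Fintype.sum_sum_type, h1, ← toNat_add_toNat_neg, x]
    have : ∑ e ∈ D, G.cost (.inl e) = ∑ e, (if e ∈ D then 1 else 0) * G.cost (.inl e) := by
      simp
    rw [this]
    simp only [Sum.elim_inl, Sum.elim_inr]
    push_cast
    simp only [add_mul, sum_add_distrib]
    simp
    ring

theorem IsWalk.conn {u v : Fin G.n} {W : List G.Step} (h : IsWalk u W v) {s : G.Step}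
    (hs : s ∈ W) {A : Set (Fin G.m ⊕ Fin G.p)} (ha : ∀ i, Step.along i ∈ W → i ∈ A)
    (hb : ∀ e, Step.back e ∈ W → .inl e ∈ A) : Conn G.tail G.head A s.source u := by
  induction W generalizing u with
  | nil => simp at hs
  | cons s' W ih =>
    have hstep : Conn G.tail G.head A s'.source s'.target := by
      cases s' with
      | along i => exact .edge (ha i (by simp))
      | back e => exact (Conn.edge (i := Sum.inl e) (hb e (by simp))).symm'
    rcases List.mem_cons.1 hs with rfl | hs
    · rw [h.1]; exact .refl' _
    · have := ih h.2 hs (fun i hi => ha i (by simp [hi])) fun e he => hb e (by simp [he])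
      rw [← h.1]
      exact this.trans' hstep.symm'

/-- Every tour in the homology class traverses the edges of a set that connects the support. -/
theorem exists_connects (h1 : ∀ a, f (.inr a) = 1) {r : Fin G.n}
    (hr : (∃ i ∈ supp f, G.tail i = r) ∨ supp f = ∅) {W : List G.Step} (hW : W ∈ homologyClass f) :
    ∃ D : Finset (Fin G.m), Connects f r D ∧ (∀ e ∈ D, f (.inl e) = 0) ∧
      baseCost f + 2 * ∑ e ∈ D, G.cost (.inl e) ≤ tourCost W := by
  classical
  obtain ⟨⟨v, hwalk⟩, hedge, harc⟩ := hW
  set D₀ : Finset (Fin G.m) := {e | f (.inl e) = 0 ∧ Step.back e ∈ W} with hD₀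
  have hle : baseCost f + 2 * ∑ e ∈ D₀, G.cost (.inl e) ≤ tourCost W := by
    have hD : ∑ e ∈ D₀, G.cost (.inl e) = ∑ e, if e ∈ D₀ then G.cost (.inl e) else 0 := by simp
    rw [tourCost_eq, baseCost, Fintype.sum_sum_type, Fintype.sum_sum_type, hD, mul_sum]
    have ha : ∑ a, |(f (.inr a) : ℝ)| * G.cost (.inr a) =
        ∑ a, (W.count (.along (.inr a)) : ℝ) * G.cost (.inr a) := by
      refine sum_congr rfl fun a _ => ?_
      have := harc a
      rw [h1] at this
      rw [h1, show W.count (.along (.inr a)) = 1 by exact_mod_cast this]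
      simp
    have hb : ∑ e, |(f (.inl e) : ℝ)| * G.cost (.inl e) +
        ∑ e, 2 * (if e ∈ D₀ then G.cost (.inl e) else 0) ≤
        ∑ e, (W.count (.along (.inl e)) : ℝ) * G.cost (.inl e) +
          ∑ e, (W.count (.back e) : ℝ) * G.cost (.inl e) := by
      rw [← sum_add_distrib, ← sum_add_distrib]
      refine sum_le_sum fun e _ => ?_
      have hc := G.cost_pos (.inl e)
      have he : (W.count (.along (.inl e)) : ℝ) - W.count (.back e) = f (.inl e) := by
        exact_mod_cast hedge e
      by_cases hmem : e ∈ D₀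
      · have h2 := (mem_filter.1 hmem).2
        have h3 : (1 : ℝ) ≤ W.count (.back e) := by
          exact_mod_cast List.count_pos_iff.2 h2.2
        rw [if_pos hmem]
        rw [h2.1] at he ⊢
        simp at he ⊢
        nlinarith
      · rw [if_neg hmem, ← add_mul, mul_zero, add_zero]
        refine mul_le_mul_of_nonneg_right ?_ hc.le
        rw [← he]
        refine (abs_sub _ _).trans ?_
        simp
    linarith
  rcases hr with ⟨i₀, hi₀, rfl⟩ | hempty
  · refine ⟨D₀, ?_, fun e he => (mem_filter.1 he).2.1, hle⟩
    have hmem : ∀ i ∈ supp f ∪ Sum.inl '' (D₀ : Set (Fin G.m)),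
        Step.along i ∈ W ∨ ∃ e, i = .inl e ∧ Step.back e ∈ W := by
      rintro i (hi | ⟨e, he, rfl⟩)
      · rcases i with e | a
        · by_contra! hno
          have h2 := hedge e
          rw [List.count_eq_zero_of_not_mem hno.1, List.count_eq_zero_of_not_mem (hno.2 e rfl)] at h2
          exact hi (by simpa using h2.symm)
        · left
          have h2 := harc a
          rw [h1] at h2
          exact List.count_pos_iff.1 (by omega)
      · exact .inr ⟨e, rfl, (mem_filter.1 he).2.2⟩
    have hback : ∀ e, Step.back e ∈ W → .inl e ∈ supp f ∪ Sum.inl '' (D₀ : Set (Fin G.m)) := by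
      intro e he
      by_cases h0 : f (.inl e) = 0
      · exact .inr ⟨e, by simpa [hD₀] using ⟨h0, he⟩, rfl⟩
      · exact .inl h0
    have halong : ∀ i, Step.along i ∈ W → i ∈ supp f ∪ Sum.inl '' (D₀ : Set (Fin G.m)) := by
      rintro (e | a) he
      · by_cases h0 : f (.inl e) = 0
        · refine .inr ⟨e, ?_, rfl⟩
          have h2 := hedge e
          have h3 := List.count_pos_iff.2 he
          rw [h0] at h2
          simpa [hD₀, h0] using List.count_pos_iff.1 (by omega : 0 < W.count (.back e))
        · exact .inl h0
      · exact .inl (by simp [supp, h1])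
    have hv : ∀ i ∈ supp f ∪ Sum.inl '' (D₀ : Set (Fin G.m)),
        Conn G.tail G.head (supp f ∪ Sum.inl '' (D₀ : Set (Fin G.m))) (G.tail i) v := by
      intro i hi
      rcases hmem i hi with h | ⟨e, rfl, h⟩
      · exact hwalk.conn h halong hback
      · exact (Conn.edge hi).trans' (hwalk.conn h halong hback)
    exact fun i hi => (hv i hi).trans' (hv i₀ (.inl hi₀)).symm'
  · refine ⟨∅, fun i hi => ?_, by simp, ?_⟩
    · simp [hempty] at hi
    · have : 0 ≤ ∑ e ∈ D₀, G.cost (.inl e) := sum_nonneg fun e _ => (G.cost_pos _).le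
      simp only [sum_empty]
      linarith

end MixedGraph

section

open scoped Classical

/-! ### Spanning trees of the contracted graph -/

theorem WeightedGraph.spans_iff {H : WeightedGraph} {T : Finset (Fin H.m)} :
    H.Spans T ↔ ∀ u v, Conn (fun e => (H.ends e).1) (fun e => (H.ends e).2) (T : Set (Fin H.m)) u v := by
  simp only [WeightedGraph.Spans, Conn, Prod.ext_iff, mem_coe]

theorem WeightedGraph.Spans.exists_tree {H : WeightedGraph} {T : Finset (Fin H.m)} (hT : H.Spans T)
    (hn : 0 < H.n) : ∃ T' ⊆ T, H.IsSpanningTree T' := by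
  rw [spans_iff] at hT
  obtain ⟨T', hsub, h1, h2⟩ := exists_greedy (s := fun e => (H.ends e).1)
    (t := fun e => (H.ends e).2) ∅ T
  simp only [Set.empty_union] at h1 h2
  have hT' : ∀ u v, Conn (fun e => (H.ends e).1) (fun e => (H.ends e).2)
      (T' : Set (Fin H.m)) u v := fun u v => h1 u v (hT u v)
  rw [numComp_empty, Nat.card_eq_fintype_card, Fintype.card_fin] at h2
  have h3 := numComp_le_card (K := {⟨0, hn⟩}) fun x => ⟨⟨0, hn⟩, by simp, hT' x ⟨0, hn⟩⟩
  have h4 := add_one_le_numComp (s := fun e => (H.ends e).1) (t := fun e => (H.ends e).2)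
    (A := (T' : Set (Fin H.m))) (J := ∅) (r := ⟨0, hn⟩) (by simp) (by simp)
  have h5 := numComp_union (s := fun e => (H.ends e).1) (t := fun e => (H.ends e).2) (A := ∅) T'
  rw [numComp_empty, Nat.card_eq_fintype_card, Fintype.card_fin, Set.empty_union] at h5
  simp only [card_singleton, card_empty] at h3 h4
  exact ⟨T', hsub, spans_iff.2 hT', by omega⟩

namespace Steiner

variable {V R : Type} {m N : ℕ} {S : Steiner V (Fin m) R} {rep : Fin m → Fin m} {lab : V → Fin N}

/-- The map `lab` numbers the components of the contracted edges. -/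
structure IsContraction (S : Steiner V (Fin m) R) (rep : Fin m → Fin m) (lab : V → Fin N) :
    Prop where
  eq_iff : ∀ x y, S.Cov x → S.Cov y → (lab x = lab y ↔ Conn S.s S.t (contracted S rep) x y)
  surj : ∀ c, ∃ x, S.Cov x ∧ lab x = c

theorem weight_pos {X : Finset V} {b : ℝ} (e : Fin m) (hb : 0 < b) : 0 < weight S rep X b e := by
  unfold weight
  split_ifs with h
  · exact hb
  · exact sum_pos (fun e _ => S.c_pos e) ⟨e, by simpa using h⟩
  · exact S.c_pos e

/-- The contracted graph; no edge is lost, as loops are allowed. -/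
noncomputable def graph (S : Steiner V (Fin m) R) (rep : Fin m → Fin m) (lab : V → Fin N)
    (X : Finset V) (b : ℝ) (hb : Fin m → 0 < b) : WeightedGraph where
  n := N
  m := m
  ends e := (lab (S.s (.inl e)), lab (S.t (.inl e)))
  weight := weight S rep X b
  weight_pos e := weight_pos e (hb e)

variable {X : Finset V} {b : ℝ} {hb : Fin m → 0 < b}

theorem IsContraction.spans_iff (hlab : IsContraction S rep lab) {T : Finset (Fin m)} :
    (S.graph rep lab X b hb).Spans T ↔ SpansContracted S rep T := by
  refine WeightedGraph.spans_iff.trans ?_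
  constructor
  · intro h v hv
    choose g hg1 hg2 using hlab.surj
    have hback : ∀ x, S.Cov x →
        Conn S.s S.t (contracted S rep ∪ Sum.inl '' (T : Set (Fin m))) x (g (lab x)) := fun x hx =>
      ((hlab.eq_iff x _ hx (hg1 _)).1 (hg2 _).symm).mono Set.subset_union_left
    have := (h (lab v) (lab S.r₀)).map (φ := g) (s' := S.s) (t' := S.t)
      (B := contracted S rep ∪ Sum.inl '' (T : Set (Fin m))) fun e he => by
        refine (hback _ (S.conn (.inl e))).symm'.trans' (.trans' (.edge ?_) (hback _ (cov_t (.inl e))))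
        exact .inr ⟨e, he, rfl⟩
    exact (hback v hv).trans' (this.trans' (hback _ cov_r₀).symm')
  · intro h u v
    obtain ⟨x, hx, rfl⟩ := hlab.surj u
    obtain ⟨y, hy, rfl⟩ := hlab.surj v
    refine ((h x hx).trans' (h y hy).symm').map (φ := lab) fun i hi => ?_
    rcases hi with hi | ⟨e, he, rfl⟩
    · rw [(hlab.eq_iff _ _ (S.conn i) (cov_t i)).2 (.edge hi)]
      exact .refl' _
    · exact Conn.edge (s := fun e => ((S.graph rep lab X b hb).ends e).1)
        (t := fun e => ((S.graph rep lab X b hb).ends e).2) he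

theorem IsContraction.connected (hlab : IsContraction S rep lab) :
    (S.graph rep lab X b hb).Connected := by
  refine ⟨(lab S.r₀).pos, hlab.spans_iff.2 fun v hv => hv.mono ?_⟩
  rintro (e | a) -
  · exact .inr ⟨e, mem_univ e, rfl⟩
  · exact .inl (.inl (S.mem_Q a))

variable (S) in
theorem exists_optimal : ∃ D, S.Optimal D := by
  have huniv : S.Feasible univ := by
    intro i _
    refine (S.conn i).mono ?_
    rintro (e | a) -
    · exact .inr ⟨e, by simp, rfl⟩
    · exact .inl (S.mem_Q a)
  obtain ⟨D, hD, hmin⟩ := exists_min_image ({D | S.Feasible D} : Finset (Finset (Fin m)))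
    (fun D => ∑ e ∈ D, S.c e) ⟨univ, by simpa using huniv⟩
  exact ⟨D, by simpa using hD, fun D' hD' => hmin D' (by simpa using hD')⟩

theorem exists_inc_of_cov {v : V} (hv : S.Cov v) (ht : ¬ S.Touched v) : ∃ e, S.Inc v e := by
  rcases hv.symm'.eq_or_mem with h | ⟨i | a, -, h⟩
  · exact absurd (.inl h.symm) ht
  · exact ⟨i, h⟩
  · exact absurd (.inr ⟨_, S.mem_Q a, h⟩) ht

/-- Branch vertices of degree at least three may be excluded or not; the other vertices of degree
different from two are leaves, which are always excluded.  Among all minimum spanning trees for the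
different choices `y` of the set `X y` of excluded vertices, the best yields an optimal purchase. -/
theorem optimal_of_best [Fintype V] (hrep : S.IsRep rep) (hlab : IsContraction S rep lab) {ι : Type}
    {X : ι → Finset V} {z : ι → ℕ} {l : ℕ} (hcard : ∀ y, #(X y) = l + z y)
    (hX : ∀ y, ∀ v ∈ X y, (∃ e, S.Inc v e) ∧ ¬ S.Touched v ∧ S.deg v ≠ 2)
    (hall : ∀ D : Finset (Fin m), ∃ y, ∀ v, v ∈ X y ↔ (∃ e, S.Inc v e) ∧ ¬ S.Touched v ∧
      S.deg v ≠ 2 ∧ (3 ≤ S.deg v → ∀ e ∈ D, ¬ S.Inc v e))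
    (hbc : b = ∑ e, (S.c e + S.c e)) {y₀ : ι} {T₀ : Finset (Fin m)}
    (hT₀ : (S.graph rep lab (X y₀) b hb).Spans T₀)
    (hbest : ∀ y, ∃ T, (S.graph rep lab (X y) b hb).IsMST T ∧
      ∑ e ∈ T₀, weight S rep (X y₀) b e - z y₀ * b ≤ ∑ e ∈ T, weight S rep (X y) b e - z y * b) :
    S.Optimal (purchase S rep (X y₀) T₀) := by
  have hb0 : 0 ≤ b := by
    rw [hbc]
    exact sum_nonneg fun e _ => add_nonneg (S.c_pos e).le (S.c_pos e).le
  obtain ⟨D, hD⟩ := S.exists_optimal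
  obtain ⟨y, hy⟩ := hall D
  obtain ⟨T', hT', hle'⟩ := hD.exists_spans hrep (X := X y) (b := b) (by
    intro v
    rw [hy]
    constructor
    · rintro ⟨⟨e, he⟩, h2, h3, h4⟩
      refine ⟨he.cov, h2, h3, fun f hf hinc => ?_⟩
      -- an optimal tree has two edges at `v`, so `v` is a branch vertex
      obtain ⟨f', -, hne, hinc'⟩ := hD.exists_ne h2 hf hinc
      have : 1 < S.deg v := one_lt_card.2 ⟨f, by simpa using hinc, f', by simpa using hinc', hne.symm⟩
      exact h4 (by omega) f hf hinc
    · rintro ⟨h1, h2, h3, h4⟩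
      exact ⟨exists_inc_of_cov h1 h2, h2, h3, fun _ => h4⟩) hb0
  obtain ⟨T'', hsub, htree⟩ := ((hlab.spans_iff (X := X y) (b := b) (hb := hb)).2 hT').exists_tree
    (lab S.r₀).pos
  obtain ⟨T, hT, hle⟩ := hbest y
  have hw : ∑ e ∈ T, weight S rep (X y) b e ≤ ∑ e ∈ T', weight S rep (X y) b e :=
    (hT.2 T'' htree).trans (sum_le_sum_of_subset_of_nonneg hsub fun e _ _ => weight_nonneg hb0 e)
  have hX' : ∀ x ∈ X y₀, S.Cov x ∧ ¬ S.Touched x ∧ ¬ S.Thin x := by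
    intro x hx
    obtain ⟨⟨e, he⟩, h2, h3⟩ := hX y₀ x hx
    exact ⟨he.cov, h2, fun h => h3 h.2⟩
  obtain ⟨h1, h2⟩ := feasible_purchase hrep hX' (hlab.spans_iff.1 hT₀)
  have h3 := cost_purchase_le (S := S) (X := X y₀) (T := T₀) hrep hb0
  have hcy : (#(X y) : ℝ) = l + z y := by exact_mod_cast hcard y
  have hcy₀ : (#(X y₀) : ℝ) = l + z y₀ := by exact_mod_cast hcard y₀
  have hcost : ∑ e ∈ purchase S rep (X y₀) T₀, S.c e + #(deadReps S rep (X y₀) T₀) * b ≤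
      ∑ e ∈ D, S.c e + #(X y₀) * b := by
    rw [hcy] at hle'
    rw [hcy₀]
    linarith
  have hfeas : S.Feasible (purchase S rep (X y₀) T₀) := by
    refine h2 ?_
    by_contra! hlt
    have h4 : (#(X y₀) : ℝ) + 1 ≤ #(deadReps S rep (X y₀) T₀) := by exact_mod_cast hlt
    have h5 : ∑ e ∈ D, S.c e < b := by
      obtain ⟨e, -⟩ := card_pos.1 (by omega : 0 < #(deadReps S rep (X y₀) T₀))
      have h6 : ∑ e ∈ D, S.c e ≤ ∑ e, S.c e :=
        sum_le_sum_of_subset_of_nonneg (subset_univ D) fun e _ _ => (S.c_pos e).le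
      have h7 : 0 < ∑ e, S.c e := sum_pos (fun e _ => S.c_pos e) ⟨e, mem_univ e⟩
      rw [hbc, sum_add_distrib]
      linarith
    have h6 : 0 ≤ ∑ e ∈ purchase S rep (X y₀) T₀, S.c e := sum_nonneg fun e _ => (S.c_pos e).le
    nlinarith
  refine ⟨hfeas, fun D' hD' => ?_⟩
  have h4 : (#(X y₀) : ℝ) ≤ #(deadReps S rep (X y₀) T₀) := by exact_mod_cast h1
  have h5 := hD.2 D' hD'
  nlinarith

end Steiner

end

section

open scoped Classical

/-! ### Steiner trees in the memory -/

/-- The scalar variable `a`. -/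
abbrev reg (a : ℕ) : IExpr := .get a (.const 0)

/-- The cell of the array `a` whose index is the loop variable `31[0]`. -/
abbrev elt (a : ℕ) : IExpr := .get a (reg 31)

theorem eqvGen_of_map {α β : Type*} {φ : α → β} (hφ : Function.Injective φ) {r : α → α → Prop}
    {r' : β → β → Prop} (h : ∀ x y, r' x y → ∃ a b, φ a = x ∧ φ b = y ∧ Relation.EqvGen r a b)
    {a b : α} (hab : Relation.EqvGen r' (φ a) (φ b)) : Relation.EqvGen r a b := by
  have key : ∀ x y, Relation.EqvGen r' x y →
      x = y ∨ ∃ a b, φ a = x ∧ φ b = y ∧ Relation.EqvGen r a b := by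
    intro x y hxy
    induction hxy with
    | rel x y hr => exact .inr (h x y hr)
    | refl x => exact .inl rfl
    | symm x y _ ih =>
      rcases ih with rfl | ⟨a, b, h1, h2, h3⟩
      · exact .inl rfl
      · exact .inr ⟨b, a, h2, h1, h3.symm⟩
    | trans x y z _ _ ih1 ih2 =>
      rcases ih1 with rfl | ⟨a, b, rfl, rfl, h1⟩
      · exact ih2
      · rcases ih2 with rfl | ⟨b', c, h2, rfl, h3⟩
        · exact .inr ⟨a, b, rfl, rfl, h1⟩
        · obtain rfl := hφ h2
          exact .inr ⟨a, c, rfl, rfl, h1.trans _ _ _ h3⟩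
  rcases key _ _ hab with h | ⟨a', b', h1, h2, h3⟩
  · rw [hφ h]; exact .refl _
  · rw [← hφ h1, ← hφ h2]; exact h3

theorem eqvGen_map {α β : Type*} {φ : α → β} {r : α → α → Prop} {r' : β → β → Prop}
    (h : ∀ a b, r a b → Relation.EqvGen r' (φ a) (φ b)) {a b : α} (hab : Relation.EqvGen r a b) :
    Relation.EqvGen r' (φ a) (φ b) := by
  induction hab with
  | rel x y hr => exact h x y hr
  | refl x => exact .refl _
  | symm x y _ ih => exact ih.symm
  | trans x y z _ _ ih1 ih2 => exact ih1.trans _ _ _ ih2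

variable {n m p : ℕ}

/-- The arrays `U` and `V` list the ends of the edges, then those of the arcs, and then the vertex `r`
as both ends of a further loop. -/
structure HoldsSlots (U V : ℤ → ℤ) (s t : Fin m ⊕ Fin p → Fin n) (r : Fin n) : Prop where
  edge : ∀ e : Fin m, U (e : ℕ) = (s (.inl e) : ℕ) ∧ V (e : ℕ) = (t (.inl e) : ℕ)
  arc : ∀ a : Fin p, U (m + a : ℕ) = (s (.inr a) : ℕ) ∧ V (m + a : ℕ) = (t (.inr a) : ℕ)
  root : U (m + p : ℕ) = (r : ℕ) ∧ V (m + p : ℕ) = (r : ℕ)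

theorem slot_cases {j : ℕ} (hj : j < m + p + 1) :
    (∃ e : Fin m, j = e) ∨ (∃ a : Fin p, j = m + a) ∨ j = m + p := by
  by_cases h1 : j < m
  · exact .inl ⟨⟨j, h1⟩, rfl⟩
  · by_cases h2 : j < m + p
    · exact .inr (.inl ⟨⟨j - m, by omega⟩, by simp; omega⟩)
    · exact .inr (.inr (by omega))

theorem natCast_fin_injective (n : ℕ) : Function.Injective fun x : Fin n => ((x : ℕ) : ℤ) :=
  fun x y h => Fin.ext (by have h' : ((x : ℕ) : ℤ) = (y : ℕ) := h; exact_mod_cast h')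

variable {U V A lab : ℤ → ℤ} {s t : Fin m ⊕ Fin p → Fin n} {r : Fin n} {cnt : ℕ}
  {B : Set (Fin m ⊕ Fin p)}

theorem HoldsSlots.isEnd_iff (hs : HoldsSlots U V s t r) {z : ℤ} : IsEnd (m + p + 1) U V z ↔
    ∃ x : Fin n, z = (x : ℕ) ∧ (x = r ∨ ∃ i, s i = x ∨ t i = x) := by
  constructor
  · rintro ⟨j, hj, h⟩
    rcases slot_cases hj with ⟨e, rfl⟩ | ⟨a, rfl⟩ | rfl
    · rw [(hs.edge e).1, (hs.edge e).2] at h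
      rcases h with h | h
      · exact ⟨_, h, .inr ⟨_, .inl rfl⟩⟩
      · exact ⟨_, h, .inr ⟨_, .inr rfl⟩⟩
    · rw [(hs.arc a).1, (hs.arc a).2] at h
      rcases h with h | h
      · exact ⟨_, h, .inr ⟨_, .inl rfl⟩⟩
      · exact ⟨_, h, .inr ⟨_, .inr rfl⟩⟩
    · rw [hs.root.1, hs.root.2, or_self] at h
      exact ⟨_, h, .inl rfl⟩
  · rintro ⟨x, rfl, rfl | ⟨e | a, h⟩⟩
    · exact ⟨m + p, by omega, .inl hs.root.1.symm⟩
    · refine ⟨e, by omega, ?_⟩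
      rw [(hs.edge e).1, (hs.edge e).2]
      rcases h with rfl | rfl
      · exact .inl rfl
      · exact .inr rfl
    · refine ⟨m + a, by omega, ?_⟩
      rw [(hs.arc a).1, (hs.arc a).2]
      rcases h with rfl | rfl
      · exact .inl rfl
      · exact .inr rfl

theorem HoldsSlots.joined_iff (hs : HoldsSlots U V s t r)
    (he : ∀ e : Fin m, 1 ≤ A (e : ℕ) ↔ .inl e ∈ B) (ha : ∀ a : Fin p, 1 ≤ A (m + a : ℕ) ↔ .inr a ∈ B)
    {x y : Fin n} : Joined (m + p + 1) U V A (x : ℕ) (y : ℕ) ↔ Conn s t B x y := by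
  constructor
  · refine eqvGen_of_map (φ := fun x : Fin n => ((x : ℕ) : ℤ)) (natCast_fin_injective n) ?_
    rintro x y ⟨j, hj, hA, rfl, rfl⟩
    rcases slot_cases hj with ⟨e, rfl⟩ | ⟨a, rfl⟩ | rfl
    · exact ⟨_, _, (hs.edge e).1.symm, (hs.edge e).2.symm, .rel _ _ ⟨_, (he e).1 hA, rfl, rfl⟩⟩
    · exact ⟨_, _, (hs.arc a).1.symm, (hs.arc a).2.symm, .rel _ _ ⟨_, (ha a).1 hA, rfl, rfl⟩⟩
    · exact ⟨_, _, hs.root.1.symm, hs.root.2.symm, .refl _⟩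
  · refine eqvGen_map (φ := fun x : Fin n => ((x : ℕ) : ℤ)) ?_
    rintro x y ⟨e | a, hB, rfl, rfl⟩
    · exact .rel _ _ ⟨e, by omega, (he e).2 hB, (hs.edge e).1, (hs.edge e).2⟩
    · exact .rel _ _ ⟨m + a, by omega, (ha a).2 hB, (hs.arc a).1, (hs.arc a).2⟩

/-- Let the component computation run on the listed edges, with flags `x`. -/
def loadSlots (x : IExpr) : Prog := block [
  .setInt 13 (.const 0) (reg 37),
  forLoop 31 37 0 (block [
    .setInt 10 (reg 31) (elt 34),
    .setInt 11 (reg 31) (elt 35),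
    .setInt 12 (reg 31) x])]

theorem runs_loadSlots {σ : State} {q : ℕ} (hq : σ.int 37 0 = q) {x : IExpr} {φ : ℕ → ℤ}
    (hx : ∀ τ : State, ∀ j < q, τ.int 31 0 = j →
      SameOff [10, 11, 12, 13, 31] [] σ τ → x.eval τ = φ j) :
    Runs (loadSlots x) σ fun t σ' => t ≤ 6 * q + 4 ∧ SameOff (loadSlots x).ints [] σ σ' ∧
      σ'.int 13 0 = q ∧ ∀ j < q, σ'.int 10 j = σ.int 34 j ∧ σ'.int 11 j = σ.int 35 j ∧
        σ'.int 12 j = φ j := by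
  suffices hS : Runs (loadSlots x) σ fun t σ' => t ≤ 6 * q + 4 ∧
      σ'.int 13 0 = q ∧ ∀ j < q, σ'.int 10 j = σ.int 34 j ∧ σ'.int 11 j = σ.int 35 j ∧
        σ'.int 12 j = φ j from
    hS.sameOff.mono fun t σ' h => ⟨h.1.1, h.2, h.1.2⟩
  rw [loadSlots, runs_block_cons, runs_setInt, runs_block_cons]
  refine (runs_forLoop q 4 (fun i τ => ∀ j < i, τ.int 10 j = σ.int 34 j ∧
    τ.int 11 j = σ.int 35 j ∧ τ.int 12 j = φ j) (by simpa using hq) (by simp [block, Prog.ints])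
    (by simp [block, Prog.ints]) (by simp) ?_).mono ?_
  · intro i hi τ hs hiv hI
    have e34 := hs.1 34 (by simp [block, Prog.ints])
    have e35 := hs.1 35 (by simp [block, Prog.ints])
    simp only [putInt_int, IExpr.eval, Nat.reduceEqDiff, if_false] at e34 e35
    simp only [runs_block_cons, runs_block_nil, runs_setInt]
    rw [hx _ i hi (by simp [hiv]) (by
      refine ⟨fun a ha => ?_, fun a ha => by simpa [block, Prog.reals] using hs.2 a⟩
      have := hs.1 a
      simp only [List.mem_cons, List.not_mem_nil, or_false, not_or] at ha
      simpa [block, Prog.ints, ha] using this)]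
    simp only [IExpr.eval, putInt_int, hiv, e34, e35, Nat.reduceEqDiff, if_true, if_false]
    refine ⟨by norm_num, fun j hj => ?_⟩
    rcases Nat.lt_succ_iff_lt_or_eq.1 hj with h | rfl
    · simpa [Function.update_apply, h.ne] using hI j h
    · simp
  · rintro t σ' ⟨ht, hs, hI⟩
    simp only [runs_block_nil]
    refine ⟨by omega, ?_, hI⟩
    rw [hs.1 13 (by simp [block, Prog.ints])]
    simpa using hq

theorem HoldsSlots.of_eq (hs : HoldsSlots U V s t r) {U' V' : ℤ → ℤ}
    (h : ∀ j : ℕ, j < m + p + 1 → U' j = U j ∧ V' j = V j) : HoldsSlots U' V' s t r where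
  edge e := by rw [(h e (by omega)).1, (h e (by omega)).2]; exact hs.edge e
  arc a := by rw [(h (m + a) (by omega)).1, (h (m + a) (by omega)).2]; exact hs.arc a
  root := by rw [(h (m + p) (by omega)).1, (h (m + p) (by omega)).2]; exact hs.root

/-- Compute the connected components of the listed graph, with flags `x`. -/
def labelSlots (x : IExpr) : Prog := .seq (loadSlots x) labelComponents

theorem runs_labelSlots {σ : State} (hq : σ.int 37 0 = (m + p + 1 : ℕ))
    (hs : HoldsSlots (σ.int 34) (σ.int 35) s t r) {x : IExpr} {φ : ℕ → ℤ}
    (hx : ∀ τ : State, ∀ j < m + p + 1, τ.int 31 0 = j →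
      SameOff [10, 11, 12, 13, 31] [] σ τ → x.eval τ = φ j)
    (he : ∀ e : Fin m, 1 ≤ φ e ↔ .inl e ∈ B) (ha : ∀ a : Fin p, 1 ≤ φ (m + a) ↔ .inr a ∈ B) :
    Runs (labelSlots x) σ fun t' σ' => t' ≤ 210 * (m + p + 1) + 30 ∧
      SameOff (labelSlots x).ints [] σ σ' ∧ ∃ cnt : ℕ, σ'.int 18 0 = cnt ∧
      (∀ x : Fin n, (x = r ∨ ∃ i, s i = x ∨ t i = x) →
        0 ≤ σ'.int 14 (x : ℕ) ∧ σ'.int 14 (x : ℕ) < cnt) ∧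
      (∀ x y : Fin n, (x = r ∨ ∃ i, s i = x ∨ t i = x) → (y = r ∨ ∃ i, s i = y ∨ t i = y) →
        (σ'.int 14 (x : ℕ) = σ'.int 14 (y : ℕ) ↔ Conn s t B x y)) ∧
      ∀ c < cnt, ∃ x : Fin n, (x = r ∨ ∃ i, s i = x ∨ t i = x) ∧ σ'.int 14 (x : ℕ) = c := by
  rw [labelSlots, runs_seq]
  refine (runs_loadSlots hq hx).mono ?_
  rintro t1 σ1 ⟨ht1, hs1, h13, h1⟩
  refine (runs_labelComponents h13).mono ?_
  rintro t2 σ2 ⟨ht2, hs2, cnt, hcnt, hlab⟩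
  have hs' : HoldsSlots (σ1.int 10) (σ1.int 11) s t r :=
    hs.of_eq fun j hj => ⟨(h1 j hj).1, (h1 j hj).2.1⟩
  refine ⟨by omega, (hs1.mono (by simp [Prog.ints]) (by simp)).trans
    (hs2.mono (by simp [Prog.ints]) (by decide)), cnt, hcnt, fun x hx => ?_, fun x y hx hy => ?_,
    fun c hc => ?_⟩
  · exact ⟨hlab.nonneg _ (hs'.isEnd_iff.2 ⟨x, rfl, hx⟩), hlab.lt _ (hs'.isEnd_iff.2 ⟨x, rfl, hx⟩)⟩
  · rw [hlab.eq_iff _ _ (hs'.isEnd_iff.2 ⟨x, rfl, hx⟩) (hs'.isEnd_iff.2 ⟨y, rfl, hy⟩)]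
    refine hs'.joined_iff (fun e => ?_) fun a => ?_
    · rw [(h1 e (by omega)).2.2, he]
    · rw [(h1 (m + a) (by omega)).2.2, ha]
  · obtain ⟨z, hz, hc'⟩ := hlab.surj c hc
    obtain ⟨x, rfl, hx⟩ := hs'.isEnd_iff.1 hz
    exact ⟨x, hx, hc'⟩

/-- The memory holds a Steiner tree problem: the ends of its edges and arcs in the arrays 34 and 35,
flags for the terminals in array 36, and the costs in the real array 0. -/
structure Inst (S : Steiner (Fin n) (Fin m) (Fin p)) (σ : State) : Prop where
  num : σ.int 0 1 = m
  len : σ.int 37 0 = (m + p + 1 : ℕ)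
  slots : HoldsSlots (σ.int 34) (σ.int 35) S.s S.t S.r₀
  flag : ∀ e : Fin m, 1 ≤ σ.int 36 (e : ℕ) ↔ .inl e ∈ S.Q
  flag_arc : ∀ a : Fin p, 1 ≤ σ.int 36 (m + a : ℕ)
  flag_root : 1 ≤ σ.int 36 (m + p : ℕ)
  cost : ∀ e : Fin m, σ.real 0 (e : ℕ) = S.c e

variable {S : Steiner (Fin n) (Fin m) (Fin p)} {σ σ' : State}

theorem Inst.frame (h : Inst S σ) {li lr : List ℕ} (hs : SameOff li lr σ σ')
    (hi : ∀ a ∈ [0, 34, 35, 36, 37], a ∉ li) (hr : 0 ∉ lr) : Inst S σ' := by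
  have e0 := hs.1 0 (hi 0 (by decide))
  have e34 := hs.1 34 (hi 34 (by decide))
  have e35 := hs.1 35 (hi 35 (by decide))
  have e36 := hs.1 36 (hi 36 (by decide))
  have e37 := hs.1 37 (hi 37 (by decide))
  have r0 := hs.2 0 hr
  exact ⟨by rw [e0, h.num], by rw [e37, h.len], by rw [e34, e35]; exact h.slots,
    by rw [e36]; exact h.flag, by rw [e36]; exact h.flag_arc, by rw [e36]; exact h.flag_root,
    by rw [r0]; exact h.cost⟩

theorem sum_fin_lt_succ {M : Type*} [AddCommMonoid M] {i : ℕ} (hi : i < m) (g : Fin m → M) :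
    ∑ e : Fin m with e.val < i + 1, g e = ∑ e : Fin m with e.val < i, g e + g ⟨i, hi⟩ := by
  have : ({e | e.val < i + 1} : Finset (Fin m)) =
      insert (⟨i, hi⟩ : Fin m) ({e | e.val < i} : Finset (Fin m)) := by
    ext e
    simp only [mem_filter, mem_univ, true_and, mem_insert, Fin.ext_iff]
    omega
  rw [this, sum_insert (by simp), add_comm]

theorem sum_fin_lt_self {M : Type*} [AddCommMonoid M] (g : Fin m → M) :
    ∑ e : Fin m with e.val < m, g e = ∑ e, g e := by
  congr 1
  ext e
  simp

theorem fin_lt_succ_cases {i : ℕ} (hi : i < m) {e : Fin m} (he : (e : ℕ) < i + 1) :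
    (e : ℕ) < i ∨ e = ⟨i, hi⟩ := by
  rcases Nat.lt_succ_iff_lt_or_eq.1 he with h | h
  · exact .inl h
  · exact .inr (Fin.ext h)

/-! ### Degrees -/

/-- Set the degrees (array 38) and flags (array 39) of all vertices with edges to zero. -/
def clearDegrees : Prog :=
  forLoop 31 0 1 (block [
    .setInt 38 (elt 34) (.const 0),
    .setInt 38 (elt 35) (.const 0),
    .setInt 39 (elt 34) (.const 0),
    .setInt 39 (elt 35) (.const 0)])

/-- Compute the degrees (array 38) and choose an edge at each vertex (array 40).  A loop counts twice,
but loops occur only at the root, whose degree does not matter. -/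
def countDegrees : Prog :=
  forLoop 31 0 1 (block [
    .setInt 38 (elt 34) (.add (.get 38 (elt 34)) (.const 1)),
    .setInt 38 (elt 35) (.add (.get 38 (elt 35)) (.const 1)),
    .setInt 40 (elt 34) (reg 31),
    .setInt 40 (elt 35) (reg 31)])

/-- Set the flags of the touched vertices (array 39). -/
def markTouched : Prog :=
  forLoop 31 37 0 (.ifte (.intLE (.const 1) (elt 36))
    (block [
      .setInt 39 (elt 34) (.const 1),
      .setInt 39 (elt 35) (.const 1)])
    .skip)

theorem runs_clearDegrees (hI : Inst S σ) : Runs clearDegrees σ fun t σ' => t ≤ 7 * m + 2 ∧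
    SameOff clearDegrees.ints clearDegrees.reals σ σ' ∧
    ∀ (v : Fin n) e, S.Inc v e → σ'.int 38 (v : ℕ) = 0 ∧ σ'.int 39 (v : ℕ) = 0 := by
  refine (runs_forLoop m 5 (fun i τ => ∀ (v : Fin n) (e : Fin m), (e : ℕ) < i → S.Inc v e →
    τ.int 38 (v : ℕ) = 0 ∧ τ.int 39 (v : ℕ) = 0) hI.num (by decide) (by decide) (by simp) ?_).mono ?_
  · intro i hi τ hs hiv hI'
    have hI := hI.frame hs (by decide) (by decide)
    obtain ⟨eU, eV⟩ := hI.slots.edge ⟨i, hi⟩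
    simp only at eU eV
    simp only [runs_block_cons, runs_block_nil, runs_setInt, IExpr.eval, putInt_int, hiv, eU, eV,
      Nat.reduceEqDiff, if_true, if_false]
    refine ⟨by norm_num, fun v e he hv => ?_⟩
    simp only [Function.update_apply, Nat.cast_inj, ← Fin.ext_iff]
    rcases fin_lt_succ_cases hi he with h | rfl
    · simp [hI' v e h hv]
    · rcases hv with rfl | rfl <;> simp
  · rintro t σ' ⟨ht, hs, h⟩
    exact ⟨ht, hs.mono (by decide) (by decide), fun v e => h v e e.2⟩

theorem runs_countDegrees (hI : Inst S σ) (h0 : ∀ (v : Fin n) e, S.Inc v e → σ.int 38 (v : ℕ) = 0) :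
    Runs countDegrees σ fun t σ' => t ≤ 7 * m + 2 ∧
      SameOff countDegrees.ints countDegrees.reals σ σ' ∧
      (∀ (v : Fin n) e, S.Inc v e → ¬ S.Touched v → σ'.int 38 (v : ℕ) = S.deg v) ∧
      ∀ (v : Fin n) e, S.Inc v e → ∃ e', S.Inc v e' ∧ σ'.int 40 (v : ℕ) = (e' : ℕ) := by
  refine (runs_forLoop m 5 (fun i τ => (∀ (v : Fin n) e, S.Inc v e → τ.int 38 (v : ℕ) =
      ∑ e : Fin m with e.val < i,
        ((if S.s (.inl e) = v then 1 else 0) + if S.t (.inl e) = v then 1 else 0)) ∧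
    ∀ (v : Fin n) (e : Fin m), (e : ℕ) < i → S.Inc v e →
      ∃ e', S.Inc v e' ∧ τ.int 40 (v : ℕ) = ((e' : Fin m) : ℕ))
    hI.num (by decide) (by decide) ?_ ?_).mono ?_
  · simpa using h0
  · rintro i hi τ hs hiv ⟨h38, h40⟩
    have hI := hI.frame hs (by decide) (by decide)
    obtain ⟨eU, eV⟩ := hI.slots.edge ⟨i, hi⟩
    simp only at eU eV
    simp only [runs_block_cons, runs_block_nil, runs_setInt, IExpr.eval, putInt_int, hiv, eU, eV,
      Nat.reduceEqDiff, if_true, if_false]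
    refine ⟨by norm_num, fun v e hv => ?_, fun v e he hv => ?_⟩
    · rw [sum_fin_lt_succ hi, ← h38 v e hv]
      simp only [Function.update_apply, Nat.cast_inj, ← Fin.ext_iff]
      by_cases h1 : S.s (.inl ⟨i, hi⟩) = v <;> by_cases h2 : S.t (.inl ⟨i, hi⟩) = v
      · simp [h1, h2]; ring
      · simp [h1, h2, Ne.symm h2]
      · simp [h1, h2, Ne.symm h1]
      · simp [h1, h2, Ne.symm h1, Ne.symm h2]
    · simp only [Function.update_apply, Nat.cast_inj, ← Fin.ext_iff]
      by_cases h1 : v = S.t (.inl ⟨i, hi⟩)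
      · exact ⟨⟨i, hi⟩, .inr h1.symm, by simp [h1]⟩
      · by_cases h2 : v = S.s (.inl ⟨i, hi⟩)
        · exact ⟨⟨i, hi⟩, .inl h2.symm, by simp [h2]⟩
        · rcases fin_lt_succ_cases hi he with h | rfl
          · simpa [h1, h2] using h40 v e h hv
          · rcases hv with rfl | rfl
            · exact absurd rfl h2
            · exact absurd rfl h1
  · rintro t σ' ⟨ht, hs, h38, h40⟩
    refine ⟨ht, hs.mono (by decide) (by decide), fun v e hv ht => ?_, fun v e => h40 v e e.2⟩
    rw [h38 v e hv, sum_fin_lt_self, Steiner.deg, card_filter, Nat.cast_sum]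
    refine sum_congr rfl fun e _ => ?_
    by_cases h1 : S.s (.inl e) = v <;> by_cases h2 : S.t (.inl e) = v
    · have := S.loop e (h1.trans h2.symm)
      exact absurd (.inl (h1.symm.trans this)) ht
    all_goals simp [Steiner.Inc, h1, h2]

theorem runs_markTouched (hI : Inst S σ) (h0 : ∀ (v : Fin n) e, S.Inc v e → σ.int 39 (v : ℕ) = 0) :
    Runs markTouched σ fun t σ' => t ≤ 6 * (m + p + 1) + 2 ∧
      SameOff markTouched.ints markTouched.reals σ σ' ∧
      ∀ (v : Fin n) e, S.Inc v e → (1 ≤ σ'.int 39 (v : ℕ) ↔ S.Touched v) := by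
  refine (runs_forLoop (m + p + 1) 4 (fun i τ => ∀ (v : Fin n) e, S.Inc v e →
    (1 ≤ τ.int 39 (v : ℕ) ↔ ∃ j : ℕ, j < i ∧ 1 ≤ σ.int 36 j ∧
      (σ.int 34 j = (v : ℕ) ∨ σ.int 35 j = (v : ℕ))))
    hI.len (by decide) (by decide) ?_ ?_).mono ?_
  · intro v e hv
    simp [h0 v e hv]
  · rintro i hi τ hs hiv h
    have e34 := hs.1 34 (by decide)
    have e35 := hs.1 35 (by decide)
    have e36 := hs.1 36 (by decide)
    simp only [runs_ifte, Test.holds, runs_block_cons, runs_block_nil, runs_setInt, runs_skip,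
      IExpr.eval, putInt_int, hiv, e34, e35, e36, Nat.reduceEqDiff, if_true, if_false]
    constructor
    · intro h36
      refine ⟨by norm_num, fun v e hv => ?_⟩
      simp only [Function.update_apply]
      constructor
      · intro h'
        by_cases h1 : σ.int 35 i = (v : ℕ)
        · exact ⟨i, by omega, h36, .inr h1⟩
        · by_cases h2 : σ.int 34 i = (v : ℕ)
          · exact ⟨i, by omega, h36, .inl h2⟩
          · simp only [Ne.symm h1, Ne.symm h2, if_false] at h'
            obtain ⟨j, h3, h4⟩ := (h v e hv).1 h'
            exact ⟨j, by omega, h4⟩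
      · rintro ⟨j, h1, h2, h3⟩
        rcases Nat.lt_succ_iff_lt_or_eq.1 h1 with h4 | rfl
        · have := (h v e hv).2 ⟨j, h4, h2, h3⟩
          split_ifs <;> omega
        · rcases h3 with h3 | h3 <;> simp [h3]
    · intro h36
      refine ⟨by norm_num, fun v e hv => ?_⟩
      rw [h v e hv]
      constructor
      · rintro ⟨j, h1, h2⟩
        exact ⟨j, by omega, h2⟩
      · rintro ⟨j, h1, h2, h3⟩
        rcases Nat.lt_succ_iff_lt_or_eq.1 h1 with h4 | rfl
        · exact ⟨j, h4, h2, h3⟩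
        · exact absurd h2 h36
  · rintro t σ' ⟨ht, hs, h⟩
    refine ⟨ht, hs.mono (by decide) (by decide), fun v e hv => (h v e hv).trans ?_⟩
    constructor
    · rintro ⟨j, h1, h2, h3⟩
      rcases slot_cases h1 with ⟨e, rfl⟩ | ⟨a, rfl⟩ | rfl
      · rw [(hI.slots.edge e).1, (hI.slots.edge e).2] at h3
        exact .inr ⟨.inl e, (hI.flag e).1 h2, by simpa [Fin.ext_iff] using h3⟩
      · rw [(hI.slots.arc a).1, (hI.slots.arc a).2] at h3
        exact .inr ⟨.inr a, S.mem_Q a, by simpa [Fin.ext_iff] using h3⟩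
      · rw [hI.slots.root.1, hI.slots.root.2] at h3
        exact .inl (by simpa [Fin.ext_iff, eq_comm] using h3)
    · rintro (rfl | ⟨e | a, h1, h2⟩)
      · exact ⟨m + p, by omega, hI.flag_root, .inl hI.slots.root.1⟩
      · refine ⟨e, by omega, (hI.flag e).2 h1, ?_⟩
        rw [(hI.slots.edge e).1, (hI.slots.edge e).2]
        simpa [Fin.ext_iff] using h2
      · refine ⟨m + a, by omega, hI.flag_arc a, ?_⟩
        rw [(hI.slots.arc a).1, (hI.slots.arc a).2]
        simpa [Fin.ext_iff] using h2

/-- Degrees (for the untouched vertices), flags for the touched vertices, and incident edges. -/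
structure Degrees (S : Steiner (Fin n) (Fin m) (Fin p)) (σ : State) : Prop where
  deg : ∀ (v : Fin n) e, S.Inc v e → ¬ S.Touched v → σ.int 38 (v : ℕ) = S.deg v
  touched : ∀ (v : Fin n) e, S.Inc v e → (1 ≤ σ.int 39 (v : ℕ) ↔ S.Touched v)
  first : ∀ (v : Fin n) e, S.Inc v e → ∃ e', S.Inc v e' ∧ σ.int 40 (v : ℕ) = (e' : ℕ)

/-- Fill the arrays 38, 39 and 40 as required by `Degrees`. -/
def computeDegrees : Prog := block [clearDegrees, countDegrees, markTouched]

theorem runs_computeDegrees (hI : Inst S σ) :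
    Runs computeDegrees σ fun t σ' => t ≤ 20 * (m + p + 1) + 10 ∧
      SameOff computeDegrees.ints computeDegrees.reals σ σ' ∧ Degrees S σ' := by
  suffices hS : Runs computeDegrees σ fun t σ' => t ≤ 20 * (m + p + 1) + 10 ∧ Degrees S σ' from
    hS.sameOff.mono fun t σ' h => ⟨h.1.1, h.2, h.1.2⟩
  rw [computeDegrees, runs_block_cons]
  refine (runs_clearDegrees hI).mono ?_
  rintro t1 σ1 ⟨ht1, hs1, h1⟩
  have hI1 := hI.frame hs1 (by decide) (by decide)
  rw [runs_block_cons]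
  refine (runs_countDegrees hI1 fun v e hv => (h1 v e hv).1).mono ?_
  rintro t2 σ2 ⟨ht2, hs2, h38, h40⟩
  have hI2 := hI1.frame hs2 (by decide) (by decide)
  rw [runs_block_cons]
  refine (runs_markTouched hI2 fun v e hv => ?_).mono ?_
  · rw [hs2.1 39 (by decide)]; exact (h1 v e hv).2
  rintro t3 σ3 ⟨ht3, hs3, h39⟩
  simp only [runs_block_nil]
  refine ⟨by omega, ?_, h39, ?_⟩
  · rw [hs3.1 38 (by decide)]; exact h38
  · rw [hs3.1 40 (by decide)]; exact h40

end

section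

open scoped Classical

variable {n m p : ℕ} {S : Steiner (Fin n) (Fin m) (Fin p)} {σ σ' : State} {rep : Fin m → Fin m}

/-! ### Threads -/

/-- The vertex is thin, according to its degree and its flag. -/
def thinTest (x : IExpr) : Test :=
  .conj (.neg (.intLE (.const 1) (.get 39 x)))
    (.conj (.intLE (.get 38 x) (.const 2)) (.intLE (.const 2) (.get 38 x)))

/-- List the pairs of an edge and the edge chosen at one of its ends, if this end is thin.  The
components of this graph, whose vertices are the edges of the Steiner tree problem, are the threads. -/
def loadThreads : Prog := block [
  .setInt 13 (.const 0) (.add (.get 0 (.const 1)) (.get 0 (.const 1))),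
  forLoop 31 0 1 (block [
    .setInt 10 (reg 31) (reg 31),
    .setInt 10 (.add (.get 0 (.const 1)) (reg 31)) (reg 31),
    .setInt 11 (reg 31) (.get 40 (elt 34)),
    .setInt 11 (.add (.get 0 (.const 1)) (reg 31)) (.get 40 (elt 35)),
    .ifte (thinTest (elt 34)) (.setInt 12 (reg 31) (.const 1)) (.setInt 12 (reg 31) (.const 0)),
    .ifte (thinTest (elt 35)) (.setInt 12 (.add (.get 0 (.const 1)) (reg 31)) (.const 1))
      (.setInt 12 (.add (.get 0 (.const 1)) (reg 31)) (.const 0))])]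

theorem Degrees.thin_iff (hd : Degrees S σ) {v : Fin n} {e : Fin m} (hv : S.Inc v e) :
    (¬ 1 ≤ σ.int 39 (v : ℕ) ∧ σ.int 38 (v : ℕ) ≤ 2 ∧ 2 ≤ σ.int 38 (v : ℕ)) ↔ S.Thin v := by
  rw [hd.touched v e hv, Steiner.Thin]
  refine and_congr_right fun h => ?_
  rw [hd.deg v e hv h]
  omega

theorem Degrees.frame (h : Degrees S σ) {li lr : List ℕ} (hs : SameOff li lr σ σ')
    (hi : ∀ a ∈ [38, 39, 40], a ∉ li) : Degrees S σ' := by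
  have e38 := hs.1 38 (hi 38 (by decide))
  have e39 := hs.1 39 (hi 39 (by decide))
  have e40 := hs.1 40 (hi 40 (by decide))
  exact ⟨by rw [e38]; exact h.deg, by rw [e39]; exact h.touched, by rw [e40]; exact h.first⟩

theorem runs_loadThreads (hI : Inst S σ) (hd : Degrees S σ) :
    Runs loadThreads σ fun t σ' => t ≤ 12 * m + 5 ∧
      SameOff loadThreads.ints loadThreads.reals σ σ' ∧ σ'.int 13 0 = (m + m : ℕ) ∧
      (∀ e : Fin m, σ'.int 10 (e : ℕ) = (e : ℕ) ∧ σ'.int 10 (m + e : ℕ) = (e : ℕ) ∧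
        σ'.int 11 (e : ℕ) = σ.int 40 (S.s (.inl e) : ℕ) ∧
        σ'.int 11 (m + e : ℕ) = σ.int 40 (S.t (.inl e) : ℕ) ∧
        (1 ≤ σ'.int 12 (e : ℕ) ↔ S.Thin (S.s (.inl e))) ∧
        (1 ≤ σ'.int 12 (m + e : ℕ) ↔ S.Thin (S.t (.inl e)))) := by
  suffices hS : Runs loadThreads σ fun t σ' => t ≤ 12 * m + 5 ∧ σ'.int 13 0 = (m + m : ℕ) ∧
      (∀ e : Fin m, σ'.int 10 (e : ℕ) = (e : ℕ) ∧ σ'.int 10 (m + e : ℕ) = (e : ℕ) ∧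
        σ'.int 11 (e : ℕ) = σ.int 40 (S.s (.inl e) : ℕ) ∧
        σ'.int 11 (m + e : ℕ) = σ.int 40 (S.t (.inl e) : ℕ) ∧
        (1 ≤ σ'.int 12 (e : ℕ) ↔ S.Thin (S.s (.inl e))) ∧
        (1 ≤ σ'.int 12 (m + e : ℕ) ↔ S.Thin (S.t (.inl e)))) from
    hS.sameOff.mono fun t σ' h => ⟨h.1.1, h.2, h.1.2⟩
  rw [loadThreads, runs_block_cons, runs_setInt, runs_block_cons]
  set σ1 := σ.putInt 13 ((IExpr.const 0).eval σ)
    ((IExpr.add (.get 0 (.const 1)) (.get 0 (.const 1))).eval σ) with hσ1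
  have hs0 : SameOff [13] [] σ σ1 :=
    ⟨fun a ha => by rw [hσ1, putInt_int, if_neg (by simpa using ha)], fun _ _ => rfl⟩
  have hI1 := hI.frame hs0 (by decide) (by decide)
  have hd1 := hd.frame hs0 (by decide)
  have h13 : σ1.int 13 0 = (m + m : ℕ) := by simp [hσ1, hI.num]
  have h40 : σ1.int 40 = σ.int 40 := hs0.1 40 (by decide)
  refine (runs_forLoop m 9 (fun i τ => ∀ e : Fin m, (e : ℕ) < i →
    τ.int 10 (e : ℕ) = (e : ℕ) ∧ τ.int 10 (m + e : ℕ) = (e : ℕ) ∧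
        τ.int 11 (e : ℕ) = σ.int 40 (S.s (.inl e) : ℕ) ∧
        τ.int 11 (m + e : ℕ) = σ.int 40 (S.t (.inl e) : ℕ) ∧
        (1 ≤ τ.int 12 (e : ℕ) ↔ S.Thin (S.s (.inl e))) ∧
        (1 ≤ τ.int 12 (m + e : ℕ) ↔ S.Thin (S.t (.inl e)))) hI1.num
    (by decide) (by decide) (by simp) ?_).mono ?_
  · intro i hi τ hs hiv h
    have hIτ := hI1.frame hs (by decide) (by decide)
    have hdτ := hd1.frame hs (by decide)
    have h40τ : τ.int 40 = σ.int 40 := (hs.1 40 (by decide)).trans h40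
    obtain ⟨eU, eV⟩ := hIτ.slots.edge ⟨i, hi⟩
    have et1 := hdτ.thin_iff (v := S.s (.inl ⟨i, hi⟩)) (e := ⟨i, hi⟩) (.inl rfl)
    have et2 := hdτ.thin_iff (v := S.t (.inl ⟨i, hi⟩)) (e := ⟨i, hi⟩) (.inr rfl)
    simp only at eU eV
    simp only [runs_block_cons, runs_block_nil, runs_setInt, IExpr.eval, putInt_int, hiv, eU, eV,
      Nat.reduceEqDiff, if_true, if_false, runs_ifte, thinTest, Test.holds, hIτ.num, h40τ, et1, et2]
    have key : ∀ a b : ℤ, (1 ≤ a ↔ S.Thin (S.s (.inl ⟨i, hi⟩))) →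
        (1 ≤ b ↔ S.Thin (S.t (.inl ⟨i, hi⟩))) → ∀ e : Fin m, (e : ℕ) < i + 1 →
      Function.update (Function.update (τ.int 10) (i : ℤ) i) (m + i : ℤ) i (e : ℕ) = (e : ℕ) ∧
      Function.update (Function.update (τ.int 10) (i : ℤ) i) (m + i : ℤ) i (m + e : ℕ) = (e : ℕ) ∧
      Function.update (Function.update (τ.int 11) (i : ℤ) (σ.int 40 (S.s (.inl ⟨i, hi⟩) : ℕ)))
        (m + i : ℤ) (σ.int 40 (S.t (.inl ⟨i, hi⟩) : ℕ)) (e : ℕ) = σ.int 40 (S.s (.inl e) : ℕ) ∧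
      Function.update (Function.update (τ.int 11) (i : ℤ) (σ.int 40 (S.s (.inl ⟨i, hi⟩) : ℕ)))
        (m + i : ℤ) (σ.int 40 (S.t (.inl ⟨i, hi⟩) : ℕ)) (m + e : ℕ) = σ.int 40 (S.t (.inl e) : ℕ) ∧
      (1 ≤ Function.update (Function.update (τ.int 12) (i : ℤ) a) (m + i : ℤ) b (e : ℕ) ↔
        S.Thin (S.s (.inl e))) ∧
      (1 ≤ Function.update (Function.update (τ.int 12) (i : ℤ) a) (m + i : ℤ) b (m + e : ℕ) ↔
        S.Thin (S.t (.inl e))) := by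
      intro a b ha hb e he
      have n1 : ((e : ℕ) : ℤ) ≠ m + i := by omega
      have n2 : ((m + e : ℕ) : ℤ) ≠ i := by omega
      rcases fin_lt_succ_cases hi he with h' | rfl
      · have n3 : ((e : ℕ) : ℤ) ≠ i := by omega
        have n4 : ((m + e : ℕ) : ℤ) ≠ m + i := by omega
        simpa only [Function.update_apply, if_neg n1, if_neg n2, if_neg n3, if_neg n4] using h e h'
      · simp only at n1 n2
        have n4 : ((m + i : ℕ) : ℤ) = m + i := by omega
        simp only [Function.update_apply, if_neg n1, if_neg n2, if_pos n4, if_true]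
        exact ⟨trivial, trivial, trivial, trivial, ha, hb⟩
    constructor <;> intro c1 <;> constructor <;> intro c2 <;>
      refine ⟨by norm_num, key _ _ (by simp [c1]) (by simp [c2])⟩
  · rintro t σ' ⟨ht, hs, h⟩
    simp only [runs_block_nil]
    refine ⟨by omega, ?_, fun e => h e e.2⟩
    rw [hs.1 13 (by decide), h13]

variable {lab : ℤ → ℤ} {cnt : ℕ} {U V A : ℤ → ℤ}

theorem edge_slot_cases {j : ℕ} (hj : j < m + m) :
    (∃ e : Fin m, j = e) ∨ ∃ e : Fin m, j = m + e := by
  by_cases h1 : j < m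
  · exact .inl ⟨⟨j, h1⟩, rfl⟩
  · exact .inr ⟨⟨j - m, by omega⟩, by simp; omega⟩

theorem label_threads_iff {first : ℤ → ℤ}
    (hf : ∀ (v : Fin n) e, S.Inc v e → ∃ e', S.Inc v e' ∧ first (v : ℕ) = ((e' : Fin m) : ℕ))
    (h : ∀ e : Fin m, U (e : ℕ) = (e : ℕ) ∧ U (m + e : ℕ) = (e : ℕ) ∧
        V (e : ℕ) = first (S.s (.inl e) : ℕ) ∧ V (m + e : ℕ) = first (S.t (.inl e) : ℕ) ∧
        (1 ≤ A (e : ℕ) ↔ S.Thin (S.s (.inl e))) ∧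
        (1 ≤ A (m + e : ℕ) ↔ S.Thin (S.t (.inl e))))
    (hlab : IsLabelling (m + m) U V A lab cnt) (e e' : Fin m) :
    lab (e : ℕ) = lab (e' : ℕ) ↔ Relation.EqvGen S.Link e e' := by
  have hend : ∀ e : Fin m, IsEnd (m + m) U V (e : ℕ) := fun e =>
    ⟨e, by omega, .inl (h e).1.symm⟩
  rw [hlab.eq_iff _ _ (hend e) (hend e')]
  constructor
  · refine eqvGen_of_map (φ := fun x : Fin m => ((x : ℕ) : ℤ)) (natCast_fin_injective m) ?_
    rintro x y ⟨j, hj, hA, rfl, rfl⟩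
    rcases edge_slot_cases hj with ⟨e, rfl⟩ | ⟨e, rfl⟩
    · obtain ⟨e', h1, h2⟩ := hf (S.s (.inl e)) e (.inl rfl)
      exact ⟨e, e', (h e).1.symm, ((h e).2.2.1.trans h2).symm,
        .rel _ _ ⟨_, (h e).2.2.2.2.1.1 hA, .inl rfl, h1⟩⟩
    · obtain ⟨e', h1, h2⟩ := hf (S.t (.inl e)) e (.inr rfl)
      exact ⟨e, e', (h e).2.1.symm, ((h e).2.2.2.1.trans h2).symm,
        .rel _ _ ⟨_, (h e).2.2.2.2.2.1 hA, .inr rfl, h1⟩⟩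
  · refine eqvGen_map (φ := fun x : Fin m => ((x : ℕ) : ℤ)) ?_
    -- both edges are joined to the edge chosen at the thin vertex
    have key : ∀ v, S.Thin v → ∀ e, S.Inc v e → Joined (m + m) U V A (e : ℕ) (first (v : ℕ)) := by
      rintro v hv e (rfl | rfl)
      · exact .rel _ _ ⟨e, by omega, (h e).2.2.2.2.1.2 hv, (h e).1, (h e).2.2.1⟩
      · exact .rel _ _ ⟨m + e, by omega, (h e).2.2.2.2.2.2 hv, (h e).2.1, (h e).2.2.2.1⟩
    rintro a b ⟨v, hv, h1, h2⟩
    exact (key v hv a h1).trans _ _ _ (key v hv b h2).symm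

/-- Copy the class of each edge to array 41, keep the last edge of each class as its representative in
array 42, and clear the costs of the classes in the real array 10. -/
def chooseReps : Prog :=
  forLoop 31 0 1 (block [
    .setInt 41 (reg 31) (elt 14),
    .setInt 42 (elt 14) (reg 31),
    .setReal 10 (elt 14) .zero])

/-- Add up the costs of the classes, and compute the cost that exceeds all others (real cell `11[0]`). -/
def addTotals : Prog := block [
  .setReal 11 (.const 0) .zero,
  forLoop 31 0 1 (block [
    .setReal 10 (elt 41) (.add (.get 10 (elt 41)) (.get 0 (reg 31))),
    .setReal 11 (.const 0) (.add (.get 11 (.const 0)) (.add (.get 0 (reg 31)) (.get 0 (reg 31))))])]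

/-- The threads, as `chooseReps` and `addTotals` store them. -/
structure Threads (S : Steiner (Fin n) (Fin m) (Fin p)) (rep : Fin m → Fin m) (σ : State) :
    Prop where
  isRep : S.IsRep rep
  cls : ∀ e e' : Fin m, σ.int 41 (e : ℕ) = σ.int 41 (e' : ℕ) ↔ rep e = rep e'
  rep_eq : ∀ e : Fin m, σ.int 42 (σ.int 41 (e : ℕ)) = (rep e : ℕ)
  total : ∀ e : Fin m, σ.real 10 (σ.int 41 (e : ℕ)) = ∑ e' with rep e' = rep e, S.c e'
  big : σ.real 11 0 = ∑ e, (S.c e + S.c e)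

theorem Threads.frame (h : Threads S rep σ) {li lr : List ℕ} (hs : SameOff li lr σ σ')
    (hi : ∀ a ∈ [41, 42], a ∉ li) (hr : ∀ a ∈ [10, 11], a ∉ lr) : Threads S rep σ' := by
  have e41 := hs.1 41 (hi 41 (by decide))
  have e42 := hs.1 42 (hi 42 (by decide))
  have e10 := hs.2 10 (hr 10 (by decide))
  have e11 := hs.2 11 (hr 11 (by decide))
  exact ⟨h.isRep, by rw [e41]; exact h.cls, by rw [e41, e42]; exact h.rep_eq,
    by rw [e41, e10]; exact h.total, by rw [e11]; exact h.big⟩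

theorem runs_chooseReps (hI : Inst S σ)
    (hlab : ∀ e e' : Fin m, σ.int 14 (e : ℕ) = σ.int 14 (e' : ℕ) ↔ Relation.EqvGen S.Link e e') :
    Runs chooseReps σ fun t σ' => t ≤ 6 * m + 2 ∧
      SameOff chooseReps.ints chooseReps.reals σ σ' ∧ ∃ rep, S.IsRep rep ∧
      (∀ e e' : Fin m, σ'.int 41 (e : ℕ) = σ'.int 41 (e' : ℕ) ↔ rep e = rep e') ∧
      (∀ e : Fin m, σ'.int 42 (σ'.int 41 (e : ℕ)) = (rep e : ℕ)) ∧
      ∀ e : Fin m, σ'.real 10 (σ'.int 41 (e : ℕ)) = 0 := by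
  refine (runs_forLoop m 4 (fun i τ => ∀ e : Fin m, (e : ℕ) < i →
    τ.int 41 (e : ℕ) = σ.int 14 (e : ℕ) ∧ τ.real 10 (σ.int 14 (e : ℕ)) = 0 ∧
    ∃ e' : Fin m, τ.int 42 (σ.int 14 (e : ℕ)) = (e' : ℕ) ∧ σ.int 14 (e' : ℕ) = σ.int 14 (e : ℕ))
    hI.num (by decide) (by decide) (by simp) ?_).mono ?_
  · intro i hi τ hs hiv h
    have e14 := hs.1 14 (by decide)
    simp only [runs_block_cons, runs_block_nil, runs_setInt, runs_setReal, IExpr.eval, RExpr.eval,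
      putInt_int, putInt_real, putReal_int, putReal_real, hiv, e14, Nat.reduceEqDiff, if_true, if_false]
    refine ⟨by norm_num, fun e he => ?_⟩
    simp only [Function.update_apply]
    rcases fin_lt_succ_cases hi he with h' | rfl
    · obtain ⟨h1, h2, e', h3, h4⟩ := h e h'
      have n1 : ((e : ℕ) : ℤ) ≠ i := by omega
      refine ⟨by simp [n1, h1], by simp [h2], ?_⟩
      by_cases hc : σ.int 14 (e : ℕ) = σ.int 14 i
      · exact ⟨⟨i, hi⟩, by simp [hc], hc.symm⟩
      · exact ⟨e', by simp [hc, h3], h4⟩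
    · exact ⟨by simp, by simp, ⟨i, hi⟩, by simp, rfl⟩
  · rintro t σ' ⟨ht, hs, h⟩
    choose h1 h2 rep h3 h4 using fun e : Fin m => h e e.2
    have hrep : ∀ e e', rep e = rep e' ↔ σ.int 14 (e : ℕ) = σ.int 14 (e' : ℕ) := by
      intro e e'
      constructor
      · intro he
        rw [← h4 e, ← h4 e', he]
      · intro he
        refine Fin.ext ?_
        have := h3 e
        rw [he, h3 e'] at this
        exact_mod_cast this.symm
    refine ⟨ht, hs.mono (by decide) (by decide), rep, ⟨fun e e' => ?_, fun e => ?_⟩, ?_, ?_, ?_⟩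
    · rw [hrep, hlab]
    · rw [hrep, h4]
    · intro e e'
      rw [h1, h1, hrep]
    · intro e
      rw [h1, h3]
    · intro e
      rw [h1, h2]

theorem runs_addTotals (hI : Inst S σ) (hrep : S.IsRep rep)
    (hcls : ∀ e e' : Fin m, σ.int 41 (e : ℕ) = σ.int 41 (e' : ℕ) ↔ rep e = rep e')
    (hr : ∀ e : Fin m, σ.int 42 (σ.int 41 (e : ℕ)) = (rep e : ℕ))
    (h0 : ∀ e : Fin m, σ.real 10 (σ.int 41 (e : ℕ)) = 0) :
    Runs addTotals σ fun t σ' => t ≤ 5 * m + 5 ∧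
      SameOff addTotals.ints addTotals.reals σ σ' ∧ Threads S rep σ' := by
  suffices hS : Runs addTotals σ fun t σ' => t ≤ 5 * m + 5 ∧ Threads S rep σ' from
    hS.sameOff.mono fun t σ' h => ⟨h.1.1, h.2, h.1.2⟩
  rw [addTotals, runs_block_cons, runs_setReal, runs_block_cons]
  refine (runs_forLoop m 3 (fun i τ => τ.real 11 0 = ∑ e : Fin m with e.val < i, (S.c e + S.c e) ∧
    ∀ e : Fin m, τ.real 10 (σ.int 41 (e : ℕ)) =
      ∑ e' : Fin m with e'.val < i, if rep e' = rep e then S.c e' else 0)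
    (by simpa using hI.num) (by decide) (by decide) (by simpa using h0) ?_).mono ?_
  · rintro i hi τ hs hiv ⟨h11, h10⟩
    have e41 : τ.int 41 = σ.int 41 := hs.1 41 (by decide)
    have r0 : τ.real 0 = σ.real 0 := (hs.2 0 (by decide)).trans (by simp)
    have ec : σ.real 0 (i : ℤ) = _ := hI.cost ⟨i, hi⟩
    simp only [runs_block_cons, runs_block_nil, runs_setReal, IExpr.eval, RExpr.eval, putInt_real,
      putReal_int, putReal_real, hiv, e41, r0, ec, Nat.reduceEqDiff, if_true, if_false, h11]
    refine ⟨by norm_num, ?_, fun e => ?_⟩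
    · rw [sum_fin_lt_succ hi]
      simp
    · rw [sum_fin_lt_succ hi, Function.update_apply]
      have hc := hcls e ⟨i, hi⟩
      simp only at hc
      simp only [hc, h10]
      by_cases he : rep e = rep ⟨i, hi⟩
      · have := h10 ⟨i, hi⟩
        simp only at this
        rw [if_pos he, this, if_pos he.symm]
        simp only [he]
      · rw [if_neg he, if_neg (Ne.symm he), add_zero]
  · rintro t σ' ⟨ht, hs, h11, h10⟩
    have e41 : σ'.int 41 = σ.int 41 := hs.1 41 (by decide)
    have e42 : σ'.int 42 = σ.int 42 := hs.1 42 (by decide)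
    simp only [runs_block_nil]
    refine ⟨by omega, hrep, by rw [e41]; exact hcls, by rw [e41, e42]; exact hr, ?_, ?_⟩
    · intro e
      rw [e41, h10, sum_fin_lt_self, sum_filter]
    · rw [h11, sum_fin_lt_self]

/-- Compute the threads. -/
def computeThreads : Prog := block [loadThreads, labelComponents, chooseReps, addTotals]

theorem runs_computeThreads (hI : Inst S σ) (hd : Degrees S σ) :
    Runs computeThreads σ fun t σ' => t ≤ 430 * m + 50 ∧
      SameOff computeThreads.ints computeThreads.reals σ σ' ∧ ∃ rep, Threads S rep σ' := by
  suffices hS : Runs computeThreads σ fun t σ' => t ≤ 430 * m + 50 ∧ ∃ rep, Threads S rep σ' from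
    hS.sameOff.mono fun t σ' h => ⟨h.1.1, h.2, h.1.2⟩
  rw [computeThreads, runs_block_cons]
  refine (runs_loadThreads hI hd).mono ?_
  rintro t1 σ1 ⟨ht1, hs1, h13, h1⟩
  have hI1 := hI.frame hs1 (by decide) (by decide)
  rw [runs_block_cons]
  refine (runs_labelComponents h13).mono ?_
  rintro t2 σ2 ⟨ht2, hs2, cnt, -, hlab⟩
  have hI2 := hI1.frame hs2 (by decide) (by decide)
  rw [runs_block_cons]
  refine (runs_chooseReps hI2 (label_threads_iff hd.first h1 hlab)).mono ?_
  rintro t3 σ3 ⟨ht3, hs3, rep, hrep, h3, h4, h5⟩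
  have hI3 := hI2.frame hs3 (by decide) (by decide)
  rw [runs_block_cons]
  refine (runs_addTotals hI3 hrep h3 h4 h5).mono ?_
  rintro t4 σ4 ⟨ht4, hs4, h6⟩
  simp only [runs_block_nil]
  exact ⟨by omega, rep, h6⟩

end

section

open scoped Classical

variable {n m p N k : ℕ} {S : Steiner (Fin n) (Fin m) (Fin p)} {σ σ' : State} {rep : Fin m → Fin m}
  {lab : Fin n → Fin N}

/-! ### The contraction -/

theorem Steiner.cov_iff {v : Fin n} : S.Cov v ↔ v = S.r₀ ∨ ∃ i, S.s i = v ∨ S.t i = v := by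
  constructor
  · intro h
    rcases h.symm'.eq_or_mem with h | ⟨i, -, h⟩
    · exact .inl h.symm
    · exact .inr ⟨i, h⟩
  · rintro (rfl | ⟨i, rfl | rfl⟩)
    · exact Steiner.cov_r₀
    · exact S.conn i
    · exact Steiner.cov_t i

/-- Flags for the edges to be contracted. -/
def flagContracted : Prog := block [
  forLoop 31 37 0 (.setInt 54 (reg 31) (elt 36)),
  forLoop 31 0 1 (.ifte (.conj (.intLE (.get 42 (elt 41)) (reg 31)) (.intLE (reg 31) (.get 42 (elt 41))))
    .skip (.setInt 54 (reg 31) (.const 1)))]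

theorem runs_flagContracted (hI : Inst S σ) (ht : Threads S rep σ) :
    Runs flagContracted σ fun t σ' => t ≤ 10 * (m + p + 1) ∧
      SameOff flagContracted.ints flagContracted.reals σ σ' ∧
      (∀ e : Fin m, 1 ≤ σ'.int 54 (e : ℕ) ↔ .inl e ∈ Steiner.contracted S rep) ∧
      ∀ a : Fin p, 1 ≤ σ'.int 54 (m + a : ℕ) := by
  suffices hS : Runs flagContracted σ fun t σ' => t ≤ 10 * (m + p + 1) ∧
      (∀ e : Fin m, 1 ≤ σ'.int 54 (e : ℕ) ↔ .inl e ∈ Steiner.contracted S rep) ∧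
      ∀ a : Fin p, 1 ≤ σ'.int 54 (m + a : ℕ) from
    hS.sameOff.mono fun t σ' h => ⟨h.1.1, h.2, h.1.2⟩
  rw [flagContracted, runs_block_cons]
  refine (runs_forLoop (m + p + 1) 1 (fun i τ => ∀ j : ℕ, j < i → τ.int 54 j = σ.int 36 j) hI.len
    (by decide) (by decide) (by simp) ?_).mono ?_
  · intro i hi τ hs hiv h
    have e36 := hs.1 36 (by decide)
    simp only [runs_setInt, IExpr.eval, putInt_int, hiv, e36, Nat.reduceEqDiff, if_true, if_false]
    refine ⟨le_refl _, fun j hj => ?_⟩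
    rcases Nat.lt_succ_iff_lt_or_eq.1 hj with h' | rfl
    · simpa [Function.update_apply, h'.ne] using h j h'
    · simp
  rintro t1 σ1 ⟨ht1, hs1, h1⟩
  have hI1 := hI.frame hs1 (by decide) (by decide)
  have hT1 := ht.frame hs1 (by decide) (by decide)
  rw [runs_block_cons]
  refine (runs_forLoop m 2 (fun i τ => (∀ j : ℕ, m ≤ j → τ.int 54 j = σ1.int 54 j) ∧
    ∀ e : Fin m, (1 ≤ τ.int 54 (e : ℕ) ↔ 1 ≤ σ1.int 54 (e : ℕ) ∨ ((e : ℕ) < i ∧ rep e ≠ e)))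
    hI1.num (by decide) (by decide) (by simp) ?_).mono ?_
  · intro i hi τ hs hiv h
    have hTτ := hT1.frame hs (by decide) (by decide)
    have hre := hTτ.rep_eq ⟨i, hi⟩
    simp only at hre
    simp only [runs_ifte, Test.holds, runs_skip, runs_setInt, IExpr.eval, putInt_int, hiv, hre,
      Nat.reduceEqDiff, if_true, if_false]
    constructor
    · intro hc
      have hc' : rep ⟨i, hi⟩ = ⟨i, hi⟩ := Fin.ext (by simp only; omega)
      refine ⟨by norm_num, h.1, fun e => ?_⟩
      rw [h.2 e]
      refine or_congr_right ⟨fun h => ⟨by omega, h.2⟩, fun h => ⟨?_, h.2⟩⟩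
      rcases fin_lt_succ_cases hi h.1 with h' | rfl
      · exact h'
      · exact absurd hc' h.2
    · intro hc
      have hc' : rep ⟨i, hi⟩ ≠ ⟨i, hi⟩ := fun h => hc (by rw [h]; simp)
      refine ⟨by norm_num, fun j hj => ?_, fun e => ?_⟩
      · rw [Function.update_of_ne (by omega), h.1 j hj]
      · by_cases he : e = ⟨i, hi⟩
        · subst he
          simp [hc']
        · have : (e : ℕ) ≠ i := fun h => he (Fin.ext h)
          rw [Function.update_of_ne (by exact_mod_cast this), h.2 e]
          refine or_congr_right (and_congr_left fun _ => by omega)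
  rintro t2 σ2 ⟨ht2, hs2, h2, h3⟩
  simp only [runs_block_nil]
  refine ⟨by omega, fun e => ?_, fun a => ?_⟩
  · rw [h3, h1 e (by omega), hI.flag]
    simp [Steiner.contracted]
  · rw [h2 (m + a) (by omega), h1 (m + a) (by omega)]
    exact hI.flag_arc a

/-- Array 45 is to hold the number of the vertices of the contracted graph, and the arrays 43 and 44 the
ends of its edges. -/
def storeContraction : Prog := block [
  .setInt 45 (.const 0) (reg 18),
  forLoop 31 0 1 (block [
    .setInt 43 (reg 31) (.get 14 (elt 34)),
    .setInt 44 (reg 31) (.get 14 (elt 35))])]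

/-- Compute the contracted graph. -/
def contract : Prog := block [flagContracted, labelSlots (elt 54), storeContraction]

/-- The contracted graph, as `contract` stores it. -/
structure Contraction (S : Steiner (Fin n) (Fin m) (Fin p)) (rep : Fin m → Fin m)
    (lab : Fin n → Fin N) (σ : State) : Prop where
  isContraction : Steiner.IsContraction S rep lab
  num : σ.int 45 0 = N
  ends : ∀ e : Fin m, σ.int 43 (e : ℕ) = (lab (S.s (.inl e)) : ℕ) ∧
    σ.int 44 (e : ℕ) = (lab (S.t (.inl e)) : ℕ)

theorem Contraction.frame (h : Contraction S rep lab σ) {li lr : List ℕ} (hs : SameOff li lr σ σ')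
    (hi : ∀ a ∈ [43, 44, 45], a ∉ li) : Contraction S rep lab σ' := by
  have e43 := hs.1 43 (hi 43 (by decide))
  have e44 := hs.1 44 (hi 44 (by decide))
  have e45 := hs.1 45 (hi 45 (by decide))
  exact ⟨h.isContraction, by rw [e45, h.num], by rw [e43, e44]; exact h.ends⟩

theorem runs_storeContraction (hI : Inst S σ) :
    Runs storeContraction σ fun t σ' => t ≤ 5 * m + 5 ∧
      σ'.int 45 0 = σ.int 18 0 ∧
      ∀ e : Fin m, σ'.int 43 (e : ℕ) = σ.int 14 (S.s (.inl e) : ℕ) ∧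
        σ'.int 44 (e : ℕ) = σ.int 14 (S.t (.inl e) : ℕ) := by
  rw [storeContraction, runs_block_cons, runs_setInt, runs_block_cons]
  set σ1 := σ.putInt 45 ((IExpr.const 0).eval σ) ((reg 18).eval σ) with hσ1
  have hs1 : SameOff [45] [] σ σ1 :=
    ⟨fun a ha => by rw [hσ1, putInt_int, if_neg (by simpa using ha)], fun _ _ => rfl⟩
  have hI1 := hI.frame hs1 (by decide) (by decide)
  refine (runs_forLoop m 3 (fun i τ => ∀ e : Fin m, (e : ℕ) < i →
    τ.int 43 (e : ℕ) = σ.int 14 (S.s (.inl e) : ℕ) ∧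
        τ.int 44 (e : ℕ) = σ.int 14 (S.t (.inl e) : ℕ)) hI1.num
    (by decide) (by decide) (by simp) ?_).mono ?_
  · intro i hi τ hs hiv h
    have hIτ := hI1.frame hs (by decide) (by decide)
    have e14 : τ.int 14 = σ.int 14 := (hs.1 14 (by decide)).trans (hs1.1 14 (by decide))
    obtain ⟨eU, eV⟩ := hIτ.slots.edge ⟨i, hi⟩
    simp only at eU eV
    simp only [runs_block_cons, runs_block_nil, runs_setInt, IExpr.eval, putInt_int, hiv, eU, eV, e14,
      Nat.reduceEqDiff, if_true, if_false]
    refine ⟨by norm_num, fun e he => ?_⟩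
    rcases fin_lt_succ_cases hi he with h' | rfl
    · have : ((e : ℕ) : ℤ) ≠ i := by omega
      simpa only [Function.update_apply, if_neg this] using h e h'
    · simp
  · rintro t σ' ⟨ht, hs, h⟩
    simp only [runs_block_nil]
    refine ⟨by omega, ?_, fun e => h e e.2⟩
    rw [hs.1 45 (by decide)]
    simp [hσ1]

theorem runs_contract (hI : Inst S σ) (hT : Threads S rep σ) :
    Runs contract σ fun t σ' => t ≤ 230 * (m + p + 1) + 50 ∧
      SameOff contract.ints contract.reals σ σ' ∧
      ∃ (N : ℕ) (lab : Fin n → Fin N), Contraction S rep lab σ' := by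
  suffices hS : Runs contract σ fun t σ' => t ≤ 230 * (m + p + 1) + 50 ∧
      ∃ (N : ℕ) (lab : Fin n → Fin N), Contraction S rep lab σ' from
    hS.sameOff.mono fun t σ' h => ⟨h.1.1, h.2, h.1.2⟩
  rw [contract, runs_block_cons]
  refine (runs_flagContracted hI hT).mono ?_
  rintro t1 σ1 ⟨ht1, hs1, h1, h1'⟩
  have hI1 := hI.frame hs1 (by decide) (by decide)
  rw [runs_block_cons]
  refine (runs_labelSlots (B := Steiner.contracted S rep) (φ := fun j => σ1.int 54 j) hI1.len
    hI1.slots (fun τ j hj h31 hs => ?_) h1 (fun a => ?_)).mono ?_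
  · have := hs.1 54 (by decide)
    simp [h31, this]
  · have := h1' a
    push_cast at this
    exact iff_of_true this (.inl (S.mem_Q a))
  rintro t2 σ2 ⟨ht2, hs2, N, hN, hlt, heq, hsurj⟩
  have hI2 := hI1.frame hs2 (by decide) (by decide)
  simp only [← Steiner.cov_iff] at hlt heq hsurj
  rw [runs_block_cons]
  refine (runs_storeContraction hI2).mono ?_
  rintro t3 σ3 ⟨ht3, h45, hends⟩
  simp only [runs_block_nil]
  refine ⟨by omega, N, ?_⟩
  have hr := hlt _ (Steiner.cov_r₀ (S := S))
  have key : ∀ v : Fin n, ∃ c : Fin N, S.Cov v → σ2.int 14 (v : ℕ) = (c : ℕ) := by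
    intro v
    by_cases hv : S.Cov v
    · obtain ⟨h1, h2⟩ := hlt v hv
      exact ⟨⟨(σ2.int 14 (v : ℕ)).toNat, by omega⟩, fun _ => by simp [h1]⟩
    · exact ⟨⟨0, by omega⟩, fun h => absurd h hv⟩
  choose lab hlab using key
  refine ⟨lab, ⟨fun x y hx hy => ?_, fun c => ?_⟩, by rw [h45, hN], fun e => ?_⟩
  · rw [← heq x y hx hy, hlab x hx, hlab y hy, Fin.ext_iff, Nat.cast_inj]
  · obtain ⟨x, hx, hc⟩ := hsurj c c.2
    refine ⟨x, hx, Fin.ext ?_⟩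
    rw [hlab x hx] at hc
    exact_mod_cast hc
  · rw [(hends e).1, (hends e).2, hlab _ (S.conn _), hlab _ (Steiner.cov_t _)]
    exact ⟨rfl, rfl⟩

/-! ### Codes of the vertices -/

/-- The code of a vertex is the index of its bit: a number in the case of a branch vertex, -2 for
a leaf, and -1 for a vertex that is touched or thin. -/
def codeVertex (x : IExpr) : Prog :=
  .ifte (.intLE (.get 46 x) (.const (-3)))
    (.ifte (.intLE (.const 1) (.get 39 x)) (.setInt 46 x (.const (-1)))
      (.ifte (.intLE (.get 38 x) (.const 1)) (.setInt 46 x (.const (-2)))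
        (.ifte (.intLE (.get 38 x) (.const 2)) (.setInt 46 x (.const (-1)))
          (block [
            .setInt 46 x (reg 47),
            .setInt 48 (reg 47) (.const 0),
            .setInt 47 (.const 0) (.add (reg 47) (.const 1))]))))
    .skip

/-- The bits that represent the number `x`, and the constant bits of the vertices without choice. -/
structure Bits (k x : ℕ) (σ : State) : Prop where
  bit : ∀ i < k, σ.int 48 (i : ℕ) = if x.testBit i then 1 else 0
  free : σ.int 48 (-1) = 1
  leaf : σ.int 48 (-2) = 0

/-- The vertices in `A` have their codes; `k` is the number of branch vertices among them. -/
structure Codes (S : Steiner (Fin n) (Fin m) (Fin p)) (A : Set (Fin n)) (k : ℕ) (σ : State) :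
    Prop where
  num : σ.int 47 0 = k
  code : ∀ v ∈ A, σ.int 46 (v : ℕ) = -1 ∧ (S.Touched v ∨ S.deg v = 2) ∨
    σ.int 46 (v : ℕ) = -2 ∧ ¬ S.Touched v ∧ S.deg v ≤ 1 ∨
    0 ≤ σ.int 46 (v : ℕ) ∧ ¬ S.Touched v ∧ 3 ≤ S.deg v
  fresh : ∀ v ∉ A, ∀ e, S.Inc v e → σ.int 46 (v : ℕ) = -3
  lt : ∀ v ∈ A, σ.int 46 (v : ℕ) < k
  inj : ∀ v ∈ A, ∀ v' ∈ A, 0 ≤ σ.int 46 (v : ℕ) → σ.int 46 (v : ℕ) = σ.int 46 (v' : ℕ) → v = v'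
  surj : ∀ i : ℕ, i < k → ∃ v ∈ A, σ.int 46 (v : ℕ) = i

theorem Codes.frame {A : Set (Fin n)} (h : Codes S A k σ) {li lr : List ℕ} (hs : SameOff li lr σ σ')
    (hi : ∀ a ∈ [46, 47], a ∉ li) : Codes S A k σ' := by
  have e46 := hs.1 46 (hi 46 (by decide))
  have e47 := hs.1 47 (hi 47 (by decide))
  exact ⟨by rw [e47, h.num], by rw [e46]; exact h.code, by rw [e46]; exact h.fresh,
    by rw [e46]; exact h.lt, by rw [e46]; exact h.inj, by rw [e46]; exact h.surj⟩

theorem Bits.frame {x : ℕ} (h : Bits k x σ) {li lr : List ℕ} (hs : SameOff li lr σ σ')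
    (hi : 48 ∉ li) : Bits k x σ' := by
  have e48 := hs.1 48 hi
  exact ⟨by rw [e48]; exact h.bit, by rw [e48, h.free], by rw [e48, h.leaf]⟩

theorem Codes.insert_special {A : Set (Fin n)} (h : Codes S A k σ) {v : Fin n} (hv : v ∉ A) {c : ℤ}
    (hc : c = -1 ∧ (S.Touched v ∨ S.deg v = 2) ∨ c = -2 ∧ ¬ S.Touched v ∧ S.deg v ≤ 1) :
    Codes S (insert v A) k (σ.putInt 46 (v : ℕ) c) := by
  have hself : (σ.putInt 46 (v : ℕ) c).int 46 (v : ℕ) = c := by simp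
  have hoff : ∀ w, w ≠ v → (σ.putInt 46 (v : ℕ) c).int 46 (w : ℕ) = σ.int 46 (w : ℕ) := by
    intro w hw
    have : ((w : ℕ) : ℤ) ≠ (v : ℕ) := fun h => hw (Fin.ext (by exact_mod_cast h))
    simp [this]
  have hne : ∀ w ∈ A, w ≠ v := fun w hw h => hv (h ▸ hw)
  have hc0 : c < 0 := by omega
  refine ⟨by simpa using h.num, ?_, ?_, ?_, ?_, ?_⟩
  · rintro w (rfl | hw)
    · rw [hself]; tauto
    · rw [hoff w (hne w hw)]; exact h.code w hw
  · intro w hw e he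
    rw [Set.mem_insert_iff, not_or] at hw
    rw [hoff w hw.1]; exact h.fresh w hw.2 e he
  · rintro w (rfl | hw)
    · rw [hself]; omega
    · rw [hoff w (hne w hw)]; exact h.lt w hw
  · rintro w (rfl | hw) w' (rfl | hw') h1 h2
    · rfl
    · rw [hself] at h1; omega
    · rw [h2, hself] at h1; omega
    · rw [hoff w (hne w hw)] at h1 h2
      rw [hoff w' (hne w' hw')] at h2
      exact h.inj w hw w' hw' h1 h2
  · intro i hi
    obtain ⟨w, hw, h1⟩ := h.surj i hi
    exact ⟨w, .inr hw, by rw [hoff w (hne w hw), h1]⟩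

theorem Codes.insert_branch {A : Set (Fin n)} (h : Codes S A k σ) {v : Fin n} (hv : v ∉ A)
    (hc : ¬ S.Touched v ∧ 3 ≤ S.deg v) (h46 : σ'.int 46 = Function.update (σ.int 46) (v : ℕ) k)
    (h47 : σ'.int 47 0 = k + 1) : Codes S (insert v A) (k + 1) σ' := by
  have hself : σ'.int 46 (v : ℕ) = k := by simp [h46]
  have hoff : ∀ w, w ≠ v → σ'.int 46 (w : ℕ) = σ.int 46 (w : ℕ) := by
    intro w hw
    have : ((w : ℕ) : ℤ) ≠ (v : ℕ) := fun h => hw (Fin.ext (by exact_mod_cast h))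
    simp [h46, this]
  have hne : ∀ w ∈ A, w ≠ v := fun w hw h => hv (h ▸ hw)
  refine ⟨by simpa using h47, ?_, ?_, ?_, ?_, ?_⟩
  · rintro w (rfl | hw)
    · rw [hself]; exact .inr (.inr ⟨by positivity, hc⟩)
    · rw [hoff w (hne w hw)]; exact h.code w hw
  · intro w hw e he
    rw [Set.mem_insert_iff, not_or] at hw
    rw [hoff w hw.1]; exact h.fresh w hw.2 e he
  · rintro w (rfl | hw)
    · rw [hself]; push_cast; omega
    · rw [hoff w (hne w hw)]; have := h.lt w hw; push_cast; omega
  · rintro w (rfl | hw) w' (rfl | hw') h1 h2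
    · rfl
    · rw [hself, hoff w' (hne w' hw')] at h2; have := h.lt w' hw'; omega
    · rw [hself, hoff w (hne w hw)] at h2; have := h.lt w hw; omega
    · rw [hoff w (hne w hw)] at h1 h2
      rw [hoff w' (hne w' hw')] at h2
      exact h.inj w hw w' hw' h1 h2
  · intro i hi
    rcases Nat.lt_succ_iff_lt_or_eq.1 hi with hi | rfl
    · obtain ⟨w, hw, h1⟩ := h.surj i hi
      exact ⟨w, .inr hw, by rw [hoff w (hne w hw), h1]⟩
    · exact ⟨v, .inl rfl, hself⟩

theorem runs_codeVertex {A : Set (Fin n)} (hd : Degrees S σ) (hc : Codes S A k σ) (hb : Bits k 0 σ)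
    {x : IExpr} {v : Fin n} (hx : x.eval σ = (v : ℕ)) {e : Fin m} (hv : S.Inc v e) :
    Runs (codeVertex x) σ fun t σ' => t ≤ 8 ∧ ∃ k, Codes S (insert v A) k σ' ∧ Bits k 0 σ' := by
  have hdeg := hd.deg v e hv
  have htou := hd.touched v e hv
  simp only [codeVertex, runs_ifte, Test.holds, runs_skip, runs_block_cons, runs_block_nil, runs_setInt,
    IExpr.eval, hx]
  have hmem : v ∈ A → ¬ σ.int 46 (v : ℕ) ≤ -3 := by
    intro h
    rcases hc.code v h with h | h | h <;> omega
  have hsp : ∀ c, SameOff [46] [] σ (σ.putInt 46 (v : ℕ) c) := fun c =>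
    ⟨fun a ha => by rw [putInt_int, if_neg (by simpa using ha)], fun _ _ => rfl⟩
  refine ⟨fun h3 => ?_, fun h3 => ?_⟩
  · have hA : v ∉ A := fun h => hmem h h3
    refine ⟨fun h => ?_, fun h => ⟨fun h' => ?_, fun h' => ⟨fun h'' => ?_, fun h'' => ?_⟩⟩⟩
    · exact ⟨by norm_num, k, hc.insert_special hA (.inl ⟨rfl, .inl (htou.1 h)⟩),
        hb.frame (hsp _) (by decide)⟩
    · have hn := mt htou.2 h
      rw [hdeg hn] at h'
      exact ⟨by norm_num, k, hc.insert_special hA (.inr ⟨rfl, hn, by omega⟩),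
        hb.frame (hsp _) (by decide)⟩
    · have hn := mt htou.2 h
      rw [hdeg hn] at h' h''
      exact ⟨by norm_num, k, hc.insert_special hA (.inl ⟨rfl, .inr (by omega)⟩),
        hb.frame (hsp _) (by decide)⟩
    · have hn := mt htou.2 h
      rw [hdeg hn] at h''
      refine ⟨by norm_num, k + 1, hc.insert_branch hA ⟨hn, by omega⟩ ?_ ?_, ?_, ?_, ?_⟩
      · simp [hc.num]
      · simp [hc.num]
      · intro i hi
        rcases Nat.lt_succ_iff_lt_or_eq.1 hi with hi | rfl
        · simpa [hc.num, Function.update_apply, hi.ne] using hb.bit i hi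
        · simp [hc.num]
      · have : (-1 : ℤ) ≠ k := by omega
        simpa [hc.num, Function.update_apply, this] using hb.free
      · have : (-2 : ℤ) ≠ k := by omega
        simpa [hc.num, Function.update_apply, this] using hb.leaf
  · have hA : v ∈ A := by
      by_contra hA
      exact h3 (hc.fresh v hA e hv).le
    rw [Set.insert_eq_of_mem hA]
    exact ⟨by norm_num, k, hc, hb⟩

/-- Mark all vertices with edges as having no code (-3), and set the constant bits. -/
def clearCodes : Prog := block [
  forLoop 31 0 1 (block [
    .setInt 46 (elt 34) (.const (-3)),
    .setInt 46 (elt 35) (.const (-3))]),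
  .setInt 47 (.const 0) (.const 0),
  .setInt 48 (.const (-1)) (.const 1),
  .setInt 48 (.const (-2)) (.const 0)]

/-- Compute the codes of all vertices with edges (array 46) and the number of branch vertices (`47[0]`);
all their bits (array 48) are cleared. -/
def computeCodes : Prog := block [
  clearCodes,
  forLoop 31 0 1 (.seq (codeVertex (elt 34)) (codeVertex (elt 35)))]

theorem runs_clearCodes (hI : Inst S σ) : Runs clearCodes σ fun t σ' => t ≤ 5 * m + 7 ∧
    SameOff clearCodes.ints clearCodes.reals σ σ' ∧ Codes S ∅ 0 σ' ∧ Bits 0 0 σ' := by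
  suffices hS : Runs clearCodes σ fun t σ' => t ≤ 5 * m + 7 ∧ Codes S ∅ 0 σ' ∧ Bits 0 0 σ' from
    hS.sameOff.mono fun t σ' h => ⟨h.1.1, h.2, h.1.2⟩
  rw [clearCodes, runs_block_cons]
  refine (runs_forLoop m 3 (fun i τ => ∀ (v : Fin n) (e : Fin m), (e : ℕ) < i → S.Inc v e →
    τ.int 46 (v : ℕ) = -3) hI.num (by decide) (by decide) (by simp) ?_).mono ?_
  · intro i hi τ hs hiv hI'
    have hI := hI.frame hs (by decide) (by decide)
    obtain ⟨eU, eV⟩ := hI.slots.edge ⟨i, hi⟩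
    simp only at eU eV
    simp only [runs_block_cons, runs_block_nil, runs_setInt, IExpr.eval, putInt_int, hiv, eU, eV,
      Nat.reduceEqDiff, if_true, if_false]
    refine ⟨by norm_num, fun v e he hv => ?_⟩
    simp only [Function.update_apply, Nat.cast_inj, ← Fin.ext_iff]
    rcases fin_lt_succ_cases hi he with h | rfl
    · simp [hI' v e h hv]
    · rcases hv with rfl | rfl <;> simp
  · rintro t σ' ⟨ht, hs, h⟩
    simp only [runs_block_cons, runs_block_nil, runs_setInt, IExpr.eval]
    refine ⟨by omega, ⟨?_, ?_, ?_, ?_, ?_, ?_⟩, ?_, ?_, ?_⟩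
    · simp
    · simp
    · intro v _ e he
      simpa using h v e e.2 he
    all_goals simp

theorem runs_computeCodes (hI : Inst S σ) (hd : Degrees S σ) :
    Runs computeCodes σ fun t σ' => t ≤ 24 * m + 12 ∧
      SameOff computeCodes.ints computeCodes.reals σ σ' ∧
      ∃ k, Codes S {v | ∃ e, S.Inc v e} k σ' ∧ Bits k 0 σ' := by
  suffices hS : Runs computeCodes σ fun t σ' => t ≤ 24 * m + 12 ∧
      ∃ k, Codes S {v | ∃ e, S.Inc v e} k σ' ∧ Bits k 0 σ' from
    hS.sameOff.mono fun t σ' h => ⟨h.1.1, h.2, h.1.2⟩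
  rw [computeCodes, runs_block_cons]
  refine (runs_clearCodes hI).mono ?_
  rintro t1 σ1 ⟨ht1, hs1, hc1, hb1⟩
  have hI1 := hI.frame hs1 (by decide) (by decide)
  have hd1 := hd.frame hs1 (by decide)
  rw [runs_block_cons]
  have put31 : ∀ (τ : State) (x : ℤ), SameOff [31] [] τ (τ.putInt 31 0 x) := fun τ x =>
    ⟨fun a ha => by rw [putInt_int, if_neg (by simpa using ha)], fun _ _ => rfl⟩
  refine (runs_forLoop m 16 (fun i τ => ∃ k, Codes S {v | ∃ e : Fin m, (e : ℕ) < i ∧ S.Inc v e} k τ ∧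
    Bits k 0 τ) hI1.num (by decide) (by decide) ?_ ?_).mono ?_
  · refine ⟨0, ?_, hb1.frame (put31 _ _) (by decide)⟩
    simpa using hc1.frame (put31 _ 0) (by decide)
  · rintro i hi τ hs hiv ⟨k, hc, hb⟩
    have hIτ := hI1.frame hs (by decide) (by decide)
    have hdτ := hd1.frame hs (by decide)
    rw [runs_seq]
    refine (runs_codeVertex hdτ hc hb (v := S.s (.inl ⟨i, hi⟩)) (e := ⟨i, hi⟩) ?_
      (.inl rfl)).sameOff.mono ?_
    · simpa [hiv] using (hIτ.slots.edge ⟨i, hi⟩).1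
    rintro t2 σ2 ⟨⟨ht2, k2, hc2, hb2⟩, hs2⟩
    have hI2 := hIτ.frame hs2 (by decide) (by decide)
    have hd2 := hdτ.frame hs2 (by decide)
    refine (runs_codeVertex hd2 hc2 hb2 (v := S.t (.inl ⟨i, hi⟩)) (e := ⟨i, hi⟩) ?_
      (.inr rfl)).mono ?_
    · simpa [hs2.1 31 (by decide), hiv] using (hI2.slots.edge ⟨i, hi⟩).2
    rintro t3 σ3 ⟨ht3, k3, hc3, hb3⟩
    refine ⟨by omega, k3, ?_, hb3.frame (put31 _ _) (by decide)⟩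
    have hset : {v | ∃ e : Fin m, (e : ℕ) < i + 1 ∧ S.Inc v e} =
        insert (S.t (.inl ⟨i, hi⟩)) (insert (S.s (.inl ⟨i, hi⟩))
          {v | ∃ e : Fin m, (e : ℕ) < i ∧ S.Inc v e}) := by
      ext v
      simp only [Set.mem_ofPred_eq, Set.mem_insert_iff]
      constructor
      · rintro ⟨e, he, hv⟩
        rcases fin_lt_succ_cases hi he with h | rfl
        · exact .inr (.inr ⟨e, h, hv⟩)
        · rcases hv with rfl | rfl
          · exact .inr (.inl rfl)
          · exact .inl rfl
      · rintro (rfl | rfl | ⟨e, he, hv⟩)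
        · exact ⟨⟨i, hi⟩, by simp, .inr rfl⟩
        · exact ⟨⟨i, hi⟩, by simp, .inl rfl⟩
        · exact ⟨e, by omega, hv⟩
    rw [hset]
    exact hc3.frame (put31 _ _) (by decide)
  · rintro t σ' ⟨ht, hs, k, hc, hb⟩
    simp only [runs_block_nil]
    refine ⟨by omega, k, ?_, hb⟩
    have : {v | ∃ e : Fin m, (e : ℕ) < m ∧ S.Inc v e} = {v | ∃ e, S.Inc v e} := by
      ext v; simp
    rwa [this] at hc

end

section

open scoped Classical

variable {n m p N k x : ℕ} {S : Steiner (Fin n) (Fin m) (Fin p)} {σ σ' : State} {rep : Fin m → Fin m}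
  {lab : Fin n → Fin N} {code : Fin n → ℤ}

/-! ### The choices of the excluded vertices -/

/-- A cost that exceeds the costs of all purchases. -/
def Steiner.big (S : Steiner (Fin n) (Fin m) (Fin p)) : ℝ := ∑ e, (S.c e + S.c e)

theorem Steiner.big_pos (e : Fin m) : 0 < S.big :=
  sum_pos (fun e _ => add_pos (S.c_pos e) (S.c_pos e)) ⟨e, mem_univ e⟩

/-- The leaves, and the branch vertices with bit 0 in the number `x`. -/
noncomputable def excluded (S : Steiner (Fin n) (Fin m) (Fin p)) (code : Fin n → ℤ) (x : ℕ) :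
    Finset (Fin n) :=
  {v | (∃ e, S.Inc v e) ∧ (code v = -2 ∨ 0 ≤ code v ∧ x.testBit (code v).toNat = false)}

/-- The number of excluded branch vertices. -/
def zeros (k x : ℕ) : ℕ := #{i ∈ range k | x.testBit i = false}

/-- The contracted graph for the choice `x`. -/
noncomputable def choiceGraph (S : Steiner (Fin n) (Fin m) (Fin p)) (rep : Fin m → Fin m)
    (lab : Fin n → Fin N) (code : Fin n → ℤ) (x : ℕ) : WeightedGraph :=
  S.graph rep lab (excluded S code x) S.big fun e => S.big_pos e

/-- The value of a tree for the choice `x`: there has to be one dead thread for each excluded vertex,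
and these are free of charge. -/
noncomputable def value (S : Steiner (Fin n) (Fin m) (Fin p)) (rep : Fin m → Fin m)
    (code : Fin n → ℤ) (k x : ℕ) (T : Finset (Fin m)) : ℝ :=
  ∑ e ∈ T, Steiner.weight S rep (excluded S code x) S.big e - zeros k x * S.big

/-- All that the main loop is given and does not change. -/
structure Setup (S : Steiner (Fin n) (Fin m) (Fin p)) (rep : Fin m → Fin m) (lab : Fin n → Fin N)
    (code : Fin n → ℤ) (k : ℕ) (σ : State) : Prop where
  inst : Inst S σ
  threads : Threads S rep σ
  contraction : Contraction S rep lab σ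
  codes : Codes S {v | ∃ e, S.Inc v e} k σ
  code_eq : ∀ v : Fin n, σ.int 46 (v : ℕ) = code v

theorem Setup.frame (h : Setup S rep lab code k σ) {li lr : List ℕ} (hs : SameOff li lr σ σ')
    (hi : ∀ a ∈ [0, 34, 35, 36, 37, 41, 42, 43, 44, 45, 46, 47], a ∉ li)
    (hr : ∀ a ∈ [0, 10, 11], a ∉ lr) : Setup S rep lab code k σ' := by
  refine ⟨h.inst.frame hs (fun a ha => hi a ?_) (hr 0 (by decide)),
    h.threads.frame hs (fun a ha => hi a ?_) (fun a ha => hr a ?_),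
    h.contraction.frame hs (fun a ha => hi a ?_), h.codes.frame hs (fun a ha => hi a ?_), ?_⟩
  any_goals simp only [List.mem_cons, List.not_mem_nil, or_false] at ha ⊢; omega
  rw [hs.1 46 (hi 46 (by decide))]
  exact h.code_eq

theorem Setup.code_cases (h : Setup S rep lab code k σ) {v : Fin n} {e : Fin m} (hv : S.Inc v e) :
    code v = -1 ∧ (S.Touched v ∨ S.deg v = 2) ∨ code v = -2 ∧ ¬ S.Touched v ∧ S.deg v ≤ 1 ∨
      0 ≤ code v ∧ code v < k ∧ ¬ S.Touched v ∧ 3 ≤ S.deg v := by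
  have h1 := h.codes.code v ⟨e, hv⟩
  have h2 := h.codes.lt v ⟨e, hv⟩
  rw [h.code_eq] at h1 h2
  tauto

theorem Setup.bit_iff (h : Setup S rep lab code k σ) (hb : Bits k x σ) {v : Fin n} {e : Fin m}
    (hv : S.Inc v e) : σ.int 48 (σ.int 46 (v : ℕ)) ≤ 0 ↔ v ∈ excluded S code x := by
  have hmem : v ∈ excluded S code x ↔
      (code v = -2 ∨ 0 ≤ code v ∧ x.testBit (code v).toNat = false) := by
    simp only [excluded, mem_filter, mem_univ, true_and]
    exact and_iff_right ⟨e, hv⟩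
  rw [hmem, h.code_eq]
  rcases h.code_cases hv with ⟨h1, -⟩ | ⟨h1, -⟩ | ⟨h1, h2, -⟩
  · simp [h1, hb.free]
  · simp [h1, hb.leaf]
  · have hb' := hb.bit (code v).toNat (by omega)
    rw [Int.toNat_of_nonneg h1] at hb'
    rw [hb']
    have : code v ≠ -2 := by omega
    cases x.testBit (code v).toNat <;> simp [h1, this]

/-- The number of branch vertices is `k`. -/
theorem Setup.card_branch (h : Setup S rep lab code k σ) :
    #{v : Fin n | (∃ e, S.Inc v e) ∧ ¬ S.Touched v ∧ 3 ≤ S.deg v} = k := by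
  conv_rhs => rw [← card_range k]
  refine card_bij (fun v _ => (code v).toNat) ?_ ?_ ?_
  · intro v hv
    simp only [mem_filter, mem_univ, true_and] at hv
    obtain ⟨⟨e, he⟩, h1, h2⟩ := hv
    rw [mem_range]
    rcases h.code_cases he with h3 | h3 | h3
    · rcases h3.2 with h4 | h4
      · exact absurd h4 h1
      · omega
    · omega
    · omega
  · intro v hv w hw hvw
    simp only [mem_filter, mem_univ, true_and] at hv hw
    obtain ⟨⟨e, he⟩, h1, h2⟩ := hv
    obtain ⟨⟨f, hf⟩, h1', h2'⟩ := hw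
    have h3 : 0 ≤ code v := by
      rcases h.code_cases he with h3 | h3 | h3
      · rcases h3.2 with h4 | h4
        · exact absurd h4 h1
        · omega
      · omega
      · omega
    have h4 : 0 ≤ code w := by
      rcases h.code_cases hf with h3 | h3 | h3
      · rcases h3.2 with h4 | h4
        · exact absurd h4 h1'
        · omega
      · omega
      · omega
    refine h.codes.inj v ⟨e, he⟩ w ⟨f, hf⟩ ?_ ?_ <;> rw [h.code_eq]
    · exact h3
    · rw [h.code_eq]; omega
  · intro i hi
    obtain ⟨v, ⟨e, he⟩, hv⟩ := h.codes.surj i (mem_range.1 hi)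
    rw [h.code_eq] at hv
    refine ⟨v, ?_, by omega⟩
    simp only [mem_filter, mem_univ, true_and]
    refine ⟨⟨e, he⟩, ?_⟩
    rcases h.code_cases he with h3 | h3 | h3
    · omega
    · omega
    · exact h3.2.2

theorem Setup.le_two_mul (h : Setup S rep lab code k σ) : k ≤ 2 * m := by
  have hsub : ({v : Fin n | (∃ e, S.Inc v e) ∧ ¬ S.Touched v ∧ 3 ≤ S.deg v} : Finset (Fin n)) ⊆
      univ.image (fun e : Fin m => S.s (.inl e)) ∪ univ.image fun e : Fin m => S.t (.inl e) := by
    intro v hv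
    simp only [mem_filter, mem_univ, true_and] at hv
    obtain ⟨⟨e, rfl | rfl⟩, -⟩ := hv
    · exact mem_union_left _ (mem_image_of_mem _ (mem_univ e))
    · exact mem_union_right _ (mem_image_of_mem (fun e : Fin m => S.t (.inl e)) (mem_univ e))
  have h1 := (card_le_card hsub).trans (card_union_le _ _)
  have h2 := card_image_le (s := univ) (f := fun e : Fin m => S.s (.inl e))
  have h3 := card_image_le (s := univ) (f := fun e : Fin m => S.t (.inl e))
  rw [card_univ, Fintype.card_fin] at h2 h3
  rw [h.card_branch] at h1
  omega

theorem Setup.card_excluded (h : Setup S rep lab code k σ) (x : ℕ) : #(excluded S code x) =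
    #{v : Fin n | (∃ e, S.Inc v e) ∧ code v = -2} + zeros k x := by
  have hsplit : excluded S code x = ({v : Fin n | (∃ e, S.Inc v e) ∧ code v = -2} : Finset (Fin n)) ∪
      ({v : Fin n | (∃ e, S.Inc v e) ∧ 0 ≤ code v ∧ x.testBit (code v).toNat = false} :
        Finset (Fin n)) := by
    ext v
    simp only [excluded, mem_union, mem_filter, mem_univ, true_and]
    tauto
  rw [hsplit, card_union_of_disjoint]
  · congr 1
    refine card_bij (fun v _ => (code v).toNat) ?_ ?_ ?_
    · intro v hv
      simp only [mem_filter, mem_univ, true_and] at hv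
      obtain ⟨⟨e, he⟩, h1, h2⟩ := hv
      rw [mem_filter, mem_range]
      refine ⟨?_, h2⟩
      rcases h.code_cases he with h3 | h3 | h3 <;> omega
    · intro v hv w hw hvw
      simp only [mem_filter, mem_univ, true_and] at hv hw
      refine h.codes.inj v hv.1 w hw.1 ?_ ?_ <;> rw [h.code_eq]
      · exact hv.2.1
      · rw [h.code_eq]; omega
    · intro i hi
      rw [mem_filter, mem_range] at hi
      obtain ⟨v, hv, h1⟩ := h.codes.surj i hi.1
      rw [h.code_eq] at h1
      refine ⟨v, ?_, by omega⟩
      simp only [mem_filter, mem_univ, true_and]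
      refine ⟨hv, by omega, ?_⟩
      rw [h1, Int.toNat_natCast]
      exact hi.2
  · rw [disjoint_left]
    intro v h1 h2
    simp only [mem_filter, mem_univ, true_and] at h1 h2
    omega

/-- Every set of edges is the purchase for some choice: exclude the branch vertices that it misses. -/
theorem Setup.exists_choice (h : Setup S rep lab code k σ) (D : Finset (Fin m)) :
    ∃ x : Fin (2 ^ k), ∀ v, v ∈ excluded S code x ↔ (∃ e, S.Inc v e) ∧ ¬ S.Touched v ∧
      S.deg v ≠ 2 ∧ (3 ≤ S.deg v → ∀ e ∈ D, ¬ S.Inc v e) := by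
  set bit : Fin k → Bool := fun i =>
    decide (∃ v, (∃ e, S.Inc v e) ∧ code v = (i : ℕ) ∧ ∃ e ∈ D, S.Inc v e) with hbit
  refine ⟨⟨Nat.ofBits bit, Nat.ofBits_lt_two_pow _⟩, fun v => ?_⟩
  simp only [excluded, mem_filter, mem_univ, true_and]
  refine and_congr_right ?_
  rintro ⟨e, he⟩
  rcases h.code_cases he with ⟨h1, h2⟩ | ⟨h1, h2, h3⟩ | ⟨h1, h2, h3, h4⟩
  · rw [h1]
    refine iff_of_false (by omega) ?_
    rintro ⟨h3, h4, -⟩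
    tauto
  · refine iff_of_true (.inl h1) ⟨h2, by omega, fun h => by omega⟩
  · have hne : code v ≠ -2 := by omega
    have hlt : (code v).toNat < k := by omega
    rw [Nat.testBit_ofBits_lt _ _ hlt, hbit]
    simp only [hne, h1, h3, true_and, false_or, decide_eq_false_iff_not, not_false_eq_true, h4,
      forall_true_left]
    rw [and_iff_right (by omega)]
    simp only [not_exists, not_and]
    constructor
    · intro h5 e' he'
      exact h5 v ⟨e, he⟩ (by omega) e' he'
    · intro h5 w ⟨e', hw⟩ hcw
      have : v = w := by
        refine h.codes.inj v ⟨e, he⟩ w ⟨e', hw⟩ ?_ ?_ <;> rw [h.code_eq]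
        · exact h1
        · rw [h.code_eq, hcw]; omega
      exact this ▸ h5

/-! ### One choice -/

/-- Flags for the dead threads (array 49). -/
def markDead : Prog := block [
  forLoop 31 0 1 (.setInt 49 (elt 41) (.const 0)),
  forLoop 31 0 1 (.ifte (.neg (.conj (.neg (.intLE (.get 48 (.get 46 (elt 34))) (.const 0)))
      (.neg (.intLE (.get 48 (.get 46 (elt 35))) (.const 0)))))
    (.setInt 49 (elt 41) (.const 1)) .skip)]

theorem runs_markDead (h : Setup S rep lab code k σ) (hb : Bits k x σ) :
    Runs markDead σ fun t σ' => t ≤ 7 * m + 5 ∧ SameOff markDead.ints markDead.reals σ σ' ∧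
      ∀ e : Fin m, 1 ≤ σ'.int 49 (σ.int 41 (e : ℕ)) ↔ Steiner.Dead S (excluded S code x) e := by
  suffices hS : Runs markDead σ fun t σ' => t ≤ 7 * m + 5 ∧
      ∀ e : Fin m, 1 ≤ σ'.int 49 (σ.int 41 (e : ℕ)) ↔ Steiner.Dead S (excluded S code x) e from
    hS.sameOff.mono fun t σ' h => ⟨h.1.1, h.2, h.1.2⟩
  rw [markDead, runs_block_cons]
  refine (runs_forLoop m 1 (fun i τ => ∀ e : Fin m, (e : ℕ) < i →
    τ.int 49 (σ.int 41 (e : ℕ)) = 0) h.inst.num (by decide) (by decide) (by simp) ?_).mono ?_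
  · intro i hi τ hs hiv hI
    have e41 := hs.1 41 (by decide)
    simp only [runs_setInt, IExpr.eval, putInt_int, hiv, e41, Nat.reduceEqDiff, if_true, if_false]
    refine ⟨le_refl _, fun e he => ?_⟩
    rcases fin_lt_succ_cases hi he with h' | rfl
    · simp [Function.update_apply, hI e h']
    · simp
  rintro t1 σ1 ⟨ht1, hs1, h1⟩
  have hS1 := h.frame hs1 (by decide) (by decide)
  have hb1 := hb.frame hs1 (by decide)
  have e41 : σ1.int 41 = σ.int 41 := hs1.1 41 (by decide)
  rw [runs_block_cons]
  refine (runs_forLoop m 2 (fun i τ => ∀ e : Fin m, 1 ≤ τ.int 49 (σ.int 41 (e : ℕ)) ↔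
    ∃ e' : Fin m, (e' : ℕ) < i ∧ rep e' = rep e ∧ ∃ v ∈ excluded S code x, S.Inc v e')
    hS1.inst.num (by decide) (by decide) ?_ ?_).mono ?_
  · intro e
    simp [h1 e e.2]
  · intro i hi τ hs hiv hI
    have hSτ := hS1.frame hs (by decide) (by decide)
    have hbτ := hb1.frame hs (by decide)
    obtain ⟨eU, eV⟩ := hSτ.inst.slots.edge ⟨i, hi⟩
    have b1 := hSτ.bit_iff hbτ (v := S.s (.inl ⟨i, hi⟩)) (e := ⟨i, hi⟩) (.inl rfl)
    have b2 := hSτ.bit_iff hbτ (v := S.t (.inl ⟨i, hi⟩)) (e := ⟨i, hi⟩) (.inr rfl)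
    have eτ : τ.int 41 = σ.int 41 := (hs.1 41 (by decide)).trans e41
    simp only at eU eV
    simp only [runs_ifte, Test.holds, runs_skip, runs_setInt, IExpr.eval, putInt_int, hiv, eU, eV, eτ,
      b1, b2, Nat.reduceEqDiff, if_true, if_false]
    constructor
    · intro hc
      refine ⟨by norm_num, fun e => ?_⟩
      have hinc : ∃ v ∈ excluded S code x, S.Inc v ⟨i, hi⟩ := by
        by_contra hcon
        push Not at hcon
        exact hc ⟨fun h => hcon _ h (.inl rfl), fun h => hcon _ h (.inr rfl)⟩
      have hcls := h.threads.cls e ⟨i, hi⟩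
      simp only at hcls
      simp only [Function.update_apply, hcls]
      by_cases he : rep e = rep ⟨i, hi⟩
      · simp only [he, if_true, le_refl, true_iff]
        exact ⟨⟨i, hi⟩, by simp, rfl, hinc⟩
      · simp only [he, if_false, hI e]
        constructor
        · rintro ⟨e', h1, h2⟩
          exact ⟨e', by omega, h2⟩
        · rintro ⟨e', h1, h2, h3⟩
          rcases fin_lt_succ_cases hi h1 with h' | rfl
          · exact ⟨e', h', h2, h3⟩
          · exact absurd h2.symm he
    · intro hc
      refine ⟨by norm_num, fun e => ?_⟩
      rw [hI e]
      constructor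
      · rintro ⟨e', h1, h2⟩
        exact ⟨e', by omega, h2⟩
      · rintro ⟨e', h1, h2, v, h3, h4⟩
        rcases fin_lt_succ_cases hi h1 with h' | rfl
        · exact ⟨e', h', h2, v, h3, h4⟩
        · refine absurd (fun hcc => ?_) hc
          rcases h4 with rfl | rfl
          · exact hcc.1 h3
          · exact hcc.2 h3
  · rintro t σ' ⟨ht, hs, h2⟩
    simp only [runs_block_nil]
    refine ⟨by omega, fun e => (h2 e).trans ?_⟩
    unfold Steiner.Dead
    simp only [Fin.is_lt, true_and, ← h.threads.isRep.eq_iff]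
    exact exists_congr fun e' => and_congr_left fun _ => eq_comm

/-- Write the contracted graph to the memory that the program for minimum spanning trees sees, and keep
a copy of the weights in the real array 12. -/
def loadGraph : Prog := block [
  .setInt 100 (.const 0) (reg 45),
  .setInt 100 (.const 1) (.get 0 (.const 1)),
  forLoop 31 0 1 (block [
    .setInt 101 (reg 31) (elt 43),
    .setInt 102 (reg 31) (elt 44),
    .ifte (.conj (.intLE (.get 42 (elt 41)) (reg 31)) (.intLE (reg 31) (.get 42 (elt 41))))
      (.ifte (.intLE (.const 1) (.get 49 (elt 41)))
        (.setReal 12 (reg 31) (.get 11 (.const 0)))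
        (.setReal 12 (reg 31) (.get 10 (elt 41))))
      (.setReal 12 (reg 31) (.get 0 (reg 31))),
    .setReal 100 (reg 31) (.get 12 (reg 31))])]

theorem runs_loadGraph (h : Setup S rep lab code k σ)
    (hd : ∀ e : Fin m, 1 ≤ σ.int 49 (σ.int 41 (e : ℕ)) ↔ Steiner.Dead S (excluded S code x) e) :
    Runs loadGraph σ fun t σ' => t ≤ 9 * m + 5 ∧ SameOff loadGraph.ints loadGraph.reals σ σ' ∧
      (choiceGraph S rep lab code x).LoadedIn (σ'.drop 100) ∧
      ∀ e : Fin m, σ'.real 12 (e : ℕ) = Steiner.weight S rep (excluded S code x) S.big e := by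
  suffices hS : Runs loadGraph σ fun t σ' => t ≤ 9 * m + 5 ∧
      (choiceGraph S rep lab code x).LoadedIn (σ'.drop 100) ∧
      ∀ e : Fin m, σ'.real 12 (e : ℕ) = Steiner.weight S rep (excluded S code x) S.big e from
    hS.sameOff.mono fun t σ' h => ⟨h.1.1, h.2, h.1.2⟩
  simp only [loadGraph, runs_block_cons, runs_setInt, IExpr.eval, putInt_int, h.inst.num,
    h.contraction.num, Nat.reduceEqDiff, if_false]
  set σ1 := (σ.putInt 100 0 N).putInt 100 1 m with hσ1
  have hs1 : SameOff [100] [] σ σ1 :=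
    ⟨fun a ha => by simp only [hσ1, putInt_int, if_neg (show ¬ a = 100 by simpa using ha)],
      fun _ _ => rfl⟩
  have hS1 := h.frame hs1 (by decide) (by decide)
  have e49 : σ1.int 49 = σ.int 49 := hs1.1 49 (by decide)
  have e41 : σ1.int 41 = σ.int 41 := hs1.1 41 (by decide)
  refine (runs_forLoop m 7 (fun i τ => ∀ e : Fin m, (e : ℕ) < i →
    τ.int 101 (e : ℕ) = (lab (S.s (.inl e)) : ℕ) ∧ τ.int 102 (e : ℕ) = (lab (S.t (.inl e)) : ℕ) ∧
    τ.real 100 (e : ℕ) = Steiner.weight S rep (excluded S code x) S.big e ∧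
    τ.real 12 (e : ℕ) = Steiner.weight S rep (excluded S code x) S.big e) hS1.inst.num
    (by decide) (by decide) (by simp) ?_).mono ?_
  · intro i hi τ hs hiv hI
    have hSτ := hS1.frame hs (by decide) (by decide)
    have eτ49 : τ.int 49 = σ.int 49 := (hs.1 49 (by decide)).trans e49
    have eτ41 : τ.int 41 = σ.int 41 := (hs.1 41 (by decide)).trans e41
    have hdi := hd ⟨i, hi⟩
    have hre := hSτ.threads.rep_eq ⟨i, hi⟩
    have hto := hSτ.threads.total ⟨i, hi⟩
    have hco := hSτ.inst.cost ⟨i, hi⟩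
    obtain ⟨eU, eV⟩ := hSτ.contraction.ends ⟨i, hi⟩
    rw [eτ41] at hre hto
    simp only at hdi hre hto hco eU eV
    have key : ∀ w : ℝ, w = Steiner.weight S rep (excluded S code x) S.big ⟨i, hi⟩ →
        ∀ e : Fin m, (e : ℕ) < i + 1 →
        Function.update (τ.int 101) i (lab (S.s (.inl ⟨i, hi⟩)) : ℕ) (e : ℕ) =
          (lab (S.s (.inl e)) : ℕ) ∧
        Function.update (τ.int 102) i (lab (S.t (.inl ⟨i, hi⟩)) : ℕ) (e : ℕ) =
          (lab (S.t (.inl e)) : ℕ) ∧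
        Function.update (τ.real 100) i w (e : ℕ) =
          Steiner.weight S rep (excluded S code x) S.big e ∧
        Function.update (τ.real 12) i w (e : ℕ) =
          Steiner.weight S rep (excluded S code x) S.big e := by
      intro w hw e he
      rcases fin_lt_succ_cases hi he with h' | rfl
      · have : ((e : ℕ) : ℤ) ≠ i := by omega
        simpa only [Function.update_apply, if_neg this] using hI e h'
      · simp [hw]
    simp only [runs_block_cons, runs_block_nil, runs_setInt, runs_setReal, runs_ifte, Test.holds,
      IExpr.eval, RExpr.eval, putInt_int, putInt_real, putReal_int, putReal_real, hiv, eU, eV, eτ41,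
      eτ49, hre, hto, hco, hdi, hSτ.threads.big, Nat.reduceEqDiff, if_true, if_false,
      Function.update_self]
    refine ⟨fun hc => ?_, fun hc => ?_⟩
    · have hc' : rep ⟨i, hi⟩ = ⟨i, hi⟩ := Fin.ext (by simp only; omega)
      refine ⟨fun hdead => ⟨by norm_num, key _ ?_⟩, fun hdead => ⟨by norm_num, key _ ?_⟩⟩
      · rw [Steiner.weight, if_pos hc', if_pos hdead, Steiner.big]
      · rw [Steiner.weight, if_pos hc', if_neg hdead, hc']
        exact sum_congr (by ext; simp) fun _ _ => rfl
    · have hc' : rep ⟨i, hi⟩ ≠ ⟨i, hi⟩ := fun h => hc (by rw [h]; simp)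
      refine ⟨by norm_num, key _ ?_⟩
      rw [Steiner.weight, if_neg hc']
  · rintro t σ' ⟨ht, hs, hI⟩
    simp only [runs_block_nil]
    have e100 := hs.1 100 (by decide)
    refine ⟨by omega, ⟨?_, ?_, fun (e : Fin m) => ?_⟩, fun e => (hI e e.2).2.2.2⟩
    · simp only [State.drop, e100, hσ1]
      simp [choiceGraph, Steiner.graph]
    · simp only [State.drop, e100, hσ1]
      simp [choiceGraph, Steiner.graph]
    · obtain ⟨h1, h2, h3, -⟩ := hI e e.2
      exact ⟨h1, h2, h3⟩

theorem notMem_ints_shift {K : ℕ} {P : Prog} {a : ℕ} (ha : a < K) : a ∉ (P.shift K).ints := by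
  induction P <;> simp_all [Prog.shift, Prog.ints]
  omega

theorem notMem_reals_shift {K : ℕ} {P : Prog} {a : ℕ} (ha : a < K) : a ∉ (P.shift K).reals := by
  induction P <;> simp_all [Prog.shift, Prog.reals]
  omega

theorem FindsMST.runs_shift {M : Prog} {T : ℕ → ℕ} (hM : FindsMST M T) {H : WeightedGraph}
    (hH : H.Connected) {K : ℕ} {σ : State} (hσ : H.LoadedIn (σ.drop K)) :
    Runs (M.shift K) σ fun t σ' => t ≤ T H.m ∧ SameOff (M.shift K).ints (M.shift K).reals σ σ' ∧
      ∃ A, H.IsMST A ∧ ∀ e : Fin H.m, σ'.int (3 + K) (e : ℕ) = if e ∈ A then 1 else 0 := by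
  obtain ⟨t, τ, hex, ht, A, hA, h3⟩ := hM H hH _ hσ
  have hex' := hex.shift K σ
  rw [State.graft_drop] at hex'
  refine ⟨t, _, hex', by omega, hex'.sameOff, A, hA, fun e => ?_⟩
  have : (σ.graft K τ).drop K = τ := State.drop_graft
  rw [← h3 e, ← this]
  simp [State.drop, State.graft]

/-- The value of the tree, to be kept in the real cell `13[0]`. -/
def computeValue : Prog := block [
  .setReal 13 (.const 0) .zero,
  forLoop 31 0 1 (.ifte (.intLE (.const 1) (elt 103))
    (.setReal 13 (.const 0) (.add (.get 13 (.const 0)) (.get 12 (reg 31)))) .skip),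
  forLoop 31 47 0 (.ifte (.intLE (elt 48) (.const 0))
    (.setReal 13 (.const 0) (.sub (.get 13 (.const 0)) (.get 11 (.const 0)))) .skip)]

theorem runs_computeValue (h : Setup S rep lab code k σ) (hb : Bits k x σ) {T : Finset (Fin m)}
    (hw : ∀ e : Fin m, σ.real 12 (e : ℕ) = Steiner.weight S rep (excluded S code x) S.big e)
    (hT : ∀ e : Fin m, σ.int 103 (e : ℕ) = if e ∈ T then 1 else 0) :
    Runs computeValue σ fun t σ' => t ≤ 4 * m + 4 * k + 6 ∧
      SameOff computeValue.ints computeValue.reals σ σ' ∧ σ'.real 13 0 = value S rep code k x T := by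
  suffices hS : Runs computeValue σ fun t σ' => t ≤ 4 * m + 4 * k + 6 ∧
      σ'.real 13 0 = value S rep code k x T from
    hS.sameOff.mono fun t σ' h => ⟨h.1.1, h.2, h.1.2⟩
  rw [computeValue, runs_block_cons, runs_setReal, runs_block_cons]
  set σ1 := σ.putReal 13 ((IExpr.const 0).eval σ) (RExpr.zero.eval σ) with hσ1
  have hs1 : SameOff [] [13] σ σ1 :=
    ⟨fun _ _ => rfl, fun a ha => by rw [hσ1, putReal_real, if_neg (by simpa using ha)]⟩
  have hS1 := h.frame hs1 (by decide) (by decide)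
  have hb1 := hb.frame hs1 (by decide)
  refine (runs_forLoop m 2 (fun i τ => τ.real 13 0 = ∑ e : Fin m with e.val < i,
    if e ∈ T then Steiner.weight S rep (excluded S code x) S.big e else 0) hS1.inst.num
    (by decide) (by decide) (by simp [hσ1]) ?_).mono ?_
  · intro i hi τ hs hiv hI
    have e103 : τ.int 103 = σ.int 103 := (hs.1 103 (by decide)).trans (hs1.1 103 (by decide))
    have e12 : τ.real 12 = σ.real 12 := (hs.2 12 (by decide)).trans (hs1.2 12 (by decide))
    have hTi := hT ⟨i, hi⟩
    have hwi := hw ⟨i, hi⟩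
    simp only at hTi hwi
    simp only [runs_ifte, Test.holds, runs_skip, runs_setReal, IExpr.eval, RExpr.eval, putInt_real,
      putReal_real, hiv, e103, e12, hTi, hwi, hI, sum_fin_lt_succ hi, if_true,
      Function.update_self]
    constructor <;> intro hc <;> refine ⟨by norm_num, ?_⟩
    · rw [if_pos (by by_contra h; simp [h] at hc)]
    · rw [if_neg (by intro h; simp [h] at hc), add_zero]
  rintro t2 σ2 ⟨ht2, hs2, h2⟩
  have hS2 := hS1.frame hs2 (by decide) (by decide)
  have hb2 := hb1.frame hs2 (by decide)
  rw [runs_block_cons]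
  refine (runs_forLoop k 2 (fun i τ => τ.real 13 0 = σ2.real 13 0 - zeros i x * S.big) hS2.codes.num
    (by decide) (by decide) (by simp [zeros]) ?_).mono ?_
  · intro i hi τ hs hiv hI
    have hbτ := hb2.frame hs (by decide)
    have hSτ := hS2.frame hs (by decide) (by decide)
    have hz : zeros (i + 1) x = zeros i x + if x.testBit i = false then 1 else 0 := by
      rw [zeros, range_add_one, filter_insert]
      split_ifs with hbit
      · rw [card_insert_of_notMem (by simp), zeros]
      · rfl
    have hbi := hbτ.bit i hi
    simp only [runs_ifte, Test.holds, runs_skip, runs_setReal, IExpr.eval, RExpr.eval, putInt_real,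
      putReal_real, hiv, hI, hz, hbi, hSτ.threads.big, if_true, Function.update_self]
    rcases hbit : x.testBit i
    · simp only [Steiner.big, Bool.false_eq_true, if_true, if_false, le_refl, forall_true_left,
        not_true_eq_false, false_imp_iff, and_true]
      refine ⟨by norm_num, ?_⟩
      push_cast
      ring
    · simp
  · rintro t3 σ3 ⟨ht3, hs3, h3⟩
    simp only [runs_block_nil]
    refine ⟨by omega, ?_⟩
    rw [h3, h2, sum_fin_lt_self, value, ← sum_filter]
    simp

end

section

open scoped Classical

variable {n m p N k x : ℕ} {S : Steiner (Fin n) (Fin m) (Fin p)} {σ σ' : State} {rep : Fin m → Fin m}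
  {lab : Fin n → Fin N} {code : Fin n → ℤ}

/-- Keep the purchase in array 50, and its value in the real cell `14[0]`. -/
def saveTree : Prog := block [
  forLoop 31 0 1 (.ifte (.conj (.intLE (.const 1) (.get 103 (.get 42 (elt 41))))
      (.neg (.intLE (.const 1) (.get 49 (elt 41)))))
    (.setInt 50 (reg 31) (.const 1)) (.setInt 50 (reg 31) (.const 0))),
  .setInt 51 (.const 0) (.const 1),
  .setReal 14 (.const 0) (.get 13 (.const 0))]

/-- Save the tree, unless there is one that is as good (`51[0]` says if there is any). -/
def keepBest : Prog :=
  .ifte (.conj (.intLE (.const 1) (reg 51)) (.realLE (.get 14 (.const 0)) (.get 13 (.const 0))))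
    .skip saveTree

/-- The best tree for the choices below `x`. -/
structure Saved (S : Steiner (Fin n) (Fin m) (Fin p)) (rep : Fin m → Fin m) (lab : Fin n → Fin N)
    (code : Fin n → ℤ) (k x : ℕ) (σ : State) : Prop where
  has : 1 ≤ σ.int 51 0 ↔ 0 < x
  best : 0 < x → ∃ y : Fin (2 ^ k), ∃ T : Finset (Fin m), (choiceGraph S rep lab code y).Spans T ∧
    value S rep code k y T = σ.real 14 0 ∧
    ∀ e : Fin m, .inl e ∉ S.Q →
      (1 ≤ σ.int 50 (e : ℕ) ↔ e ∈ Steiner.purchase S rep (excluded S code y) T)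
  le : ∀ y < x, ∃ T : Finset (Fin m), (choiceGraph S rep lab code y).IsMST T ∧
    σ.real 14 0 ≤ value S rep code k y T

theorem Saved.frame (h : Saved S rep lab code k x σ) {li lr : List ℕ} (hs : SameOff li lr σ σ')
    (hi : ∀ a ∈ [50, 51], a ∉ li) (hr : 14 ∉ lr) : Saved S rep lab code k x σ' := by
  have e50 := hs.1 50 (hi 50 (by decide))
  have e51 := hs.1 51 (hi 51 (by decide))
  have e14 := hs.2 14 hr
  exact ⟨by rw [e51]; exact h.has, by rw [e50, e14]; exact h.best, by rw [e14]; exact h.le⟩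

theorem runs_saveTree (h : Setup S rep lab code k σ) {T : Finset (Fin m)}
    (hd : ∀ e : Fin m, 1 ≤ σ.int 49 (σ.int 41 (e : ℕ)) ↔ Steiner.Dead S (excluded S code x) e)
    (hT : ∀ e : Fin m, σ.int 103 (e : ℕ) = if e ∈ T then 1 else 0) :
    Runs saveTree σ fun t σ' => t ≤ 4 * m + 5 ∧ σ'.int 51 0 = 1 ∧ σ'.real 14 0 = σ.real 13 0 ∧
      ∀ e : Fin m, .inl e ∉ S.Q →
        (1 ≤ σ'.int 50 (e : ℕ) ↔ e ∈ Steiner.purchase S rep (excluded S code x) T) := by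
  rw [saveTree, runs_block_cons]
  refine (runs_forLoop m 2 (fun i τ => ∀ e : Fin m, (e : ℕ) < i → .inl e ∉ S.Q →
    (1 ≤ τ.int 50 (e : ℕ) ↔ e ∈ Steiner.purchase S rep (excluded S code x) T)) h.inst.num
    (by decide) (by decide) (by simp) ?_).mono ?_
  · intro i hi τ hs hiv hI
    have hSτ := h.frame hs (by decide) (by decide)
    have e103 := hs.1 103 (by decide)
    have e49 := hs.1 49 (by decide)
    have e41 := hs.1 41 (by decide)
    have hre := hSτ.threads.rep_eq ⟨i, hi⟩
    have hdi := hd ⟨i, hi⟩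
    have hTi := hT (rep ⟨i, hi⟩)
    rw [e41] at hre
    simp only at hre hdi
    simp only [runs_ifte, Test.holds, runs_setInt, IExpr.eval, putInt_int, hiv, e103, e49, e41, hre,
      hdi, hTi, Nat.reduceEqDiff, if_true, if_false]
    have hnew : ∀ c : ℤ, (1 ≤ c ↔ rep ⟨i, hi⟩ ∈ T ∧ ¬ Steiner.Dead S (excluded S code x) ⟨i, hi⟩) →
        ∀ e : Fin m, (e : ℕ) < i + 1 → .inl e ∉ S.Q →
        (1 ≤ Function.update (τ.int 50) i c (e : ℕ) ↔
          e ∈ Steiner.purchase S rep (excluded S code x) T) := by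
      intro c hc e he hQ
      rcases fin_lt_succ_cases hi he with h' | rfl
      · have : ((e : ℕ) : ℤ) ≠ i := by omega
        rw [Function.update_of_ne this]
        exact hI e h' hQ
      · rw [Function.update_self, hc]
        simp [Steiner.purchase, hQ]
    refine ⟨fun hc => ⟨by norm_num, hnew 1 ?_⟩, fun hc => ⟨by norm_num, hnew 0 ?_⟩⟩
    · refine iff_of_true le_rfl ⟨?_, hc.2⟩
      by_contra hcon
      simp [hcon] at hc
    · refine iff_of_false (by norm_num) fun hcon => hc ⟨?_, hcon.2⟩
      simp [hcon.1]
  · rintro t σ' ⟨ht, hs, hI⟩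
    have e13 : σ'.real 13 = σ.real 13 := hs.2 13 (by decide)
    simp only [runs_block_cons, runs_block_nil, runs_setInt, runs_setReal, IExpr.eval, RExpr.eval,
      putInt_int, putInt_real, putReal_int, putReal_real, Nat.reduceEqDiff, if_true, if_false, e13]
    exact ⟨by omega, by simp, by simp, fun e => hI e e.2⟩

theorem runs_keepBest (h : Setup S rep lab code k σ) (hsv : Saved S rep lab code k x σ)
    (hx : x < 2 ^ k) {T : Finset (Fin m)}
    (hd : ∀ e : Fin m, 1 ≤ σ.int 49 (σ.int 41 (e : ℕ)) ↔ Steiner.Dead S (excluded S code x) e)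
    (hT : ∀ e : Fin m, σ.int 103 (e : ℕ) = if e ∈ T then 1 else 0)
    (hmst : (choiceGraph S rep lab code x).IsMST T)
    (hv : σ.real 13 0 = value S rep code k x T) :
    Runs keepBest σ fun t σ' => t ≤ 4 * m + 6 ∧ SameOff keepBest.ints keepBest.reals σ σ' ∧
      Saved S rep lab code k (x + 1) σ' := by
  suffices hS : Runs keepBest σ fun t σ' => t ≤ 4 * m + 6 ∧ Saved S rep lab code k (x + 1) σ' from
    hS.sameOff.mono fun t σ' h => ⟨h.1.1, h.2, h.1.2⟩
  simp only [keepBest, runs_ifte, runs_skip, Test.holds, IExpr.eval, RExpr.eval]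
  refine ⟨fun hc => ⟨by omega, ?_, ?_, ?_⟩, fun hc => (runs_saveTree h hd hT).mono ?_⟩
  · exact iff_of_true hc.1 (by omega)
  · exact fun _ => hsv.best (hsv.has.1 hc.1)
  · intro y hy
    rcases Nat.lt_succ_iff_lt_or_eq.1 hy with hy | rfl
    · exact hsv.le y hy
    · exact ⟨T, hmst, by rw [← hv]; exact hc.2⟩
  · rintro t σ' ⟨ht, h51, h14, h50⟩
    refine ⟨by omega, ?_, fun _ => ⟨⟨x, hx⟩, T, hmst.1.1, ?_, h50⟩, fun y hy => ?_⟩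
    · exact iff_of_true h51.ge (by omega)
    · rw [h14, hv]
    · rcases Nat.lt_succ_iff_lt_or_eq.1 hy with hy | rfl
      · obtain ⟨T', h1, h2⟩ := hsv.le y hy
        refine ⟨T', h1, ?_⟩
        have h3 : ¬ σ.real 14 0 ≤ σ.real 13 0 := fun h4 => hc ⟨hsv.has.2 (by omega), h4⟩
        rw [h14]
        linarith
      · exact ⟨T, hmst, by rw [h14, hv]⟩

/-! ### A binary counter -/

theorem testBit_add_one {j : ℕ} (h1 : ∀ i < j, x.testBit i = true) (h2 : x.testBit j = false)
    (i : ℕ) : (x + 1).testBit i = if i < j then false else if i = j then true else x.testBit i := by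
  induction j generalizing x i with
  | zero =>
    have hx : x % 2 = 0 := by simpa [Nat.testBit_zero] using h2
    cases i with
    | zero => simp [Nat.testBit_zero]; omega
    | succ i =>
      rw [Nat.testBit_succ, Nat.testBit_succ, show (x + 1) / 2 = x / 2 by omega]
      simp
  | succ j ih =>
    have hx : x % 2 = 1 := by simpa [Nat.testBit_zero] using h1 0 (by omega)
    cases i with
    | zero => simp [Nat.testBit_zero]; omega
    | succ i =>
      rw [Nat.testBit_succ, Nat.testBit_succ, show (x + 1) / 2 = x / 2 + 1 by omega,
        ih (fun i hi => by rw [← Nat.testBit_succ]; exact h1 _ (by omega))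
          (by rw [← Nat.testBit_succ]; exact h2)]
      simp

theorem two_pow_le_of_testBit {j : ℕ} (h1 : ∀ i < j, x.testBit i = true) : 2 ^ j ≤ x + 1 := by
  induction j generalizing x with
  | zero => simp
  | succ j ih =>
    have hx : x % 2 = 1 := by simpa [Nat.testBit_zero] using h1 0 (by omega)
    have := ih (x := x / 2) fun i hi => by rw [← Nat.testBit_succ]; exact h1 _ (by omega)
    rw [pow_succ]
    omega

/-- Add one to the number represented by the bits; `52[0]` is set to 1 in the case of an overflow. -/
def increment : Prog := block [
  .setInt 53 (.const 0) (.const 0),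
  .while (.conj (.neg (.intLE (reg 47) (reg 53))) (.intLE (.const 1) (.get 48 (reg 53))))
    (block [
      .setInt 48 (reg 53) (.const 0),
      .setInt 53 (.const 0) (.add (reg 53) (.const 1))]),
  .ifte (.intLE (reg 47) (reg 53)) (.setInt 52 (.const 0) (.const 1))
    (.setInt 48 (reg 53) (.const 1))]

theorem runs_increment (hk : σ.int 47 0 = k) (hb : Bits k x σ) (hx : x < 2 ^ k) :
    Runs increment σ fun t σ' => t ≤ 4 * k + 6 ∧ SameOff increment.ints increment.reals σ σ' ∧
      (x + 1 < 2 ^ k ∧ Bits k (x + 1) σ' ∧ σ'.int 52 0 = σ.int 52 0 ∨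
        x + 1 = 2 ^ k ∧ σ'.int 52 0 = 1) := by
  suffices hS : Runs increment σ fun t σ' => t ≤ 4 * k + 6 ∧
      (x + 1 < 2 ^ k ∧ Bits k (x + 1) σ' ∧ σ'.int 52 0 = σ.int 52 0 ∨
        x + 1 = 2 ^ k ∧ σ'.int 52 0 = 1) from
    hS.sameOff.mono fun t σ' h => ⟨h.1.1, h.2, h.1.2⟩
  rw [increment, runs_block_cons, runs_setInt, runs_block_cons]
  refine (runs_while (fun c τ => SameOff [48, 53] [] σ τ ∧ ∃ j : ℕ, j ≤ k ∧ c = 4 * (k - j) ∧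
    τ.int 53 0 = j ∧ (∀ i < j, x.testBit i = true) ∧
    (∀ i < k, τ.int 48 (i : ℕ) = if i < j then 0 else if x.testBit i then 1 else 0) ∧
    τ.int 48 (-1) = 1 ∧ τ.int 48 (-2) = 0) ?_ (n := 4 * k) ?_).mono ?_
  · rintro c τ ⟨hs, j, hj, rfl, h53, h1, h2, h3, h4⟩ hc
    have e47 : τ.int 47 = σ.int 47 := hs.1 47 (by decide)
    simp only [Test.holds, IExpr.eval, e47, hk, h53] at hc
    have hjk : j < k := by omega
    have hxj : x.testBit j = true := by
      by_contra hcon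
      have := h2 j hjk
      simp only [lt_irrefl, if_false, hcon] at this
      simp [this] at hc
    simp only [runs_block_cons, runs_block_nil, runs_setInt, IExpr.eval, putInt_int, h53,
      Nat.reduceEqDiff, if_true, if_false]
    refine ⟨4 * (k - (j + 1)), ⟨hs.trans ⟨fun a ha => ?_, fun _ _ => rfl⟩, j + 1, hjk, rfl, by simp,
      ?_, ?_, ?_, ?_⟩, by omega⟩
    · simp only [List.mem_cons, List.not_mem_nil, or_false, not_or] at ha
      simp only [putInt_int, ha, if_false]
    · intro i hi
      rcases Nat.lt_succ_iff_lt_or_eq.1 hi with h | rfl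
      · exact h1 i h
      · exact hxj
    · intro i hi
      by_cases hij : i = j
      · subst hij; simp
      · rw [Function.update_of_ne (by omega), h2 i hi]
        have : i < j + 1 ↔ i < j := by omega
        simp only [this]
    · rw [Function.update_of_ne (by omega), h3]
    · rw [Function.update_of_ne (by omega), h4]
  · refine ⟨⟨fun a ha => ?_, fun _ _ => rfl⟩, 0, Nat.zero_le _, by simp, by simp, by simp, ?_, ?_, ?_⟩
    · simp only [List.mem_cons, List.not_mem_nil, or_false, not_or] at ha
      simp only [putInt_int, ha, if_false]
    · intro i hi
      simpa using hb.bit i hi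
    · simpa using hb.free
    · simpa using hb.leaf
  · rintro t τ ⟨c, ⟨hs, j, hj, rfl, h53, h1, h2, h3, h4⟩, hc, ht⟩
    have e47 : τ.int 47 = σ.int 47 := hs.1 47 (by decide)
    have e52 : τ.int 52 = σ.int 52 := hs.1 52 (by decide)
    simp only [Test.holds, IExpr.eval, e47, hk, h53] at hc
    simp only [runs_block_cons, runs_block_nil, runs_setInt, runs_ifte, Test.holds, IExpr.eval,
      putInt_int, h53, e47, hk, e52, Nat.reduceEqDiff, if_true, if_false]
    refine ⟨fun hkj => ⟨by omega, .inr ⟨?_, by simp⟩⟩, fun hkj => ⟨by omega, .inl ?_⟩⟩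
    · obtain rfl : j = k := by omega
      have := two_pow_le_of_testBit h1
      omega
    · have hjk : j < k := by omega
      have hxj : x.testBit j = false := by
        by_contra hcon
        have := h2 j hjk
        simp only [lt_irrefl, if_false, eq_true_of_ne_false hcon, if_true] at this
        simp [this, hjk] at hc
      have hbit := testBit_add_one h1 hxj
      refine ⟨?_, ⟨fun i hi => ?_, ?_, ?_⟩, trivial⟩
      · refine lt_of_le_of_ne hx fun heq => ?_
        have := hbit j
        rw [heq, Nat.testBit_two_pow] at this
        simp only [lt_irrefl, if_false, if_true, decide_eq_true_eq] at this
        omega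
      · simp only [putInt_int, if_true, hbit i]
        by_cases hij : i = j
        · subst hij; simp
        · rw [Function.update_of_ne (by omega), h2 i hi]
          by_cases hlt : i < j <;> simp [hlt, hij]
      · simp only [putInt_int, if_true]
        rw [Function.update_of_ne (by omega), h3]
      · simp only [putInt_int, if_true]
        rw [Function.update_of_ne (by omega), h4]

/-! ### The main loop -/

/-- Try one choice, by means of the program `M` for minimum spanning trees. -/
def tryChoice (M : Prog) : Prog := block [
  markDead, loadGraph, M.shift 100, computeValue, keepBest, increment]

/-- Try all choices. -/
def tryAll (M : Prog) : Prog := block [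
  .setInt 51 (.const 0) (.const 0),
  .setInt 52 (.const 0) (.const 0),
  .while (.intLE (reg 52) (.const 0)) (tryChoice M)]

variable {M : Prog} {T : ℕ → ℕ}

theorem notMem_shift {l : List ℕ} (hl : ∀ a ∈ l, a < 100) :
    (∀ a ∈ l, a ∉ (M.shift 100).ints) ∧ ∀ a ∈ l, a ∉ (M.shift 100).reals :=
  ⟨fun a ha => notMem_ints_shift (hl a ha), fun a ha => notMem_reals_shift (hl a ha)⟩

theorem runs_tryChoice (hM : FindsMST M T) (h : Setup S rep lab code k σ) (hb : Bits k x σ)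
    (hx : x < 2 ^ k) (hsv : Saved S rep lab code k x σ) :
    Runs (tryChoice M) σ fun t σ' => t ≤ T m + 40 * m + 40 ∧ Setup S rep lab code k σ' ∧
      Saved S rep lab code k (x + 1) σ' ∧
      (x + 1 < 2 ^ k ∧ Bits k (x + 1) σ' ∧ σ'.int 52 0 = σ.int 52 0 ∨
        x + 1 = 2 ^ k ∧ σ'.int 52 0 = 1) := by
  rw [tryChoice, runs_block_cons]
  refine (runs_markDead h hb).mono ?_
  rintro t1 σ1 ⟨ht1, hs1, hd⟩
  have hS1 := h.frame hs1 (by decide) (by decide)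
  have hb1 := hb.frame hs1 (by decide)
  have hsv1 := hsv.frame hs1 (by decide) (by decide)
  rw [← hs1.1 41 (by decide)] at hd
  rw [runs_block_cons]
  refine (runs_loadGraph hS1 hd).mono ?_
  rintro t2 σ2 ⟨ht2, hs2, hload, hw⟩
  have hS2 := hS1.frame hs2 (by decide) (by decide)
  have hb2 := hb1.frame hs2 (by decide)
  have hsv2 := hsv1.frame hs2 (by decide) (by decide)
  rw [← hs2.1 41 (by decide), ← hs2.1 49 (by decide)] at hd
  rw [runs_block_cons]
  refine (hM.runs_shift (h.contraction.isContraction.connected) hload).mono ?_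
  rintro t3 σ3 ⟨ht3, hs3, (A : Finset (Fin m)), hA, hsel⟩
  have hsel : ∀ e : Fin m, σ3.int 103 (e : ℕ) = if e ∈ A then 1 else 0 := fun e => by
    exact (hsel e).trans (by congr)
  have ht3 : t3 ≤ T m := ht3
  have hS3 := hS2.frame hs3 (notMem_shift (by decide)).1 (notMem_shift (by decide)).2
  have hb3 := hb2.frame hs3 (notMem_ints_shift (by decide))
  have hsv3 := hsv2.frame hs3 (notMem_shift (by decide)).1 (notMem_reals_shift (by decide))
  rw [← hs3.1 41 (notMem_ints_shift (by decide)), ← hs3.1 49 (notMem_ints_shift (by decide))] at hd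
  rw [← hs3.2 12 (notMem_reals_shift (by decide))] at hw
  rw [runs_block_cons]
  refine (runs_computeValue hS3 hb3 hw hsel).mono ?_
  rintro t4 σ4 ⟨ht4, hs4, hv⟩
  have hS4 := hS3.frame hs4 (by decide) (by decide)
  have hb4 := hb3.frame hs4 (by decide)
  have hsv4 := hsv3.frame hs4 (by decide) (by decide)
  rw [← hs4.1 41 (by decide), ← hs4.1 49 (by decide)] at hd
  rw [← hs4.1 103 (by decide)] at hsel
  rw [runs_block_cons]
  refine (runs_keepBest hS4 hsv4 hx hd hsel hA hv).mono ?_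
  rintro t5 σ5 ⟨ht5, hs5, hsv5⟩
  have hS5 := hS4.frame hs5 (by decide) (by decide)
  have hb5 := hb4.frame hs5 (by decide)
  rw [runs_block_cons]
  refine (runs_increment hS5.codes.num hb5 hx).mono ?_
  rintro t6 σ6 ⟨ht6, hs6, h6⟩
  have hk := h.le_two_mul
  simp only [runs_block_nil]
  refine ⟨by omega, hS5.frame hs6 (by decide) (by decide), hsv5.frame hs6 (by decide) (by decide), ?_⟩
  rwa [hs5.1 52 (by decide), hs4.1 52 (by decide), hs3.1 52 (notMem_ints_shift (by decide)),
    hs2.1 52 (by decide), hs1.1 52 (by decide)] at h6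

theorem Saved.optimal (h : Setup S rep lab code k σ) (hsv : Saved S rep lab code k (2 ^ k) σ) :
    ∃ D, S.Optimal D ∧ ∀ e : Fin m, .inl e ∉ S.Q → (1 ≤ σ.int 50 (e : ℕ) ↔ e ∈ D) := by
  obtain ⟨y, A, hA, hval, h50⟩ := hsv.best (by positivity)
  refine ⟨_, Steiner.optimal_of_best (ι := Fin (2 ^ k)) (N := N) (b := S.big)
    (hb := fun e => S.big_pos e) h.threads.isRep
    h.contraction.isContraction (X := fun y => excluded S code y) (z := fun y => zeros k y)
    (fun y => h.card_excluded y) ?_ h.exists_choice rfl hA fun y' => ?_, h50⟩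
  · intro y v hv
    simp only [excluded, mem_filter, mem_univ, true_and] at hv
    obtain ⟨⟨e, he⟩, hv⟩ := hv
    refine ⟨⟨e, he⟩, ?_⟩
    rcases h.code_cases he with h1 | ⟨h1, h2, h3⟩ | ⟨h1, h2, h3, h4⟩
    · omega
    · exact ⟨h2, by omega⟩
    · exact ⟨h3, by omega⟩
  · obtain ⟨A', h1, h2⟩ := hsv.le y' y'.2
    rw [← hval] at h2
    exact ⟨A', h1, h2⟩

theorem runs_tryAll (hM : FindsMST M T) (h : Setup S rep lab code k σ) (hb : Bits k 0 σ) :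
    Runs (tryAll M) σ fun t σ' => t ≤ 2 ^ k * (T m + 40 * m + 41) + 4 ∧
      ∃ D, S.Optimal D ∧ ∀ e : Fin m, .inl e ∉ S.Q → (1 ≤ σ'.int 50 (e : ℕ) ↔ e ∈ D) := by
  simp only [tryAll, runs_block_cons, runs_setInt, IExpr.eval]
  set σ1 := (σ.putInt 51 0 0).putInt 52 0 0 with hσ1
  have hs1 : SameOff [51, 52] [] σ σ1 :=
    ⟨fun a ha => by
      simp only [List.mem_cons, List.not_mem_nil, or_false, not_or] at ha
      simp only [hσ1, putInt_int, ha, if_false], fun _ _ => rfl⟩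
  have hS1 := h.frame hs1 (by decide) (by decide)
  have hb1 := hb.frame hs1 (by decide)
  refine (runs_while (fun c τ => Setup S rep lab code k τ ∧ ∃ x, Saved S rep lab code k x τ ∧
    c = (2 ^ k - x) * (T m + 40 * m + 41) ∧
    (x < 2 ^ k ∧ Bits k x τ ∧ τ.int 52 0 = 0 ∨ x = 2 ^ k ∧ τ.int 52 0 = 1)) ?_
    (n := 2 ^ k * (T m + 40 * m + 41)) ?_).mono ?_
  · rintro c τ ⟨hS, x, hsv, rfl, hcase⟩ hc
    simp only [Test.holds, IExpr.eval] at hc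
    obtain ⟨hx, hb, h52⟩ : x < 2 ^ k ∧ Bits k x τ ∧ τ.int 52 0 = 0 := by
      rcases hcase with hcase | ⟨-, h52⟩
      · exact hcase
      · omega
    refine (runs_tryChoice hM hS hb hx hsv).mono ?_
    rintro t τ' ⟨ht, hS', hsv', hcase'⟩
    rw [h52] at hcase'
    refine ⟨(2 ^ k - (x + 1)) * (T m + 40 * m + 41), ⟨hS', x + 1, hsv', rfl, hcase'⟩, ?_⟩
    obtain ⟨d, hd⟩ : ∃ d, 2 ^ k = x + 1 + d := ⟨2 ^ k - (x + 1), by omega⟩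
    rw [hd, show x + 1 + d - (x + 1) = d by omega, show x + 1 + d - x = d + 1 by omega, add_mul]
    omega
  · refine ⟨hS1, 0, ⟨?_, fun h => absurd h (lt_irrefl _), fun y hy => absurd hy (Nat.not_lt_zero _)⟩,
      by simp, .inl ⟨by positivity, hb1, by simp [hσ1]⟩⟩
    simp [hσ1]
  · rintro t τ ⟨c, ⟨hS, x, hsv, -, hcase⟩, hc, ht⟩
    simp only [Test.holds, IExpr.eval] at hc
    simp only [runs_block_nil]
    obtain ⟨rfl, -⟩ : x = 2 ^ k ∧ τ.int 52 0 = 1 := by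
      rcases hcase with ⟨-, -, h52⟩ | hcase
      · omega
      · exact hcase
    exact ⟨by omega, hsv.optimal hS⟩

/-- Solve the Steiner tree problem; array 50 is to hold flags for the edges to be bought. -/
def solve (M : Prog) : Prog := block [
  computeDegrees, computeThreads, contract, computeCodes, tryAll M]

theorem notMem_ints_solve {a : ℕ} (ha : a ∈ [0, 1, 2, 3, 4, 5, 6, 7, 8, 9, 33]) :
    a ∉ (solve M).ints := by
  have h := notMem_ints_shift (P := M) (show a < 100 by revert a; decide)
  simp only [solve, tryAll, tryChoice, block, Prog.ints, List.mem_append, not_or]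
  refine ⟨?_, ?_, ?_, ?_, ⟨?_, ?_, ⟨?_, ?_, h, ?_, ?_, ?_, ?_⟩, ?_⟩, ?_⟩ <;>
    · clear h
      revert a
      decide

theorem notMem_reals_solve {a : ℕ} (ha : a ∈ [0, 1]) : a ∉ (solve M).reals := by
  have h := notMem_reals_shift (P := M) (show a < 100 by revert a; decide)
  simp only [solve, tryAll, tryChoice, block, Prog.reals, List.mem_append, not_or]
  refine ⟨?_, ?_, ?_, ?_, ⟨?_, ?_, ⟨?_, ?_, h, ?_, ?_, ?_, ?_⟩, ?_⟩, ?_⟩ <;>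
    · clear h
      revert a
      decide

theorem runs_solve (hM : FindsMST M T) (hI : Inst S σ) :
    Runs (solve M) σ fun t σ' =>
      t ≤ 2 ^ #{v : Fin n | (∃ e, S.Inc v e) ∧ ¬ S.Touched v ∧ 3 ≤ S.deg v} * (T m + 40 * m + 41) +
        800 * (m + p + 1) ∧
      SameOff (solve M).ints (solve M).reals σ σ' ∧
      ∃ D, S.Optimal D ∧ ∀ e : Fin m, .inl e ∉ S.Q → (1 ≤ σ'.int 50 (e : ℕ) ↔ e ∈ D) := by
  suffices hS : Runs (solve M) σ fun t σ' =>
      t ≤ 2 ^ #{v : Fin n | (∃ e, S.Inc v e) ∧ ¬ S.Touched v ∧ 3 ≤ S.deg v} * (T m + 40 * m + 41) +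
        800 * (m + p + 1) ∧
      ∃ D, S.Optimal D ∧ ∀ e : Fin m, .inl e ∉ S.Q → (1 ≤ σ'.int 50 (e : ℕ) ↔ e ∈ D) from
    hS.sameOff.mono fun t σ' h => ⟨h.1.1, h.2, h.1.2⟩
  rw [solve, runs_block_cons]
  refine (runs_computeDegrees hI).mono ?_
  rintro t1 σ1 ⟨ht1, hs1, hd1⟩
  have hI1 := hI.frame hs1 (by decide) (by decide)
  rw [runs_block_cons]
  refine (runs_computeThreads hI1 hd1).mono ?_
  rintro t2 σ2 ⟨ht2, hs2, rep, hT2⟩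
  have hI2 := hI1.frame hs2 (by decide) (by decide)
  have hd2 := hd1.frame hs2 (by decide)
  rw [runs_block_cons]
  refine (runs_contract hI2 hT2).mono ?_
  rintro t3 σ3 ⟨ht3, hs3, N, lab, hC3⟩
  have hI3 := hI2.frame hs3 (by decide) (by decide)
  have hd3 := hd2.frame hs3 (by decide)
  have hT3 := hT2.frame hs3 (by decide) (by decide)
  rw [runs_block_cons]
  refine (runs_computeCodes hI3 hd3).mono ?_
  rintro t4 σ4 ⟨ht4, hs4, k, hc4, hb4⟩
  have hS4 : Setup S rep lab (fun v => σ4.int 46 (v : ℕ)) k σ4 :=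
    ⟨hI3.frame hs4 (by decide) (by decide), hT3.frame hs4 (by decide) (by decide),
      hC3.frame hs4 (by decide), hc4, fun _ => rfl⟩
  rw [runs_block_cons]
  refine (runs_tryAll hM hS4 hb4).mono ?_
  rintro t5 σ5 ⟨ht5, h5⟩
  simp only [runs_block_nil]
  refine ⟨?_, h5⟩
  rw [hS4.card_branch]
  omega

end

section

open scoped Classical

namespace MixedGraph

variable {G : MixedGraph} {f : Fin G.m ⊕ Fin G.p → ℤ} {r : Fin G.n}

/-! ### Tours as Steiner trees -/

/-- Is the vertex in the component of `r` of the whole graph? -/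
def InRoot (r v : Fin G.n) : Prop := Conn G.tail G.head Set.univ v r

/-- Move all vertices outside the component of `r` to `r`. -/
noncomputable def toRoot (r v : Fin G.n) : Fin G.n := if InRoot r v then v else r

theorem toRoot_self : toRoot r r = r := by simp [toRoot]

theorem inRoot_head_iff {i : Fin G.m ⊕ Fin G.p} : InRoot r (G.head i) ↔ InRoot r (G.tail i) :=
  have h := Conn.edge (s := G.tail) (t := G.head) (Set.mem_univ i)
  ⟨fun h' => h.trans' h', fun h' => h.symm'.trans' h'⟩

theorem conn_toRoot {A : Set (Fin G.m ⊕ Fin G.p)} {u v : Fin G.n} (h : Conn G.tail G.head A u v) :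
    Conn (fun i => toRoot r (G.tail i)) (fun i => toRoot r (G.head i)) A (toRoot r u)
      (toRoot r v) :=
  h.map (φ := toRoot r) fun _ hi =>
    Conn.edge (s := fun i => toRoot r (G.tail i)) (t := fun i => toRoot r (G.head i)) hi

/-- The edges of the tours in a homology class whose total flow is zero have to connect the support
of the flow.  The edges outside the component of `r` are made loops at `r`. -/
noncomputable def steiner (h1 : ∀ a, f (.inr a) = 1) (r : Fin G.n) :
    Steiner (Fin G.n) (Fin G.m) (Fin G.p) where
  s i := toRoot r (G.tail i)
  t i := toRoot r (G.head i)
  r₀ := r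
  Q := supp f
  c e := G.cost (.inl e)
  c_pos e := G.cost_pos _
  mem_Q a := by simp [supp, h1]
  conn i := by
    by_cases h : InRoot r (G.tail i)
    · simpa only [toRoot_self] using conn_toRoot (r := r) h
    · rw [toRoot, if_neg h]
      exact .refl' _
  loop e he := by
    by_cases h : InRoot r (G.tail (.inl e))
    · rw [toRoot, toRoot, if_pos h, if_pos (inRoot_head_iff.2 h)] at he
      exact absurd he (G.no_loop e)
    · rw [toRoot, if_neg h]

variable {h1 : ∀ a, f (.inr a) = 1} {D : Finset (Fin G.m)}

theorem Connects.feasible (hD : Connects f r D) : (steiner h1 r).Feasible D := by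
  intro i hi
  have := conn_toRoot (r := r) (hD i hi)
  rwa [toRoot_self] at this

theorem Connects.inRoot (hD : Connects f r D) {i : Fin G.m ⊕ Fin G.p} (hi : i ∈ supp f) :
    InRoot r (G.tail i) :=
  (hD i (.inl hi)).mono (Set.subset_univ _)

theorem connects_of_feasible (hr : ∀ i ∈ supp f, InRoot r (G.tail i))
    (hD : (steiner h1 r).Feasible D) :
    Connects f r {e ∈ D | f (.inl e) = 0 ∧ InRoot r (G.tail (.inl e))} := by
  intro i hi
  have hir : InRoot r (G.tail i) := by
    rcases hi with hi | ⟨e, he, rfl⟩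
    · exact hr i hi
    · exact (mem_filter.1 (mem_coe.1 he)).2.2
  have hi' : i ∈ (steiner h1 r).Q ∪ Sum.inl '' (D : Set (Fin G.m)) := by
    refine hi.imp id ?_
    rintro ⟨e, he, rfl⟩
    exact ⟨e, (mem_filter.1 (mem_coe.1 he)).1, rfl⟩
  have hc := hD i hi'
  have hs : (steiner h1 r).s i = G.tail i := if_pos hir
  rw [hs] at hc
  refine hc.map (φ := id) fun j hj => ?_
  simp only [id_eq]
  by_cases hjr : InRoot r (G.tail j)
  · have e1 : (steiner h1 r).s j = G.tail j := if_pos hjr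
    have e2 : (steiner h1 r).t j = G.head j := if_pos (inRoot_head_iff.2 hjr)
    rw [e1, e2]
    refine .edge ?_
    rcases hj with hj | ⟨e, he, rfl⟩
    · exact .inl hj
    · by_cases hf : f (.inl e) = 0
      · exact .inr ⟨e, by simpa using ⟨he, hf, hjr⟩, rfl⟩
      · exact .inl hf
  · have e1 : (steiner h1 r).s j = r := if_neg hjr
    have e2 : (steiner h1 r).t j = r := if_neg fun h => hjr (inRoot_head_iff.1 h)
    rw [e1, e2]
    exact .refl' _

/-- An optimal Steiner tree yields an optimal tour. -/
theorem exists_isMinCostTourIn (hf : G.IsCirculation f)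
    (hr : (∃ i ∈ supp f, G.tail i = r) ∨ supp f = ∅) (hne : (homologyClass f).Nonempty)
    (hD : (steiner h1 r).Optimal D) : ∃ W, IsMinCostTourIn W f ∧
      (∀ e, W.count (.along (.inl e)) = (f (.inl e)).toNat +
        if e ∈ D ∧ f (.inl e) = 0 ∧ InRoot r (G.tail (.inl e)) then 1 else 0) ∧
      (∀ e, W.count (.back e) = (-f (.inl e)).toNat +
        if e ∈ D ∧ f (.inl e) = 0 ∧ InRoot r (G.tail (.inl e)) then 1 else 0) ∧
      ∀ a, W.count (.along (.inr a)) = 1 := by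
  obtain ⟨W₀, hW₀⟩ := hne
  obtain ⟨D₀, hD₀, -⟩ := exists_connects h1 hr hW₀
  obtain ⟨W, hW, h2, h3, h4, h5⟩ := exists_tour hf h1
    (connects_of_feasible (fun i hi => hD₀.inRoot hi) hD.1)
  refine ⟨W, ⟨hW, fun W' hW' => ?_⟩, by simpa only [mem_filter] using h2,
    by simpa only [mem_filter] using h3, h4⟩
  obtain ⟨D', hD', -, hle⟩ := exists_connects h1 hr hW'
  have h6 : ∑ e ∈ D, G.cost (.inl e) ≤ ∑ e ∈ D', G.cost (.inl e) := hD.2 D' hD'.feasible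
  have h7 : ∑ e ∈ D with f (.inl e) = 0 ∧ InRoot r (G.tail (.inl e)), G.cost (.inl e) ≤
      ∑ e ∈ D, G.cost (.inl e) :=
    sum_le_sum_of_subset_of_nonneg (filter_subset _ _) fun e _ _ => (G.cost_pos _).le
  linarith

theorem card_branch_le : #{v : Fin G.n | (∃ e, (steiner h1 r).Inc v e) ∧
    ¬ (steiner h1 r).Touched v ∧ 3 ≤ (steiner h1 r).deg v} ≤ G.branchCount := by
  refine card_le_card fun v hv => ?_
  simp only [mem_filter, mem_univ, true_and] at hv ⊢
  refine hv.2.2.trans (card_le_card fun e he => ?_)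
  have hvr : v ≠ r := fun h => hv.2.1 (.inl h)
  have key : ∀ u, toRoot r u = v → v = u := by
    intro u hu
    by_cases h : InRoot r u
    · rw [toRoot, if_pos h] at hu
      exact hu.symm
    · rw [toRoot, if_neg h] at hu
      exact absurd hu.symm hvr
  simp only [mem_filter, mem_univ, true_and] at he ⊢
  exact he.imp (key _) (key _)

/-! ### The program for tours -/

theorem LoadedIn.frame {σ σ' : State} (h : G.LoadedIn f σ) {li lr : List ℕ}
    (hs : SameOff li lr σ σ') (hi : ∀ a ∈ [0, 1, 2, 3, 4, 5, 6], a ∉ li)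
    (hr : ∀ a ∈ [0, 1], a ∉ lr) : G.LoadedIn f σ' := by
  have e0 := hs.1 0 (hi 0 (by decide))
  have e1 := hs.1 1 (hi 1 (by decide))
  have e2 := hs.1 2 (hi 2 (by decide))
  have e3 := hs.1 3 (hi 3 (by decide))
  have e4 := hs.1 4 (hi 4 (by decide))
  have e5 := hs.1 5 (hi 5 (by decide))
  have e6 := hs.1 6 (hi 6 (by decide))
  have r0 := hs.2 0 (hr 0 (by decide))
  have r1 := hs.2 1 (hr 1 (by decide))
  unfold LoadedIn at h ⊢
  rwa [e0, e1, e2, e3, e4, e5, e6, r0, r1]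

end MixedGraph

open MixedGraph

/-- Copy the ends of the edges to the arrays 34 and 35, with flags for the support in array 36, and choose
a vertex at the support as the root `30[0]`. -/
def collectEdges : Prog := forLoop 31 0 1 (block [
    .setInt 34 (reg 31) (elt 1),
    .setInt 35 (reg 31) (elt 2),
    .ifte (.conj (.intLE (elt 3) (.const 0)) (.intLE (.const 0) (elt 3)))
      (.setInt 36 (reg 31) (.const 0))
      (block [.setInt 36 (reg 31) (.const 1), .setInt 30 (.const 0) (elt 1)])])

/-- Append the arcs, which belong to the support.  As they are traversed once, the output in array 9 is
known. -/
def collectArcs : Prog := forLoop 31 0 2 (block [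
    .setInt 34 (.add (.get 0 (.const 1)) (reg 31)) (elt 4),
    .setInt 35 (.add (.get 0 (.const 1)) (reg 31)) (elt 5),
    .setInt 36 (.add (.get 0 (.const 1)) (reg 31)) (.const 1),
    .setInt 30 (.const 0) (elt 4),
    .setInt 9 (reg 31) (.const 1)])

/-- List the edges, the arcs and a loop at the root, which is vertex 0 if the support is empty. -/
def collect : Prog := block [
  .setInt 30 (.const 0) (.const 0),
  .setInt 37 (.const 0) (.add (.add (.get 0 (.const 1)) (.get 0 (.const 2))) (.const 1)),
  collectEdges,
  collectArcs,
  .setInt 34 (.add (.get 0 (.const 1)) (.get 0 (.const 2))) (reg 30),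
  .setInt 35 (.add (.get 0 (.const 1)) (.get 0 (.const 2))) (reg 30),
  .setInt 36 (.add (.get 0 (.const 1)) (.get 0 (.const 2))) (.const 1)]

variable {G : MixedGraph} {f : Fin G.m ⊕ Fin G.p → ℤ} {r : Fin G.n} {σ σ' : State}

theorem runs_collectEdges (h : G.LoadedIn f σ) (h0 : σ.int 30 0 = (r : ℕ)) :
    Runs collectEdges σ fun t σ' => t ≤ 9 * G.m + 2 ∧
      SameOff collectEdges.ints collectEdges.reals σ σ' ∧
      (∀ e : Fin G.m, σ'.int 34 (e : ℕ) = (G.tail (.inl e) : ℕ) ∧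
        σ'.int 35 (e : ℕ) = (G.head (.inl e) : ℕ) ∧ (1 ≤ σ'.int 36 (e : ℕ) ↔ f (.inl e) ≠ 0)) ∧
      ∃ r : Fin G.n, σ'.int 30 0 = (r : ℕ) ∧
        ((∃ i ∈ supp f, G.tail i = r) ∨ ∀ e, f (.inl e) = 0) := by
  refine (runs_forLoop G.m 7 (fun i τ => (∀ e : Fin G.m, (e : ℕ) < i →
      τ.int 34 (e : ℕ) = (G.tail (.inl e) : ℕ) ∧
        τ.int 35 (e : ℕ) = (G.head (.inl e) : ℕ) ∧ (1 ≤ τ.int 36 (e : ℕ) ↔ f (.inl e) ≠ 0)) ∧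
      ∃ r : Fin G.n, τ.int 30 0 = (r : ℕ) ∧
        ((∃ i ∈ supp f, G.tail i = r) ∨ ∀ e : Fin G.m, (e : ℕ) < i → f (.inl e) = 0)) h.2.1
    (by decide) (by decide) ⟨by simp, r, by simpa using h0, by simp⟩ ?_).mono ?_
  · rintro i hi τ hs hiv ⟨hI, r, hr, hr'⟩
    have hτ := h.frame hs (by decide) (by decide)
    obtain ⟨h1, h2, h3, -⟩ := hτ.2.2.2.1 ⟨i, hi⟩
    simp only at h1 h2 h3
    simp only [runs_block_cons, runs_block_nil, runs_setInt, runs_ifte, Test.holds, IExpr.eval,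
      putInt_int, hiv, h1, h2, h3, Nat.reduceEqDiff, if_true, if_false]
    have key : ∀ c : ℤ, (1 ≤ c ↔ f (.inl ⟨i, hi⟩) ≠ 0) → ∀ e : Fin G.m, (e : ℕ) < i + 1 →
        Function.update (τ.int 34) i (G.tail (.inl ⟨i, hi⟩) : ℕ) (e : ℕ) = (G.tail (.inl e) : ℕ) ∧
        Function.update (τ.int 35) i (G.head (.inl ⟨i, hi⟩) : ℕ) (e : ℕ) = (G.head (.inl e) : ℕ) ∧
        (1 ≤ Function.update (τ.int 36) i c (e : ℕ) ↔ f (.inl e) ≠ 0) := by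
      intro c hc e he
      rcases fin_lt_succ_cases hi he with h' | rfl
      · have : ((e : ℕ) : ℤ) ≠ i := by omega
        simpa only [Function.update_apply, if_neg this] using hI e h'
      · simpa using hc
    refine ⟨fun hc => ⟨by norm_num, key 0 ?_, r, hr, hr'.imp id fun h e he => ?_⟩,
      fun hc => ⟨by norm_num, key 1 ?_, G.tail (.inl ⟨i, hi⟩), by simp, .inl ⟨_, ?_, rfl⟩⟩⟩
    · exact iff_of_false (by norm_num) fun h => h (by omega)
    · rcases fin_lt_succ_cases hi he with h' | rfl
      · exact h e h'
      · omega
    · exact iff_of_true le_rfl fun h => hc (by omega)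
    · exact fun h => hc (by omega)
  · rintro t σ' ⟨ht, hs, hI, r, hr, hr'⟩
    exact ⟨ht, hs.mono (by decide) (by decide), fun e => hI e e.2, r, hr,
      hr'.imp id fun h e => h e e.2⟩

theorem runs_collectArcs (h : G.LoadedIn f σ) (h1 : ∀ a, f (.inr a) = 1) (h0 : σ.int 30 0 = (r : ℕ))
    (hr : (∃ i ∈ supp f, G.tail i = r) ∨ ∀ e, f (.inl e) = 0) :
    Runs collectArcs σ fun t σ' => t ≤ 8 * G.p + 2 ∧
      SameOff collectArcs.ints collectArcs.reals σ σ' ∧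
      (∀ j < (G.m : ℤ), σ'.int 34 j = σ.int 34 j ∧ σ'.int 35 j = σ.int 35 j ∧
        σ'.int 36 j = σ.int 36 j) ∧
      (∀ a : Fin G.p, σ'.int 34 (G.m + a : ℕ) = (G.tail (.inr a) : ℕ) ∧
        σ'.int 35 (G.m + a : ℕ) = (G.head (.inr a) : ℕ) ∧ 1 ≤ σ'.int 36 (G.m + a : ℕ) ∧
        σ'.int 9 (a : ℕ) = 1) ∧
      ∃ r : Fin G.n, σ'.int 30 0 = (r : ℕ) ∧ ((∃ i ∈ supp f, G.tail i = r) ∨ supp f = ∅) := by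
  refine (runs_forLoop G.p 6 (fun i τ => (∀ j < (G.m : ℤ), τ.int 34 j = σ.int 34 j ∧
        τ.int 35 j = σ.int 35 j ∧ τ.int 36 j = σ.int 36 j) ∧
      (∀ a : Fin G.p, (a : ℕ) < i → τ.int 34 (G.m + a : ℕ) = (G.tail (.inr a) : ℕ) ∧
        τ.int 35 (G.m + a : ℕ) = (G.head (.inr a) : ℕ) ∧ 1 ≤ τ.int 36 (G.m + a : ℕ) ∧
        τ.int 9 (a : ℕ) = 1) ∧
      ∃ r : Fin G.n, τ.int 30 0 = (r : ℕ) ∧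
        ((∃ i ∈ supp f, G.tail i = r) ∨ i = 0 ∧ ∀ e, f (.inl e) = 0)) h.2.2.1
    (by decide) (by decide) ⟨by simp, by simp, r, by simpa using h0, by simpa using hr⟩ ?_).mono ?_
  · rintro i hi τ hs hiv ⟨hI, hI', -⟩
    have hτ := h.frame hs (by decide) (by decide)
    obtain ⟨h2, h3, -⟩ := hτ.2.2.2.2 ⟨i, hi⟩
    have h4 := hτ.2.1
    simp only at h2 h3
    simp only [runs_block_cons, runs_block_nil, runs_setInt, IExpr.eval, putInt_int, hiv, h2, h3, h4,
      Nat.reduceEqDiff, if_true, if_false]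
    refine ⟨by norm_num, fun j hj => ?_, fun a ha => ?_, G.tail (.inr ⟨i, hi⟩), by simp,
      .inl ⟨.inr ⟨i, hi⟩, by simp [supp, h1], rfl⟩⟩
    · have : j ≠ G.m + i := by omega
      simpa only [Function.update_apply, if_neg this] using hI j hj
    · rcases fin_lt_succ_cases hi ha with h' | rfl
      · have n1 : ((G.m + a : ℕ) : ℤ) ≠ G.m + i := by omega
        have n2 : ((a : ℕ) : ℤ) ≠ i := by omega
        simpa only [Function.update_apply, if_neg n1, if_neg n2] using hI' a h'
      · simp
  · rintro t σ' ⟨ht, hs, hI, hI', r, hr, hr'⟩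
    refine ⟨ht, hs.mono (by decide) (by decide), hI, fun a => hI' a a.2, r, hr, ?_⟩
    refine hr'.imp id ?_
    rintro ⟨hp, he⟩
    refine Set.eq_empty_of_forall_notMem ?_
    rintro (e | a) hi
    · exact hi (he e)
    · have := a.2
      omega

theorem runs_collect (h : G.LoadedIn f σ) (h1 : ∀ a, f (.inr a) = 1) (hn : 0 < G.n) :
    Runs collect σ fun t σ' => t ≤ 9 * (G.m + G.p + 1) + 10 ∧
      SameOff collect.ints collect.reals σ σ' ∧
      ∃ r : Fin G.n, σ'.int 30 0 = (r : ℕ) ∧ ((∃ i ∈ supp f, G.tail i = r) ∨ supp f = ∅) ∧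
      HoldsSlots (σ'.int 34) (σ'.int 35) G.tail G.head r ∧ σ'.int 37 0 = (G.m + G.p + 1 : ℕ) ∧
      (∀ e : Fin G.m, 1 ≤ σ'.int 36 (e : ℕ) ↔ f (.inl e) ≠ 0) ∧
      (∀ a : Fin G.p, 1 ≤ σ'.int 36 (G.m + a : ℕ)) ∧ 1 ≤ σ'.int 36 (G.m + G.p : ℕ) ∧
      ∀ a : Fin G.p, σ'.int 9 (a : ℕ) = 1 := by
  suffices hS : Runs collect σ fun t σ' => t ≤ 9 * (G.m + G.p + 1) + 10 ∧
      ∃ r : Fin G.n, σ'.int 30 0 = (r : ℕ) ∧ ((∃ i ∈ supp f, G.tail i = r) ∨ supp f = ∅) ∧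
      HoldsSlots (σ'.int 34) (σ'.int 35) G.tail G.head r ∧ σ'.int 37 0 = (G.m + G.p + 1 : ℕ) ∧
      (∀ e : Fin G.m, 1 ≤ σ'.int 36 (e : ℕ) ↔ f (.inl e) ≠ 0) ∧
      (∀ a : Fin G.p, 1 ≤ σ'.int 36 (G.m + a : ℕ)) ∧ 1 ≤ σ'.int 36 (G.m + G.p : ℕ) ∧
      ∀ a : Fin G.p, σ'.int 9 (a : ℕ) = 1 from
    hS.sameOff.mono fun t σ' h => ⟨h.1.1, h.2, h.1.2⟩
  rw [collect]
  simp only [runs_block_cons, runs_setInt, IExpr.eval, putInt_int, h.2.1, h.2.2.1, Nat.reduceEqDiff,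
    if_false]
  set σ1 := (σ.putInt 30 0 0).putInt 37 0 (G.m + G.p + 1) with hσ1
  have hs1 : SameOff [30, 37] [] σ σ1 :=
    ⟨fun a ha => by
      simp only [List.mem_cons, List.not_mem_nil, or_false, not_or] at ha
      simp only [hσ1, putInt_int, ha, if_false], fun _ _ => rfl⟩
  have hL1 := h.frame hs1 (by decide) (by decide)
  have h37 : σ1.int 37 0 = (G.m + G.p + 1 : ℕ) := by simp [hσ1]
  refine (runs_collectEdges hL1 (r := ⟨0, hn⟩) (by simp [hσ1])).mono ?_
  rintro t2 σ2 ⟨ht2, hs2, h2, r2, hr2, hr2'⟩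
  have hL2 := hL1.frame hs2 (by decide) (by decide)
  refine (runs_collectArcs hL2 h1 hr2 hr2').mono ?_
  rintro t3 σ3 ⟨ht3, hs3, h3, h3', r, hr, hr'⟩
  have hL3 := hL2.frame hs3 (by decide) (by decide)
  have e37 : σ3.int 37 0 = (G.m + G.p + 1 : ℕ) := by
    rw [hs3.1 37 (by decide), hs2.1 37 (by decide), h37]
  simp only [hL3.2.1, hL3.2.2.1, hr, runs_block_nil]
  have n1 : ∀ e : Fin G.m, ((e : ℕ) : ℤ) ≠ (G.m : ℤ) + G.p := fun e => by omega
  have n2 : ∀ a : Fin G.p, ((G.m + a : ℕ) : ℤ) ≠ (G.m : ℤ) + G.p := fun a => by omega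
  have n3 : ((G.m + G.p : ℕ) : ℤ) = (G.m : ℤ) + G.p := by omega
  refine ⟨by omega, r, hr, hr', ⟨fun e => ?_, fun a => ?_, ?_⟩, e37, fun e => ?_, fun a => ?_, ?_,
    fun a => (h3' a).2.2.2⟩
  · simp only [putInt_int, Nat.reduceEqDiff, if_true, if_false]
    rw [Function.update_of_ne (n1 e), Function.update_of_ne (n1 e), (h3 _ (by omega)).1,
      (h3 _ (by omega)).2.1]
    exact ⟨(h2 e).1, (h2 e).2.1⟩
  · simp only [putInt_int, Nat.reduceEqDiff, if_true, if_false]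
    rw [Function.update_of_ne (n2 a), Function.update_of_ne (n2 a)]
    exact ⟨(h3' a).1, (h3' a).2.1⟩
  · simp only [putInt_int, Nat.reduceEqDiff, if_true, if_false]
    rw [n3, Function.update_self, Function.update_self]
    exact ⟨rfl, rfl⟩
  · simp only [putInt_int, Nat.reduceEqDiff, if_true, if_false]
    rw [Function.update_of_ne (n1 e), (h3 _ (by omega)).2.2]
    exact (h2 e).2.2
  · simp only [putInt_int, Nat.reduceEqDiff, if_true, if_false]
    rw [Function.update_of_ne (n2 a)]
    exact (h3' a).2.2.1
  · simp only [putInt_int, Nat.reduceEqDiff, if_true, if_false]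
    rw [n3, Function.update_self]

/-- Flags for the edges in the component of the root (array 33); the other edges are made loops. -/
def restrict : Prog := forLoop 31 0 1
  (.ifte (.conj (.intLE (.get 14 (elt 34)) (.get 14 (reg 30)))
      (.intLE (.get 14 (reg 30)) (.get 14 (elt 34))))
    (.setInt 33 (reg 31) (.const 1))
    (block [
      .setInt 33 (reg 31) (.const 0),
      .setInt 34 (reg 31) (reg 30),
      .setInt 35 (reg 31) (reg 30)]))

theorem runs_restrict (h : G.LoadedIn f σ) (hr : σ.int 30 0 = (r : ℕ))
    (hs : HoldsSlots (σ.int 34) (σ.int 35) G.tail G.head r)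
    (harc : ∀ a, InRoot r (G.tail (.inr a)))
    (hlab : ∀ e : Fin G.m, σ.int 14 (G.tail (.inl e) : ℕ) = σ.int 14 (r : ℕ) ↔
      InRoot r (G.tail (.inl e))) :
    Runs restrict σ fun t σ' => t ≤ 7 * G.m + 2 ∧ SameOff restrict.ints restrict.reals σ σ' ∧
      (∀ e : Fin G.m, 1 ≤ σ'.int 33 (e : ℕ) ↔ InRoot r (G.tail (.inl e))) ∧
      HoldsSlots (σ'.int 34) (σ'.int 35) (fun i => toRoot r (G.tail i))
        (fun i => toRoot r (G.head i)) r := by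
  refine (runs_forLoop G.m 5 (fun i τ => (∀ e : Fin G.m, (e : ℕ) < i →
      (1 ≤ τ.int 33 (e : ℕ) ↔ InRoot r (G.tail (.inl e))) ∧
      τ.int 34 (e : ℕ) = (toRoot r (G.tail (.inl e)) : ℕ) ∧
      τ.int 35 (e : ℕ) = (toRoot r (G.head (.inl e)) : ℕ)) ∧
      ∀ j : ℕ, i ≤ j → τ.int 34 j = σ.int 34 j ∧ τ.int 35 j = σ.int 35 j) h.2.1
    (by decide) (by decide) (by simp) ?_).mono ?_
  · rintro i hi τ hsτ hiv ⟨hI, hI'⟩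
    have e14 := hsτ.1 14 (by decide)
    have e30 := hsτ.1 30 (by decide)
    have hU : τ.int 34 i = (G.tail (.inl ⟨i, hi⟩) : ℕ) :=
      (hI' i le_rfl).1.trans (hs.edge ⟨i, hi⟩).1
    have hV : τ.int 35 i = (G.head (.inl ⟨i, hi⟩) : ℕ) :=
      (hI' i le_rfl).2.trans (hs.edge ⟨i, hi⟩).2
    have hl := hlab ⟨i, hi⟩
    simp only [runs_block_cons, runs_block_nil, runs_setInt, runs_ifte, Test.holds, IExpr.eval,
      putInt_int, hiv, e14, e30, hr, hU, Nat.reduceEqDiff, if_true, if_false]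
    refine ⟨fun hc => ⟨by norm_num, fun e he => ?_, fun j hj => hI' j (by omega)⟩,
      fun hc => ⟨by norm_num, fun e he => ?_, fun j hj => ?_⟩⟩
    · have hin := hl.1 (by omega)
      rcases fin_lt_succ_cases hi he with h' | rfl
      · have : ((e : ℕ) : ℤ) ≠ i := by omega
        simpa only [Function.update_apply, if_neg this] using hI e h'
      · simp only [Function.update_self, le_refl, hin, hU, hV, toRoot,
          inRoot_head_iff, if_true, true_and]
    · have hin : ¬ InRoot r (G.tail (.inl ⟨i, hi⟩)) := fun h => hc (by have := hl.2 h; omega)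
      rcases fin_lt_succ_cases hi he with h' | rfl
      · have : ((e : ℕ) : ℤ) ≠ i := by omega
        simpa only [Function.update_apply, if_neg this] using hI e h'
      · simp [hin, toRoot, inRoot_head_iff]
    · rw [Function.update_of_ne (by omega), Function.update_of_ne (by omega)]
      exact hI' j (by omega)
  · rintro t σ' ⟨ht, hs', hI, hI'⟩
    refine ⟨ht, hs'.mono (by decide) (by decide), fun e => (hI e e.2).1,
      fun e => (hI e e.2).2, fun a => ?_, ?_⟩
    · rw [(hI' (G.m + a) (by omega)).1, (hI' (G.m + a) (by omega)).2, (hs.arc a).1, (hs.arc a).2,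
        toRoot, if_pos (harc a), toRoot, if_pos (inRoot_head_iff.2 (harc a))]
      exact ⟨rfl, rfl⟩
    · rw [(hI' (G.m + G.p) (by omega)).1, (hI' (G.m + G.p) (by omega)).2]
      exact hs.root

/-- Write the output. -/
def writeTour : Prog := forLoop 31 0 1
  (.ifte (.intLE (.const 1) (elt 3))
    (block [.setInt 7 (reg 31) (elt 3), .setInt 8 (reg 31) (.const 0)])
    (.ifte (.intLE (elt 3) (.const (-1)))
      (block [.setInt 7 (reg 31) (.const 0), .setInt 8 (reg 31) (.sub (.const 0) (elt 3))])
      (.ifte (.conj (.intLE (.const 1) (elt 50)) (.intLE (.const 1) (elt 33)))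
        (block [.setInt 7 (reg 31) (.const 1), .setInt 8 (reg 31) (.const 1)])
        (block [.setInt 7 (reg 31) (.const 0), .setInt 8 (reg 31) (.const 0)]))))

theorem runs_writeTour {D : Finset (Fin G.m)} (h : G.LoadedIn f σ)
    (hin : ∀ e : Fin G.m, 1 ≤ σ.int 33 (e : ℕ) ↔ InRoot r (G.tail (.inl e)))
    (hD : ∀ e : Fin G.m, f (.inl e) = 0 → (1 ≤ σ.int 50 (e : ℕ) ↔ e ∈ D)) :
    Runs writeTour σ fun t σ' => t ≤ 9 * G.m + 2 ∧
      SameOff writeTour.ints writeTour.reals σ σ' ∧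
      ∀ e : Fin G.m, σ'.int 7 (e : ℕ) = ((f (.inl e)).toNat +
        if e ∈ D ∧ f (.inl e) = 0 ∧ InRoot r (G.tail (.inl e)) then 1 else 0 : ℕ) ∧
      σ'.int 8 (e : ℕ) = ((-f (.inl e)).toNat +
        if e ∈ D ∧ f (.inl e) = 0 ∧ InRoot r (G.tail (.inl e)) then 1 else 0 : ℕ) := by
  refine (runs_forLoop G.m 7 (fun i τ => ∀ e : Fin G.m, (e : ℕ) < i →
      τ.int 7 (e : ℕ) = ((f (.inl e)).toNat +
        if e ∈ D ∧ f (.inl e) = 0 ∧ InRoot r (G.tail (.inl e)) then 1 else 0 : ℕ) ∧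
      τ.int 8 (e : ℕ) = ((-f (.inl e)).toNat +
        if e ∈ D ∧ f (.inl e) = 0 ∧ InRoot r (G.tail (.inl e)) then 1 else 0 : ℕ)) h.2.1
    (by decide) (by decide) (by simp) ?_).mono ?_
  · intro i hi τ hs hiv hI
    have hτ := h.frame hs (by decide) (by decide)
    have h3 := (hτ.2.2.2.1 ⟨i, hi⟩).2.2.1
    have e33 := hs.1 33 (by decide)
    have e50 := hs.1 50 (by decide)
    have hini := hin ⟨i, hi⟩
    have hDi := hD ⟨i, hi⟩
    simp only at h3 hini hDi
    simp only [runs_block_cons, runs_block_nil, runs_setInt, runs_ifte, Test.holds, IExpr.eval,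
      putInt_int, hiv, h3, e33, e50, hini, Nat.reduceEqDiff, if_true, if_false]
    have key : ∀ a b : ℤ, a = ((f (.inl ⟨i, hi⟩)).toNat +
        if ⟨i, hi⟩ ∈ D ∧ f (.inl ⟨i, hi⟩) = 0 ∧ InRoot r (G.tail (.inl ⟨i, hi⟩)) then 1 else 0 : ℕ) →
        b = ((-f (.inl ⟨i, hi⟩)).toNat +
        if ⟨i, hi⟩ ∈ D ∧ f (.inl ⟨i, hi⟩) = 0 ∧ InRoot r (G.tail (.inl ⟨i, hi⟩)) then 1 else 0 : ℕ) →
        ∀ e : Fin G.m, (e : ℕ) < i + 1 →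
        Function.update (τ.int 7) i a (e : ℕ) = ((f (.inl e)).toNat +
          if e ∈ D ∧ f (.inl e) = 0 ∧ InRoot r (G.tail (.inl e)) then 1 else 0 : ℕ) ∧
        Function.update (τ.int 8) i b (e : ℕ) = ((-f (.inl e)).toNat +
          if e ∈ D ∧ f (.inl e) = 0 ∧ InRoot r (G.tail (.inl e)) then 1 else 0 : ℕ) := by
      intro a b ha hb e he
      rcases fin_lt_succ_cases hi he with h' | rfl
      · have : ((e : ℕ) : ℤ) ≠ i := by omega
        simpa only [Function.update_apply, if_neg this] using hI e h'
      · rw [Function.update_self, Function.update_self]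
        exact ⟨ha, hb⟩
    refine ⟨fun hpos => ⟨by norm_num, key _ _ ?_ ?_⟩, fun hpos => ⟨fun hneg => ⟨by norm_num,
      key _ _ ?_ ?_⟩, fun hneg => ?_⟩⟩
    · rw [if_neg (by omega)]; omega
    · rw [if_neg (by omega)]; omega
    · rw [if_neg (by omega)]; omega
    · rw [if_neg (by omega)]; omega
    · have hz : f (.inl ⟨i, hi⟩) = 0 := by omega
      rw [hDi hz]
      refine ⟨fun hc => ⟨by norm_num, key _ _ ?_ ?_⟩, fun hc => ⟨by norm_num, key _ _ ?_ ?_⟩⟩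
      · rw [if_pos ⟨hc.1, hz, hc.2⟩, hz]; rfl
      · rw [if_pos ⟨hc.1, hz, hc.2⟩, hz]; rfl
      · rw [if_neg (by tauto), hz]; rfl
      · rw [if_neg (by tauto), hz]; rfl
  · rintro t σ' ⟨ht, hs, hI⟩
    exact ⟨ht, hs.mono (by decide) (by decide), fun e => hI e e.2⟩

/-- Find a tour of minimum cost in a homology class, by means of the program `M` for minimum spanning
trees. -/
def findTour (M : Prog) : Prog := block [
  collect, labelSlots (.const 1), restrict, solve M, writeTour]

/-- The program reads its input. -/
theorem FindsMST.le {M : Prog} {T : ℕ → ℕ} (hM : FindsMST M T) (m : ℕ) : 3 * m + 2 ≤ T m := by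
  obtain ⟨t, σ', -, ht, -⟩ := hM ⟨1, m, fun _ => (0, 0), fun _ => 1, fun _ => one_pos⟩
    ⟨one_pos, fun u v => by rw [Subsingleton.elim u v]; exact .refl _⟩
    ⟨fun a i => if a = 0 then if i = 0 then 1 else m else 0, fun _ _ => 1⟩
    ⟨by simp, by simp, fun e => by simp⟩
  simp only [WeightedGraph.inputSize] at ht
  omega

theorem runs_findTour {M : Prog} {T : ℕ → ℕ} (hM : FindsMST M T) (hf : G.IsCirculation f)
    (h1 : ∀ a, f (.inr a) = 1) (hne : (homologyClass f).Nonempty) (h : G.LoadedIn f σ) :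
    Runs (findTour M) σ fun t σ' => t ≤ 2 ^ G.branchCount * (T G.m + 40 * G.m + 41) +
        1100 * (G.m + G.p + 1) ∧
      ∃ W, IsMinCostTourIn W f ∧ ReturnedIn W σ' := by
  have hn : 0 < G.n := by
    obtain ⟨W, ⟨v, -⟩, -⟩ := hne
    exact v.pos
  rw [findTour, runs_block_cons]
  refine (runs_collect h h1 hn).mono ?_
  rintro t1 σ1 ⟨ht1, hs1, r, hr1, hr, hsl1, h37, hfl, hfa, hfr, h9⟩
  have hL1 := h.frame hs1 (by decide) (by decide)
  have hroot : ∀ i ∈ supp f, InRoot r (G.tail i) := by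
    obtain ⟨W₀, hW₀⟩ := hne
    obtain ⟨D₀, hD₀, -⟩ := exists_connects h1 hr hW₀
    exact fun i hi => hD₀.inRoot hi
  rw [runs_block_cons]
  refine (runs_labelSlots (B := Set.univ) (φ := fun _ => 1) h37 hsl1 (fun τ j hj h31 hs => rfl)
    (fun e => by simp) (fun a => by simp)).mono ?_
  rintro t2 σ2 ⟨ht2, hs2, cnt, -, -, hlab, -⟩
  have hL2 := hL1.frame hs2 (by decide) (by decide)
  rw [runs_block_cons]
  refine (runs_restrict hL2 (r := r) (by rw [hs2.1 30 (by decide), hr1])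
    (by rw [hs2.1 34 (by decide), hs2.1 35 (by decide)]; exact hsl1)
    (fun a => hroot _ (by simp [supp, h1]))
    fun e => hlab _ _ (.inr ⟨_, .inl rfl⟩) (.inl rfl)).mono ?_
  rintro t3 σ3 ⟨ht3, hs3, h33, hsl3⟩
  have hL3 := hL2.frame hs3 (by decide) (by decide)
  have e36 : σ3.int 36 = σ1.int 36 := (hs3.1 36 (by decide)).trans (hs2.1 36 (by decide))
  have hI : Inst (steiner h1 r) σ3 :=
    ⟨hL3.2.1, by rw [hs3.1 37 (by decide), hs2.1 37 (by decide), h37], hsl3,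
      by rw [e36]; exact hfl, by rw [e36]; exact hfa, by rw [e36]; exact hfr,
      fun e => (hL3.2.2.2.1 e).2.2.2⟩
  rw [runs_block_cons]
  refine (runs_solve hM hI).mono ?_
  rintro t4 σ4 ⟨ht4, hs4, D, hD, h50⟩
  have hL4 := hL3.frame hs4 (fun a ha => notMem_ints_solve (List.mem_append_left [7, 8, 9, 33] ha))
    fun a ha => notMem_reals_solve ha
  rw [← hs4.1 33 (notMem_ints_solve (by decide))] at h33
  rw [runs_block_cons]
  refine (runs_writeTour hL4 h33 fun e he => h50 e fun h => h he).mono ?_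
  rintro t5 σ5 ⟨ht5, hs5, h5⟩
  simp only [runs_block_nil]
  obtain ⟨W, hW, hW1, hW2, hW3⟩ := exists_isMinCostTourIn hf hr hne hD
  refine ⟨?_, W, hW, fun e => ?_, fun a => ?_⟩
  · have h6 := Nat.mul_le_mul_right (T G.m + 40 * G.m + 41)
      (Nat.pow_le_pow_right two_pos (card_branch_le (h1 := h1) (r := r)))
    omega
  · rw [hW1, hW2]
    exact h5 e
  · rw [hW3, hs5.1 9 (by decide), hs4.1 9 (notMem_ints_solve (by decide)), hs3.1 9 (by decide),
      hs2.1 9 (by decide), h9]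
    rfl

end

end StackerCrane

theorem mainTheorem6 (M : Prog) (T : ℕ → ℕ) (hM : FindsMST M T) :
    ∃ (P : Prog) (C : ℕ), ∀ (G : MixedGraph) (f : Fin G.m ⊕ Fin G.p → ℤ),
      G.IsCirculation f → (∀ a : Fin G.p, f (.inr a) = 1) →
      (MixedGraph.homologyClass f).Nonempty →
      ∀ σ : State, G.LoadedIn f σ →
        ∃ (t : ℕ) (σ' : State), Exec P σ t σ' ∧
          G.inputSize + t ≤ C * (G.p + 2 ^ G.branchCount * T G.m) ∧
          ∃ W : List G.Step, MixedGraph.IsMinCostTourIn W f ∧ MixedGraph.ReturnedIn W σ' := by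
  refine ⟨findTour M, 5000, fun G f hf h1 hne σ hσ => ?_⟩
  obtain ⟨t, σ', hex, ht, hW⟩ := runs_findTour hM hf h1 hne hσ
  refine ⟨t, σ', hex, ?_, hW⟩
  -- the input size is at most linear in `G.p` and `T G.m`
  have h2 := hM.le G.m
  have h3 : T G.m ≤ 2 ^ G.branchCount * T G.m := Nat.le_mul_of_pos_left _ (by positivity)
  have h4 : 2 ^ G.branchCount * (T G.m + 40 * G.m + 41) ≤ 2 ^ G.branchCount * (82 * T G.m) :=
    Nat.mul_le_mul_left _ (by omega)
  rw [Nat.mul_left_comm] at h4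
  rw [MixedGraph.inputSize]
  omega
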